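/- **Polyhedral maps on the plane.** A *polyhedral map* $Y$ on $\mathbb{R}^2$ consists of a set $V\subset\mathbb{R}^2$ of vertices, a set of edges and a set of faces such that: each edge is a simple arc meeting $V$ exactly in its two end points, and two distinct edges meet only in vertices; each face is a closed topological disc whose intersection with the edge graph (the union of all vertices and edges) is its boundary circle, and this circle is a cycle of the edge graph with $n$ vertices for some $n\ge 3$ (the face is then called an $n$-gon); two distinct faces are disjoint or meet in exactly one vertex or exactly one edge; the faces cover $\mathbb{R}^2$ and form a locally finite family. An *isomorphism* of polyhedral maps is a triple of bijections, between the vertices, the edges and the faces, preserving incidence in both directions; we write $Y\cong Y'$. $Y$ is *semi-equivelar of type* $[p_1^{n_1},\dots,p_k^{n_k}]$ if at every vertex $v$ the edges and faces containing $v$ can be listed without repetition in a cyclic order in which edges and faces alternate, each face containing its two neighbouring edges, such that the faces in this order are $n_1$ $p_1$-gons, then $n_2$ $p_2$-gons, $\dots$, then $n_k$ $p_k$-gons. **The tilings.** For $i,j\in\mathbb{Z}$ let $$u_{i,j}=\lfloor i/2\rfloor\left(1+\tfrac{\sqrt3}{2},-\tfrac12\right)+\lfloor j/2\rfloor\left(\tfrac12,1+\tfrac{\sqrt3}{2}\right)+(i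 \bmod 2,\ j \bmod 2).$$ The *snub square tiling* $E_2$ has vertices $u_{i,j}$; its edges are the segments $u_{i,j}u_{i+1,j}$ and $u_{i,j}u_{i,j+1}$ for all $i,j$, the segments $u_{i,j}u_{i+1,j+1}$ for $i$ odd and $j$ even, and the segments $u_{i+1,j}u_{i,j+1}$ for $i$ even and $j$ odd. Its faces are the squares with vertices $u_{i,j},u_{i+1,j},u_{i+1,j+1},u_{i,j+1}$ for $i+j$ even, and, for $i+j$ odd, the two triangles into which the quadrangle $u_{i,j}u_{i+1,j}u_{i+1,j+1}u_{i,j+1}$ is divided by the diagonal just named. Let $v_{i,j}=i(2,0)+j(1,\sqrt3)$, $w_{i,j}=v_{i,j}+(1,0)$, and redefine $u_{i,j}=v_{i,j}+(\tfrac32,\tfrac{\sqrt3}{2})$. The *trihexagonal tiling* $E_6$ has vertices $u_{i,j},v_{i,j},w_{i,j}$ ($i,j\in\mathbb{Z}$), edges the segments $v_{i,j}w_{i,j}$, $w_{i,j}v_{i+1,j}$, $w_{i,j}u_{i,j}$, $v_{i+1,j}u_{i,j}$, $u_{i,j}v_{i,j+1}$, $u_{i,j}w_{i,j+1}$, and faces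 the triangles $w_{i,j}v_{i+1,j}u_{i,j}$ and $v_{i,j+1}w_{i,j+1}u_{i,j}$ and the regular hexagons $v_{i,j}w_{i,j}u_{i,j}v_{i,j+1}w_{i-1,j+1}u_{i-1,j}$. **Lemma.** Let $Y$ be a semi-equivelar polyhedral map on the plane $\mathbb{R}^2$. (a) If $Y$ is of type $[3^2,4^1,3^1,4^1]$, then $Y\cong E_2$. (b) If $Y$ is of type $[3^1,6^1,3^1,6^1]$, then $Y\cong E_6$. -/

import Mathlib

/-- The Euclidean plane `ℝ²`. -/
abbrev Plane : Type := EuclideanSpace ℝ (Fin 2)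

/-- The raw data of a cell structure on `ℝ²`: a set of points (vertices), and two families of
closed subsets (the closed edges and the closed faces). -/
structure PlaneCells where
  verts : Set Plane
  edges : Set (Set Plane)
  faces : Set (Set Plane)

namespace PlaneCells

/-- The union of all vertices and edges (the carrier of the embedded edge graph). -/
def graph (M : PlaneCells) : Set Plane := M.verts ∪ ⋃₀ M.edges

/-- `e` is a simple arc that meets the vertex set exactly in its two end points. -/
def IsEdgeArc (M : PlaneCells) (e : Set Plane) : Prop :=
  ∃ γ : unitInterval → Plane, Continuous γ ∧ Function.Injective γ ∧ Set.range γ = e ∧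
    e ∩ M.verts = {γ 0, γ 1}

/-- `f` is a closed topological disc which meets the edge graph exactly in the boundary circle of
the disc, and that circle is an `n`-cycle `v₀-v₁-⋯-vₙ₋₁-v₀` of the edge graph with `n ≥ 3`. Here
`finRotate n` is the cyclic successor `i ↦ i + 1`. -/
def IsPolygon (M : PlaneCells) (f : Set Plane) : Prop :=
  ∃ h : Metric.closedBall (0 : Plane) 1 → Plane,
    Continuous h ∧ Function.Injective h ∧ Set.range h = f ∧
    f ∩ M.graph = h '' {x | ‖(x : Plane)‖ = 1} ∧
    ∃ n : ℕ, 3 ≤ n ∧ ∃ (v : Fin n → Plane) (e : Fin n → Set Plane),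
      Function.Injective v ∧ (∀ i, v i ∈ M.verts) ∧
      (∀ i, e i ∈ M.edges ∧ e i ∩ M.verts = {v i, v (finRotate n i)}) ∧
      h '' {x | ‖(x : Plane)‖ = 1} = ⋃ i, e i

/-- The cells form a (locally finite) polyhedral map on the plane `ℝ²`. -/
structure IsPolyhedralMap (M : PlaneCells) : Prop where
  edge_arc : ∀ e ∈ M.edges, M.IsEdgeArc e
  edge_inter : ∀ e ∈ M.edges, ∀ e' ∈ M.edges, e ≠ e' → e ∩ e' ⊆ M.verts
  face_polygon : ∀ f ∈ M.faces, M.IsPolygon f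
  face_inter : ∀ f ∈ M.faces, ∀ f' ∈ M.faces, f ≠ f' →
    f ∩ f' = ∅ ∨ (∃ v ∈ M.verts, f ∩ f' = {v}) ∨ f ∩ f' ∈ M.edges
  cover : ⋃₀ M.faces = Set.univ
  locallyFinite : LocallyFinite (fun f : M.faces => (f : Set Plane))

/-- The number of vertices on the face `f`, so that `f` is an `M.size f`-gon. -/
noncomputable def size (M : PlaneCells) (f : Set Plane) : ℕ := (f ∩ M.verts).ncard

/-- The face-cycle at `v` reads `p` (up to the choice of a starting face and of a direction): with
`d` the length of `p`, the faces containing `v` are `F₀, …, F_{d-1}`, the edges containing `v` are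
`e₀, …, e_{d-1}`, cyclically `Fᵢ` lies between `eᵢ` and `eᵢ₊₁`, and `Fᵢ` is a `pᵢ`-gon. -/
def HasFaceCycle (M : PlaneCells) (v : Plane) (p : List ℕ) : Prop :=
  ∃ e F : Fin p.length → Set Plane,
    Function.Injective e ∧ Set.range e = {a | a ∈ M.edges ∧ v ∈ a} ∧
    Function.Injective F ∧ Set.range F = {f | f ∈ M.faces ∧ v ∈ f} ∧
    ∀ i, e i ⊆ F i ∧ e (finRotate p.length i) ⊆ F i ∧ M.size (F i) = p.get i

/-- All vertices have face-cycle of type `[p₁^{n₁}, …, p_k^{n_k}]`, a path of `n₁` `p₁`-gons followed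
by a path of `n₂` `p₂`-gons and so on cyclically. The type is given as the list of the pairs
`(pᵢ, nᵢ)`. -/
def IsSemiEquivelarOfType (M : PlaneCells) (t : List (ℕ × ℕ)) : Prop :=
  ∀ v ∈ M.verts, M.HasFaceCycle v (t.flatMap fun a => List.replicate a.2 a.1)

/-- Isomorphism of maps: bijections between the vertices, the edges and the faces that preserve and
reflect incidence. -/
def Isomorphic (M N : PlaneCells) : Prop :=
  ∃ (φ : M.verts ≃ N.verts) (ψ : M.edges ≃ N.edges) (χ : M.faces ≃ N.faces),
    (∀ (v : M.verts) (e : M.edges), (v : Plane) ∈ (e : Set Plane) ↔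
      (φ v : Plane) ∈ (ψ e : Set Plane)) ∧
    (∀ (v : M.verts) (f : M.faces), (v : Plane) ∈ (f : Set Plane) ↔
      (φ v : Plane) ∈ (χ f : Set Plane)) ∧
    (∀ (e : M.edges) (f : M.faces), (e : Set Plane) ⊆ (f : Set Plane) ↔
      (ψ e : Set Plane) ⊆ (χ f : Set Plane))

end PlaneCells

namespace SnubSquare

/-- The vertices `u_{i,j}` of the snub square tiling with edge length `1`. The translations of the
tiling are spanned by `u_{2,0} - u_{0,0} = (1 + √3/2, -1/2)` and
`u_{0,2} - u_{0,0} = (1/2, 1 + √3/2)`, and `u_{0,0} u_{1,0} u_{1,1} u_{0,1}` is the unit square. -/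
noncomputable def u (i j : ℤ) : Plane :=
  ((i / 2 : ℤ) : ℝ) • !₂[1 + √3 / 2, -1 / 2] + ((j / 2 : ℤ) : ℝ) • !₂[1 / 2, 1 + √3 / 2] +
    !₂[((i % 2 : ℤ) : ℝ), ((j % 2 : ℤ) : ℝ)]

/-- The snub square tiling `E₂` by unit squares and unit equilateral triangles. -/
noncomputable def E₂ : PlaneCells where
  verts := {x | ∃ i j : ℤ, x = u i j}
  edges := {s | ∃ i j : ℤ,
    s = segment ℝ (u i j) (u (i + 1) j) ∨
    s = segment ℝ (u i j) (u i (j + 1)) ∨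
    (Odd i ∧ Even j ∧ s = segment ℝ (u i j) (u (i + 1) (j + 1))) ∨
    (Even i ∧ Odd j ∧ s = segment ℝ (u (i + 1) j) (u i (j + 1)))}
  faces := {s | ∃ i j : ℤ,
    (Even (i + j) ∧
      s = convexHull ℝ {u i j, u (i + 1) j, u (i + 1) (j + 1), u i (j + 1)}) ∨
    (Odd i ∧ Even j ∧ s = convexHull ℝ {u i j, u (i + 1) j, u (i + 1) (j + 1)}) ∨
    (Odd i ∧ Even j ∧ s = convexHull ℝ {u i j, u (i + 1) (j + 1), u i (j + 1)}) ∨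
    (Even i ∧ Odd j ∧ s = convexHull ℝ {u i j, u (i + 1) j, u i (j + 1)}) ∨
    (Even i ∧ Odd j ∧ s = convexHull ℝ {u (i + 1) j, u (i + 1) (j + 1), u i (j + 1)})}

end SnubSquare

namespace Trihexagonal

/-- The vertices `v_{i,j} = i (2, 0) + j (1, √3)` of the trihexagonal tiling with edge length `1`. -/
noncomputable def v (i j : ℤ) : Plane := !₂[2 * (i : ℝ) + j, √3 * (j : ℝ)]

/-- The vertices `w_{i,j} = v_{i,j} + (1, 0)`. -/
noncomputable def w (i j : ℤ) : Plane := v i j + !₂[1, 0]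

/-- The vertices `u_{i,j} = v_{i,j} + (3/2, √3/2)`. -/
noncomputable def u (i j : ℤ) : Plane := v i j + !₂[3 / 2, √3 / 2]

/-- The trihexagonal tiling `E₆` by equilateral triangles and regular hexagons of side `1`. -/
noncomputable def E₆ : PlaneCells where
  verts := {x | ∃ i j : ℤ, x = u i j ∨ x = v i j ∨ x = w i j}
  edges := {s | ∃ i j : ℤ,
    s = segment ℝ (v i j) (w i j) ∨
    s = segment ℝ (w i j) (v (i + 1) j) ∨
    s = segment ℝ (w i j) (u i j) ∨
    s = segment ℝ (v (i + 1) j) (u i j) ∨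
    s = segment ℝ (u i j) (v i (j + 1)) ∨
    s = segment ℝ (u i j) (w i (j + 1))}
  faces := {s | ∃ i j : ℤ,
    s = convexHull ℝ {w i j, v (i + 1) j, u i j} ∨
    s = convexHull ℝ {v i (j + 1), w i (j + 1), u i j} ∨
    s = convexHull ℝ {v i j, w i j, u i j, v i (j + 1), w (i - 1) (j + 1), u (i - 1) j}}

end Trihexagonal

/-!
A map of type `[3², 4, 3, 4]` or `[3, 6, 3, 6]` is reconstructed from its local structure. The local
data are the flags (a vertex on an edge on a face), with the three operations `flipVert`, `flipEdge`
and `flipFace` that change one member of the flag. The axioms of a polyhedral map and the face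
cycles at the vertices say how these operations compose around a face (`iterate_face`) and around a
vertex (`exists_vertFlags`).

In both types a subset of the flags carries three involutions that satisfy the relations of a
crystallographic reflection group. In type `[3, 6, 3, 6]` these are the flags of the hexagons, with
the passage through a triangle to the next hexagon in place of `flipFace`. In type `[3², 4, 3, 4]`
every triangle has exactly one edge in common with another triangle (`isApex_flipVert`); without
these edges the map consists of quadrangles, four at each vertex, and the flags on the remaining
edges satisfy the relations of the square lattice. In such a group the unit translations, written as
words in the involutions, commute, and therefore the flags of the lattice map equivariantly to those
of the map (`exists_gridFlag_map`, `exists_hexFlag_map`).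

The equivariant map, together with the vertices and faces of the tiling, is a `FlagModel`. It
defines a local isomorphism from the tiling to the given map on the plane, so a covering. Since the plane is
simply connected, the local isomorphism is injective on vertices and surjective onto them
(`bijective_of_local_iso`). Simple connectivity enters here only: the monodromy of a locally finite
cover of a simply connected space by closed connected sets is trivial (`exists_compatible_family`),
and the faces of a map form such a cover of the plane. Hence the given map is described by its
vertices in the same way as the tiling (`FlagModel.realizes`), and the tilings themselves are
described so by elementary estimates of distances (`realizes_E₂`, `realizes_E₆`). Two maps with the
same description are isomorphic.
-/

/-! ### Monodromy over a simply connected space -/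

section Monodromy

open Topology Filter Bundle

variable {X ι S : Type*}

/-- The open star of a point with respect to a family of sets: the points that lie only in members
of the family containing the given point. -/
def openStar (C : ι → Set X) (x : X) : Set X := {y | ∀ i, y ∈ C i → x ∈ C i}

theorem mem_openStar_self (C : ι → Set X) (x : X) : x ∈ openStar C x := fun _ h => h

variable [TopologicalSpace X]

theorem openStar_mem_nhds {C : ι → Set X} (hcl : ∀ i, IsClosed (C i)) (hlf : LocallyFinite C)
    (x : X) : openStar C x ∈ 𝓝 x := by
  refine mem_of_superset (hlf.iInter_compl_mem_nhds hcl x) fun y hy i hi => ?_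
  by_contra hx
  simp only [Set.mem_iInter, Set.mem_compl_iff] at hy
  exact hy i hx hi

theorem isOpen_openStar {C : ι → Set X} (hcl : ∀ i, IsClosed (C i)) (hlf : LocallyFinite C)
    (x : X) : IsOpen (openStar C x) := by
  refine isOpen_iff_mem_nhds.2 fun y hy => ?_
  exact mem_of_superset (openStar_mem_nhds hcl hlf y) fun z hz i hi => hy i (hz i hi)

/-- The covering space with fibre `S` glued from the transition maps `T i j` along a locally finite
closed cover `C`. The charts are indexed by the points `x` of the base and live on open stars; the
chart at `x` reads the fibre in a chosen member `C (f x)` containing `x`. -/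
def monodromyCore [TopologicalSpace S] [DiscreteTopology S] (C : ι → Set X)
    (hcl : ∀ i, IsClosed (C i)) (hlf : LocallyFinite C) (f : X → ι) (hf : ∀ x, x ∈ C (f x))
    (T : ι → ι → S → S) (hself : ∀ i s, T i i s = s)
    (hT : ∀ i j k, (C i ∩ C j ∩ C k).Nonempty → ∀ s, T j k (T i j s) = T i k s) :
    FiberBundleCore X X S where
  baseSet := openStar C
  isOpen_baseSet := isOpen_openStar hcl hlf
  indexAt := id
  mem_baseSet_at := mem_openStar_self C
  coordChange x y z s := T (f z) (f y) (T (f x) (f z) s)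
  coordChange_self x z hz s := by
    rw [hT _ _ _ ⟨x, ⟨hf x, hz _ (hf z)⟩, hf x⟩, hself]
  continuousOn_coordChange x y := by
    rintro ⟨z, s⟩ ⟨⟨hzx, hzy⟩, -⟩
    refine ContinuousAt.continuousWithinAt ?_
    refine tendsto_nhds_of_eventually_eq ?_
    have h : openStar C z ×ˢ {s} ∈ 𝓝 (z, s) :=
      prod_mem_nhds (openStar_mem_nhds hcl hlf z) (by simp)
    filter_upwards [h]
    rintro ⟨w, t⟩ ⟨hw, ht⟩
    obtain rfl : t = s := ht
    have hz : z ∈ C (f w) := hw _ (hf w)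
    have hx := hzx _ hz
    have hy := hzy _ hz
    change T (f w) (f y) (T (f x) (f w) t) = T (f z) (f y) (T (f x) (f z) t)
    rw [← hT (f x) (f z) (f w) ⟨x, ⟨hf x, hzx _ (hf z)⟩, hx⟩,
      hT (f z) (f w) (f y) ⟨y, ⟨hzy _ (hf z), hy⟩, hf y⟩]
  coordChange_comp x y w z hz s := by
    obtain ⟨⟨hx, hy⟩, hw⟩ := hz
    have hx := hx _ (hf z)
    have hy := hy _ (hf z)
    have hw := hw _ (hf z)
    change T (f z) (f w) (T (f y) (f z) (T (f z) (f y) (T (f x) (f z) s))) = _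
    rw [hT (f z) (f y) (f z) ⟨y, ⟨hy, hf y⟩, hy⟩, hself]

/-- A locally constant system of fibres on a locally finite closed cover of a simply connected
space, by connected sets, has a compatible family through every element: lift the identity map to
the covering space `monodromyCore`. -/
theorem exists_compatible_family [SimplyConnectedSpace X] [LocallyPathConnectedSpace X]
    {C : ι → Set X} (hcl : ∀ i, IsClosed (C i)) (hconn : ∀ i, IsPreconnected (C i))
    (hlf : LocallyFinite C) (hcov : ∀ x, ∃ i, x ∈ C i)
    (T : ι → ι → S → S) (hself : ∀ i s, T i i s = s)
    (hT : ∀ i j k, (C i ∩ C j ∩ C k).Nonempty → ∀ s, T j k (T i j s) = T i k s)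
    (i₀ : ι) (hi₀ : (C i₀).Nonempty) (s₀ : S) :
    ∃ σ : ι → S, σ i₀ = s₀ ∧ ∀ i j, (C i ∩ C j).Nonempty → T i j (σ i) = σ j := by
  classical
  choose f hf using hcov
  let _ : TopologicalSpace S := ⊥
  have : DiscreteTopology S := ⟨rfl⟩
  let Z := monodromyCore C hcl hlf f hf T hself hT
  have cov : IsCoveringMap (π S Z.Fiber) := FiberBundle.isCoveringMap
  obtain ⟨x₀, hx₀⟩ := hi₀
  obtain ⟨F, ⟨hF0, hF⟩, -⟩ := cov.existsUnique_continuousMap_lifts (ContinuousMap.id X) x₀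
    (⟨x₀, T i₀ (f x₀) s₀⟩ : TotalSpace S Z.Fiber) rfl
  have hproj : ∀ x, (F x).proj = x := fun x => congrFun hF x
  let τ : X → S := fun x => (F x).2
  have hτ0 : τ x₀ = T i₀ (f x₀) s₀ := by
    have : (F x₀).2 = (⟨x₀, T i₀ (f x₀) s₀⟩ : TotalSpace S Z.Fiber).2 := by rw [hF0]
    exact this
  have hloc : ∀ x, ∀ᶠ y in 𝓝 x, T (f y) (f x) (τ y) = τ x := by
    intro x
    have hxsrc : F x ∈ (Z.localTrivAt x).source := by
      rw [(Z.localTrivAt x).mem_source]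
      change (F x).proj ∈ openStar C x
      rw [hproj]; exact mem_openStar_self C x
    have hc : ContinuousAt (fun y => (Z.localTrivAt x (F y)).2) x :=
      ((((Z.localTrivAt x).continuousOn.continuousAt
        ((Z.localTrivAt x).open_source.mem_nhds hxsrc))).comp F.continuous.continuousAt).snd
    have hval : ∀ y, (Z.localTrivAt x (F y)).2 = T (f y) (f x) (τ y) := by
      intro y
      rw [Z.localTrivAt_snd]
      change T (f (F y).proj) (f x) (T (f (F y).proj) (f (F y).proj) (τ y)) = _
      rw [hself, hproj]
    have hev : ∀ᶠ y in 𝓝 x, (Z.localTrivAt x (F y)).2 = (Z.localTrivAt x (F x)).2 :=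
      hc.eventually (p := fun t => t = (Z.localTrivAt x (F x)).2)
        ((isOpen_discrete {(Z.localTrivAt x (F x)).2}).mem_nhds rfl)
    filter_upwards [hev] with y hy
    rw [hval, hval, hself] at hy
    exact hy
  have hconst : ∀ i, ∀ x ∈ C i, ∀ y ∈ C i, T (f x) i (τ x) = T (f y) i (τ y) := by
    intro i x hx y hy
    refine (hconn i).constant (f := fun x => T (f x) i (τ x)) ?_ hx hy
    intro z hz
    refine tendsto_nhds_of_eventually_eq ?_
    refine eventually_nhdsWithin_iff.2 ?_
    filter_upwards [hloc z, openStar_mem_nhds hcl hlf z] with w hw hwz _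
    rw [← hw, hT (f w) (f z) i ⟨z, ⟨hwz _ (hf w), hf z⟩, hz⟩]
  let σ : ι → S := fun i => if h : (C i).Nonempty then T (f h.some) i (τ h.some) else s₀
  have hσ : ∀ i, ∀ x ∈ C i, σ i = T (f x) i (τ x) := by
    intro i x hx
    have h : (C i).Nonempty := ⟨x, hx⟩
    simp only [σ, dif_pos h]
    exact hconst i _ h.some_mem _ hx
  refine ⟨σ, ?_, ?_⟩
  · rw [hσ i₀ x₀ hx₀, hτ0, hT _ _ _ ⟨x₀, ⟨hx₀, hf x₀⟩, hx₀⟩, hself]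
  · rintro i j ⟨x, hxi, hxj⟩
    rw [hσ i x hxi, hσ j x hxj, hT _ _ _ ⟨x, ⟨hf x, hxi⟩, hxj⟩]

end Monodromy

section UniqueLift

open Topology Filter

variable {X ι P : Type*} [TopologicalSpace X]

/-- In a connected space, the members of a locally finite closed cover are connected to each other
by chains of members in which consecutive ones intersect. -/
theorem cover_induction [PreconnectedSpace X] {C : ι → Set X} (hcl : ∀ i, IsClosed (C i))
    (hlf : LocallyFinite C) (hcov : ∀ x, ∃ i, x ∈ C i) (hne : ∀ i, (C i).Nonempty)
    (J : ι → Prop) {i₀ : ι} (h₀ : J i₀)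
    (step : ∀ i j, (C i ∩ C j).Nonempty → J i → J j) (j : ι) : J j := by
  have hclosed : ∀ K : ι → Prop, IsClosed (⋃ i : {i // K i}, C i) := fun K =>
    (hlf.comp_injective Subtype.val_injective).isClosed_iUnion fun i => hcl i
  have hcompl : (⋃ i : {i // J i}, C i)ᶜ = ⋃ i : {i // ¬ J i}, C i := by
    ext x
    simp only [Set.mem_compl_iff, Set.mem_iUnion, Subtype.exists, exists_prop, not_exists, not_and]
    constructor
    · intro h
      obtain ⟨i, hi⟩ := hcov x
      exact ⟨i, fun hJ => h i hJ hi, hi⟩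
    · rintro ⟨i, hJ, hi⟩ k hk hxk
      exact hJ (step k i ⟨x, hxk, hi⟩ hk)
  have hclopen : IsClopen (⋃ i : {i // J i}, C i) :=
    ⟨hclosed J, by rw [← isClosed_compl_iff, hcompl]; exact hclosed _⟩
  have huniv := hclopen.eq_univ ((hne i₀).mono (Set.subset_iUnion (fun i : {i // J i} => C i)
    ⟨i₀, h₀⟩))
  obtain ⟨x, hx⟩ := hne j
  have : x ∈ ⋃ i : {i // J i}, C i := huniv ▸ Set.mem_univ x
  obtain ⟨⟨i, hi⟩, hxi⟩ := Set.mem_iUnion.1 this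
  exact step i j ⟨x, hxi, hx⟩ hi

/-- Let `C` be a locally finite closed cover, by connected sets, of a simply connected space, and
let the index set be covered by a set `P` with an adjacency relation `R`, such that adjacency lifts
uniquely and is transitive over triple intersections. If `P` is connected under `R`, then the
projection of `P` to the index set is a bijection. -/
theorem bijective_of_unique_lift [SimplyConnectedSpace X] [LocallyPathConnectedSpace X]
    {C : ι → Set X} (hcl : ∀ i, IsClosed (C i)) (hconn : ∀ i, IsPreconnected (C i))
    (hlf : LocallyFinite C) (hcov : ∀ x, ∃ i, x ∈ C i) (hne : ∀ i, (C i).Nonempty)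
    [Nonempty P] (π : P → ι) (R : P → P → Prop) (hrefl : ∀ p, R p p)
    (hsymm : ∀ p q, R p q → R q p)
    (hR : ∀ p q, R p q → (C (π p) ∩ C (π q)).Nonempty)
    (hlift : ∀ p j, (C (π p) ∩ C j).Nonempty → ∃ q, π q = j ∧ R p q)
    (huniq : ∀ p q r, R p q → R p r → π q = π r → q = r)
    (hcoc : ∀ p q r, R p q → R q r → (C (π p) ∩ C (π q) ∩ C (π r)).Nonempty → R p r)
    (hP : ∀ p q, Relation.ReflTransGen R p q) : Function.Bijective π := by
  classical
  choose tr htr hRtr using hlift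
  have hself : ∀ p h, tr p (π p) h = p := fun p h =>
    huniq p _ _ (hRtr p _ h) (hrefl p) (htr _ _ _)
  constructor
  · intro p₀ q₀ hpq
    -- A fibre over `π p₀` serves as the constant fibre of the local system.
    let Fib : ι → Type _ := fun i => {p : P // π p = i}
    let tf : ∀ i j, (C i ∩ C j).Nonempty → Fib i → Fib j := fun i j h p =>
      ⟨tr p.1 j (by rw [p.2]; exact h), htr _ _ _⟩
    have htf : ∀ i j h (p : Fib i), R p.1 (tf i j h p).1 := fun i j h p => hRtr _ _ _
    have htf_uniq : ∀ i j h (p : Fib i) (q : Fib j), R p.1 q.1 → tf i j h p = q :=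
      fun i j h p q hpq => Subtype.ext (huniq p.1 _ _ (htf i j h p) hpq
        ((tf i j h p).2.trans q.2.symm))
    have hequiv : ∀ j, Nonempty (Fib (π p₀) ≃ Fib j) := by
      refine cover_induction hcl hlf hcov hne _ (i₀ := π p₀) ⟨Equiv.refl _⟩ ?_
      rintro i j hij ⟨e⟩
      have hji : (C j ∩ C i).Nonempty := by rwa [Set.inter_comm]
      exact ⟨e.trans ⟨tf i j hij, tf j i hji,
        fun p => htf_uniq _ _ hji _ _ (hsymm _ _ (htf _ _ hij _)),
        fun p => htf_uniq _ _ hij _ _ (hsymm _ _ (htf _ _ hji _))⟩⟩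
    have e : ∀ j, Fib (π p₀) ≃ Fib j := fun j => (hequiv j).some
    let T : ι → ι → Fib (π p₀) → Fib (π p₀) := fun i j s =>
      if h : (C i ∩ C j).Nonempty then (e j).symm (tf i j h (e i s)) else s
    have hT : ∀ i j (h : (C i ∩ C j).Nonempty) s, e j (T i j s) = tf i j h (e i s) := by
      intro i j h s
      simp only [T, dif_pos h, Equiv.apply_symm_apply]
    have hTself : ∀ i s, T i i s = s := by
      intro i s
      have h : (C i ∩ C i).Nonempty := by rw [Set.inter_self]; exact hne i
      apply (e i).injective
      rw [hT i i h]
      exact htf_uniq _ _ h _ _ (hrefl _)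
    have hTT : ∀ i j k, (C i ∩ C j ∩ C k).Nonempty → ∀ s, T j k (T i j s) = T i k s := by
      rintro i j k ⟨x, ⟨hi, hj⟩, hk⟩ s
      apply (e k).injective
      rw [hT j k ⟨x, hj, hk⟩, hT i j ⟨x, hi, hj⟩, hT i k ⟨x, hi, hk⟩]
      refine (htf_uniq i k ⟨x, hi, hk⟩ _ _ (hcoc _ _ _ (htf i j ⟨x, hi, hj⟩ _)
        (htf j k ⟨x, hj, hk⟩ _) ⟨x, ?_⟩)).symm
      have hmem : ∀ i (p : Fib i), x ∈ C i → x ∈ C (π p.1) := fun i p h => by rw [p.2]; exact h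
      exact ⟨⟨hmem _ _ hi, hmem _ _ hj⟩, hmem _ _ hk⟩
    obtain ⟨σ, hσ0, hσ⟩ := exists_compatible_family hcl hconn hlf hcov T hTself hTT (π p₀)
      (hne _) ((e (π p₀)).symm ⟨p₀, rfl⟩)
    let s : ∀ i, Fib i := fun i => e i (σ i)
    have hs : ∀ i j (h : (C i ∩ C j).Nonempty), tf i j h (s i) = s j := by
      intro i j h
      simp only [s]
      rw [← hT i j h, hσ i j h]
    have hs0 : s (π p₀) = ⟨p₀, rfl⟩ := by simp [s, hσ0]
    -- The section inverts the projection on everything adjacent to `p₀` through a chain.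
    have hsec : ∀ q, (s (π q)).1 = q := by
      intro q
      induction hP p₀ q with
      | refl => rw [hs0]
      | @tail b c _ hbc ih =>
        have h := hR b c hbc
        have h1 := htf (π b) (π c) h (s (π b))
        rw [hs _ _ h, ih] at h1
        exact huniq b _ _ h1 hbc (s (π c)).2
    exact (hsec p₀).symm.trans ((congrArg (fun i => (s i).1) hpq).trans (hsec q₀))
  · intro j
    obtain ⟨p⟩ := ‹Nonempty P›
    refine cover_induction hcl hlf hcov hne (fun j => ∃ p, π p = j) (i₀ := π p) ⟨p, rfl⟩ ?_ j
    rintro i j hij ⟨p, rfl⟩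
    exact ⟨tr p j hij, htr _ _ _⟩

end UniqueLift

/-! ### Local structure of polyhedral maps -/

namespace PlaneCells

variable {M : PlaneCells}

theorem IsPolyhedralMap.two_ends (hM : M.IsPolyhedralMap) {e : Set Plane} (he : e ∈ M.edges) :
    ∃ a b, a ≠ b ∧ ∀ v, (v ∈ M.verts ∧ v ∈ e) ↔ v = a ∨ v = b := by
  obtain ⟨γ, -, hγ, -, h⟩ := hM.edge_arc e he
  refine ⟨γ 0, γ 1, fun h01 => zero_ne_one (hγ h01), fun v => ?_⟩
  rw [and_comm, ← Set.mem_inter_iff, h]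
  rfl

theorem IsPolyhedralMap.not_edge_subset_verts (hM : M.IsPolyhedralMap) {e : Set Plane}
    (he : e ∈ M.edges) : ¬ e ⊆ M.verts := by
  obtain ⟨γ, -, hγ, rfl, h⟩ := hM.edge_arc e he
  intro hsub
  have hmem : γ ⟨1 / 2, by norm_num, by norm_num⟩ ∈ ({γ 0, γ 1} : Set Plane) :=
    h ▸ ⟨⟨_, rfl⟩, hsub ⟨_, rfl⟩⟩
  rcases hmem with hm | hm
  · have := congrArg Subtype.val (hγ hm)
    norm_num at this
  · have := congrArg Subtype.val (hγ hm)
    norm_num at this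

theorem finRotate_ne_self {n : ℕ} (hn : 3 ≤ n) (i : Fin n) : finRotate n i ≠ i := by
  obtain ⟨k, rfl⟩ := Nat.exists_eq_add_of_le' hn
  rw [finRotate_apply]
  simp

theorem finRotate_finRotate_ne_self {n : ℕ} (hn : 3 ≤ n) (i : Fin n) :
    finRotate n (finRotate n i) ≠ i := by
  obtain ⟨k, rfl⟩ := Nat.exists_eq_add_of_le' hn
  rw [finRotate_apply, finRotate_apply, add_assoc]
  intro h
  have h2 : (1 + 1 : Fin (k + 3)) = 0 := by simpa using h
  have := congrArg Fin.val h2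
  simp [Fin.val_add, Nat.mod_eq_of_lt (show 2 < k + 3 by omega)] at this

/-- The vertices `v i` and the edges `e i` form the boundary cycle of the face `f`. -/
structure IsBoundary (M : PlaneCells) (f : Set Plane) {n : ℕ} (v : Fin n → Plane)
    (e : Fin n → Set Plane) : Prop where
  three_le : 3 ≤ n
  inj : Function.Injective v
  vert : ∀ i, v i ∈ M.verts
  edge : ∀ i, e i ∈ M.edges
  ends : ∀ i, e i ∩ M.verts = {v i, v (finRotate n i)}
  graph : f ∩ M.graph = ⋃ i, e i

theorem IsPolyhedralMap.exists_boundary (hM : M.IsPolyhedralMap) {f : Set Plane}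
    (hf : f ∈ M.faces) :
    ∃ (n : ℕ) (v : Fin n → Plane) (e : Fin n → Set Plane), M.IsBoundary f v e := by
  obtain ⟨h, -, -, -, hb, n, hn, v, e, hv, hvV, he, hu⟩ := hM.face_polygon f hf
  exact ⟨n, v, e, hn, hv, hvV, fun i => (he i).1, fun i => (he i).2, hb.trans hu⟩

namespace IsBoundary

variable {f : Set Plane} {n : ℕ} {v : Fin n → Plane} {e : Fin n → Set Plane}

theorem edge_subset (hb : M.IsBoundary f v e) (i : Fin n) : e i ⊆ f := fun x hx => by
  have : x ∈ f ∩ M.graph := hb.graph ▸ Set.mem_iUnion.2 ⟨i, hx⟩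
  exact this.1

theorem vert_mem_edge (hb : M.IsBoundary f v e) {i j : Fin n} :
    v i ∈ e j ↔ i = j ∨ i = finRotate n j := by
  have : v i ∈ e j ↔ v i ∈ e j ∩ M.verts := by simp [hb.vert i]
  rw [this, hb.ends]
  simp [hb.inj.eq_iff]

theorem inter_verts (hb : M.IsBoundary f v e) : f ∩ M.verts = Set.range v := by
  ext x
  constructor
  · rintro ⟨hx, hxV⟩
    have : x ∈ ⋃ i, e i := hb.graph ▸ ⟨hx, Or.inl hxV⟩
    obtain ⟨i, hi⟩ := Set.mem_iUnion.1 this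
    have : x ∈ e i ∩ M.verts := ⟨hi, hxV⟩
    rw [hb.ends] at this
    rcases this with rfl | rfl <;> exact ⟨_, rfl⟩
  · rintro ⟨i, rfl⟩
    exact ⟨hb.edge_subset i (hb.vert_mem_edge.2 (Or.inl rfl)), hb.vert i⟩

theorem size_eq (hb : M.IsBoundary f v e) : M.size f = n := by
  rw [size, hb.inter_verts, ← Set.image_univ, Set.ncard_image_of_injective _ hb.inj]
  simp

theorem exists_eq_edge (hb : M.IsBoundary f v e) (hM : M.IsPolyhedralMap) {a : Set Plane}
    (ha : a ∈ M.edges) (haf : a ⊆ f) : ∃ i, a = e i := by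
  by_contra! hne
  refine hM.not_edge_subset_verts ha fun x hx => ?_
  have : x ∈ ⋃ i, e i := hb.graph ▸ ⟨haf hx, Or.inr ⟨a, ha, hx⟩⟩
  obtain ⟨i, hi⟩ := Set.mem_iUnion.1 this
  exact hM.edge_inter a ha (e i) (hb.edge i) (hne i) ⟨hx, hi⟩

/-- Since `n ≥ 3`, the edges of an `n`-gon are determined by their end points. -/
theorem eq_of_ends_eq (hb : M.IsBoundary f v e) {i j : Fin n}
    (hij : e i ∩ M.verts = e j ∩ M.verts) : i = j := by
  have hmem : ∀ k, v k ∈ e k ∩ M.verts := fun k => ⟨hb.vert_mem_edge.2 (Or.inl rfl), hb.vert k⟩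
  have h1 : i = j ∨ i = finRotate n j := hb.vert_mem_edge.1 (hij ▸ hmem i).1
  have h2 : j = i ∨ j = finRotate n i := hb.vert_mem_edge.1 (hij ▸ hmem j).1
  rcases h1 with h1 | h1
  · exact h1
  rcases h2 with h2 | h2
  · exact h2.symm
  exact absurd (h1 ▸ h2.symm) (finRotate_finRotate_ne_self hb.three_le j)

theorem edge_injective (hb : M.IsBoundary f v e) : Function.Injective e := fun i j hij =>
  hb.eq_of_ends_eq (by rw [hij])

end IsBoundary

theorem IsPolyhedralMap.two_edges (hM : M.IsPolyhedralMap) {f : Set Plane} (hf : f ∈ M.faces)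
    {v : Plane} (hv : v ∈ M.verts) (hvf : v ∈ f) :
    ∃ a b, a ≠ b ∧ ∀ e, (e ∈ M.edges ∧ v ∈ e ∧ e ⊆ f) ↔ e = a ∨ e = b := by
  obtain ⟨n, w, d, hb⟩ := hM.exists_boundary hf
  obtain ⟨i, rfl⟩ : v ∈ Set.range w := hb.inter_verts ▸ ⟨hvf, hv⟩
  obtain ⟨j, rfl⟩ := (finRotate n).surjective i
  refine ⟨d j, d (finRotate n j), fun h => finRotate_ne_self hb.three_le j
    (hb.edge_injective h).symm, fun e => ⟨?_, ?_⟩⟩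
  · rintro ⟨he, hve, hef⟩
    obtain ⟨k, rfl⟩ := hb.exists_eq_edge hM he hef
    rcases hb.vert_mem_edge.1 hve with h | h
    · rw [h]; exact Or.inr rfl
    · rw [(finRotate n).injective h]; exact Or.inl rfl
  · rintro (rfl | rfl)
    · exact ⟨hb.edge _, hb.vert_mem_edge.2 (Or.inr rfl), hb.edge_subset _⟩
    · exact ⟨hb.edge _, hb.vert_mem_edge.2 (Or.inl rfl), hb.edge_subset _⟩

/-- A polyhedral map in which the cells around every vertex form a cycle. -/
structure IsCyclicMap (M : PlaneCells) : Prop extends M.IsPolyhedralMap where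
  exists_faceCycle : ∀ v ∈ M.verts, ∃ p : List ℕ, 3 ≤ p.length ∧ M.HasFaceCycle v p

theorem IsPolyhedralMap.eq_or_eq_of_faceCycle (hM : M.IsPolyhedralMap) {v : Plane}
    (hv : v ∈ M.verts) {d : ℕ} (hd : 3 ≤ d) {e F : Fin d → Set Plane} (he : Function.Injective e)
    (her : Set.range e = {a | a ∈ M.edges ∧ v ∈ a})
    (hFr : Set.range F = {f | f ∈ M.faces ∧ v ∈ f})
    (h : ∀ i, e i ⊆ F i ∧ e (finRotate d i) ⊆ F i) {i j : Fin d} (hij : e i ⊆ F j) :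
    i = j ∨ i = finRotate d j := by
  have hE : ∀ i, e i ∈ M.edges ∧ v ∈ e i := fun i => by
    have : e i ∈ {a | a ∈ M.edges ∧ v ∈ a} := her ▸ ⟨i, rfl⟩
    exact this
  have hF : F j ∈ M.faces ∧ v ∈ F j := by
    have : F j ∈ {f | f ∈ M.faces ∧ v ∈ f} := hFr ▸ ⟨j, rfl⟩
    exact this
  obtain ⟨a, b, -, hab⟩ := hM.two_edges hF.1 hv hF.2
  have h1 := (hab (e i)).1 ⟨(hE i).1, (hE i).2, hij⟩
  have h2 := (hab (e j)).1 ⟨(hE j).1, (hE j).2, (h j).1⟩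
  have h3 := (hab (e (finRotate d j))).1 ⟨(hE _).1, (hE _).2, (h j).2⟩
  have h23 : e j ≠ e (finRotate d j) := fun h => finRotate_ne_self hd j (he h).symm
  by_contra! hcon
  have h12 : e i ≠ e j := fun h => hcon.1 (he h)
  have h13 : e i ≠ e (finRotate d j) := fun h => hcon.2 (he h)
  rcases h1 with h1 | h1 <;> rcases h2 with h2 | h2 <;> rcases h3 with h3 | h3 <;>
    simp_all

theorem IsCyclicMap.two_faces (hM : M.IsCyclicMap) {e : Set Plane} (he : e ∈ M.edges) :
    ∃ a b, a ≠ b ∧ ∀ f, (f ∈ M.faces ∧ e ⊆ f) ↔ f = a ∨ f = b := by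
  obtain ⟨v, b, -, hv⟩ := hM.two_ends he
  obtain ⟨hvV, hve⟩ := (hv v).2 (Or.inl rfl)
  obtain ⟨p, hp, E, F, hE, hEr, hF, hFr, h⟩ := hM.exists_faceCycle v hvV
  obtain ⟨i, rfl⟩ : e ∈ Set.range E := hEr ▸ ⟨he, hve⟩
  obtain ⟨j, rfl⟩ := (finRotate p.length).surjective i
  have hFm : ∀ i, F i ∈ M.faces := fun i => by
    have : F i ∈ {f | f ∈ M.faces ∧ v ∈ f} := hFr ▸ ⟨i, rfl⟩
    exact this.1
  refine ⟨F j, F (finRotate _ j), fun h => finRotate_ne_self hp j (hF h).symm, fun f => ⟨?_, ?_⟩⟩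
  · rintro ⟨hf, hef⟩
    obtain ⟨k, rfl⟩ : f ∈ Set.range F := hFr ▸ ⟨hf, hef hve⟩
    rcases hM.eq_or_eq_of_faceCycle hvV hp hE hEr hFr (fun i => ⟨(h i).1, (h i).2.1⟩) hef
      with hk | hk
    · rw [hk]; exact Or.inr rfl
    · rw [(finRotate _).injective hk]; exact Or.inl rfl
  · rintro (rfl | rfl)
    · exact ⟨hFm _, (h _).2.1⟩
    · exact ⟨hFm _, (h _).1⟩

end PlaneCells

namespace PlaneCells

variable {M : PlaneCells}

/-! ### Cells are determined by their vertices -/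

theorem IsPolyhedralMap.exists_three_verts (hM : M.IsPolyhedralMap) {f : Set Plane}
    (hf : f ∈ M.faces) :
    ∃ a b c, a ≠ b ∧ a ≠ c ∧ b ≠ c ∧ a ∈ f ∩ M.verts ∧ b ∈ f ∩ M.verts ∧ c ∈ f ∩ M.verts := by
  obtain ⟨n, v, e, hb⟩ := hM.exists_boundary hf
  have h3 := hb.three_le
  rw [hb.inter_verts]
  refine ⟨v ⟨0, by omega⟩, v ⟨1, by omega⟩, v ⟨2, by omega⟩, ?_, ?_, ?_, ⟨_, rfl⟩, ⟨_, rfl⟩,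
    ⟨_, rfl⟩⟩ <;> exact fun h => by simpa using hb.inj h

/-- Two distinct faces that share two vertices meet in an edge with these end points. -/
theorem IsPolyhedralMap.inter_mem_edges (hM : M.IsPolyhedralMap) {f f' : Set Plane}
    (hf : f ∈ M.faces) (hf' : f' ∈ M.faces) (hne : f ≠ f') {x y : Plane} (hxy : x ≠ y)
    (hx : x ∈ f ∩ f') (hy : y ∈ f ∩ f') (hxV : x ∈ M.verts) (hyV : y ∈ M.verts) :
    f ∩ f' ∈ M.edges ∧ ∀ z, (z ∈ M.verts ∧ z ∈ f ∩ f') ↔ z = x ∨ z = y := by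
  rcases hM.face_inter f hf f' hf' hne with h | ⟨v, -, h⟩ | h
  · rw [h] at hx; exact hx.elim
  · rw [h] at hx hy; exact absurd (hx.trans hy.symm) hxy
  · refine ⟨h, ?_⟩
    obtain ⟨a, b, hab, hv⟩ := hM.two_ends h
    have h1 := (hv x).1 ⟨hxV, hx⟩
    have h2 := (hv y).1 ⟨hyV, hy⟩
    intro z
    rw [hv z]
    rcases h1 with rfl | rfl <;> rcases h2 with rfl | rfl
    · exact absurd rfl hxy
    · rfl
    · exact or_comm
    · exact absurd rfl hxy

theorem IsPolyhedralMap.face_eq_of_verts_subset (hM : M.IsPolyhedralMap) {f f' : Set Plane}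
    (hf : f ∈ M.faces) (hf' : f' ∈ M.faces) (h : f ∩ M.verts ⊆ f') : f = f' := by
  by_contra hne
  obtain ⟨a, b, c, hab, hac, hbc, ha, hb, hc⟩ := hM.exists_three_verts hf
  obtain ⟨-, hz⟩ := hM.inter_mem_edges hf hf' hne hab ⟨ha.1, h ha⟩ ⟨hb.1, h hb⟩ ha.2 hb.2
  rcases (hz c).1 ⟨hc.2, hc.1, h hc⟩ with h | h
  · exact hac h.symm
  · exact hbc h.symm

theorem IsPolyhedralMap.edge_eq_of_subset_face (hM : M.IsPolyhedralMap) {e e' f : Set Plane}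
    (he : e ∈ M.edges) (he' : e' ∈ M.edges) (hf : f ∈ M.faces) (hef : e ⊆ f) (hef' : e' ⊆ f)
    (h : e ∩ M.verts = e' ∩ M.verts) : e = e' := by
  obtain ⟨n, v, d, hb⟩ := hM.exists_boundary hf
  obtain ⟨i, rfl⟩ := hb.exists_eq_edge hM he hef
  obtain ⟨j, rfl⟩ := hb.exists_eq_edge hM he' hef'
  rw [hb.eq_of_ends_eq h]

theorem IsCyclicMap.edge_subset_iff (hM : M.IsCyclicMap) {e f : Set Plane}
    (he : e ∈ M.edges) (hf : f ∈ M.faces) : e ⊆ f ↔ e ∩ M.verts ⊆ f := by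
  refine ⟨fun h => Set.inter_subset_left.trans h, fun h => ?_⟩
  obtain ⟨f₁, f₂, -, hfe⟩ := hM.two_faces he
  obtain ⟨hf₁, hef₁⟩ := (hfe f₁).2 (Or.inl rfl)
  by_cases hne : f = f₁
  · rw [hne]; exact hef₁
  obtain ⟨a, b, hab, hv⟩ := hM.two_ends he
  obtain ⟨haV, ha⟩ := (hv a).2 (Or.inl rfl)
  obtain ⟨hbV, hb⟩ := (hv b).2 (Or.inr rfl)
  obtain ⟨hE, hEv⟩ := hM.inter_mem_edges hf hf₁ hne hab ⟨h ⟨ha, haV⟩, hef₁ ha⟩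
    ⟨h ⟨hb, hbV⟩, hef₁ hb⟩ haV hbV
  rw [hM.edge_eq_of_subset_face he hE hf₁ hef₁ Set.inter_subset_right ?_]
  · exact Set.inter_subset_left
  · ext x
    rw [Set.mem_inter_iff, and_comm, hv, Set.mem_inter_iff, and_comm, hEv]

theorem IsCyclicMap.edge_eq_of_verts_eq (hM : M.IsCyclicMap) {e e' : Set Plane}
    (he : e ∈ M.edges) (he' : e' ∈ M.edges) (h : e ∩ M.verts = e' ∩ M.verts) : e = e' := by
  obtain ⟨f, f₂, -, hfe⟩ := hM.two_faces he
  obtain ⟨hf, hef⟩ := (hfe f).2 (Or.inl rfl)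
  refine hM.edge_eq_of_subset_face he he' hf hef ?_ h
  rw [hM.edge_subset_iff he' hf, ← h]
  exact Set.inter_subset_left.trans hef

/-- Faces with a common point have a common vertex. -/
theorem IsPolyhedralMap.exists_vert_mem (hM : M.IsPolyhedralMap) {f f' f'' : Set Plane}
    (hf : f ∈ M.faces) (hf' : f' ∈ M.faces) (hf'' : f'' ∈ M.faces)
    (h : (f ∩ f' ∩ f'').Nonempty) : ∃ v ∈ M.verts, v ∈ f ∧ v ∈ f' ∧ v ∈ f'' := by
  obtain ⟨x, ⟨hx, hx'⟩, hx''⟩ := h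
  have key : ∀ g ∈ M.faces, ∀ g' ∈ M.faces, x ∈ g → x ∈ g' →
      g = g' ∨ x ∈ M.verts ∨ g ∩ g' ∈ M.edges := by
    intro g hg g' hg' h1 h2
    by_cases hne : g = g'
    · exact Or.inl hne
    rcases hM.face_inter g hg g' hg' hne with h | ⟨v, hv, h⟩ | h
    · exact absurd (show x ∈ g ∩ g' from ⟨h1, h2⟩) (by rw [h]; simp)
    · have : x ∈ ({v} : Set Plane) := h ▸ ⟨h1, h2⟩
      rw [Set.mem_singleton_iff.1 this]
      exact Or.inr (Or.inl hv)
    · exact Or.inr (Or.inr h)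
  by_cases hxV : x ∈ M.verts
  · exact ⟨x, hxV, hx, hx', hx''⟩
  have hend : ∀ e ∈ M.edges, ∃ v ∈ M.verts, v ∈ e := fun e he => by
    obtain ⟨a, b, -, hv⟩ := hM.two_ends he
    exact ⟨a, (hv a).2 (Or.inl rfl)⟩
  have hface : ∀ g ∈ M.faces, ∃ v ∈ M.verts, v ∈ g := fun g hg => by
    obtain ⟨a, -, -, -, -, -, ha, -, -⟩ := hM.exists_three_verts hg
    exact ⟨a, ha.2, ha.1⟩
  rcases key f hf f' hf' hx hx' with rfl | h | h1
  · rcases key f hf f'' hf'' hx hx'' with rfl | h | h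
    · obtain ⟨v, hv, hvf⟩ := hface f hf
      exact ⟨v, hv, hvf, hvf, hvf⟩
    · exact absurd h hxV
    · obtain ⟨v, hv, hvf⟩ := hend _ h
      exact ⟨v, hv, hvf.1, hvf.1, hvf.2⟩
  · exact absurd h hxV
  rcases key f hf f'' hf'' hx hx'' with rfl | h | h2
  · obtain ⟨v, hv, hvf⟩ := hend _ h1
    exact ⟨v, hv, hvf.1, hvf.2, hvf.1⟩
  · exact absurd h hxV
  by_cases h12 : f ∩ f' = f ∩ f''
  · obtain ⟨v, hv, hvf⟩ := hend _ h1
    exact ⟨v, hv, hvf.1, hvf.2, (h12 ▸ hvf).2⟩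
  · exact absurd (hM.edge_inter _ h1 _ h2 h12 ⟨⟨hx, hx'⟩, hx, hx''⟩) hxV

/-! ### Rigidity of local isomorphisms onto a map on the plane -/

theorem IsPolyhedralMap.isCompact_face (hM : M.IsPolyhedralMap) {f : Set Plane}
    (hf : f ∈ M.faces) : IsCompact f := by
  obtain ⟨h, hc, -, rfl, -⟩ := hM.face_polygon f hf
  exact isCompact_range hc

theorem IsPolyhedralMap.isPreconnected_face (hM : M.IsPolyhedralMap) {f : Set Plane}
    (hf : f ∈ M.faces) : IsPreconnected f := by
  obtain ⟨h, hc, -, rfl, -⟩ := hM.face_polygon f hf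
  have : PreconnectedSpace (Metric.closedBall (0 : Plane) 1) :=
    isPreconnected_iff_preconnectedSpace.1 (convex_closedBall _ _).isPreconnected
  exact isPreconnected_range hc

/-- Let `A` be the vertex set and `Φ` the set of faces (each given by its vertices) of an abstract
connected map, and let `φ` send vertices of `A` to vertices of a polyhedral map on the plane. If
`φ` carries faces to faces, and the faces at a vertex, as well as those at a pair of vertices of a
common face, to the corresponding faces of the plane map, then `φ` is bijective onto the vertices,
because the plane is simply connected. -/
theorem IsPolyhedralMap.bijective_of_local_iso (hM : M.IsPolyhedralMap) {A : Type*} [Nonempty A]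
    {φ : A → Plane} (hφ : ∀ a, φ a ∈ M.verts) {Φ : Set (Set A)}
    (hface : ∀ p ∈ Φ, ∃ f ∈ M.faces, φ '' p = f ∩ M.verts)
    (hlift : ∀ x, ∀ f ∈ M.faces, φ x ∈ f → ∃ p ∈ Φ, x ∈ p ∧ φ '' p = f ∩ M.verts)
    (huniq : ∀ p ∈ Φ, ∀ q ∈ Φ, ∀ x, x ∈ p → x ∈ q → φ '' p = φ '' q → p = q)
    (hinj : ∀ p ∈ Φ, Set.InjOn φ p)
    (hedge : ∀ p ∈ Φ, ∀ x ∈ p, ∀ y ∈ p, x ≠ y → ∀ f ∈ M.faces, f ∩ M.verts ≠ φ '' p → φ x ∈ f →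
      φ y ∈ f → ∃ q ∈ Φ, x ∈ q ∧ y ∈ q ∧ φ '' q = f ∩ M.verts)
    (hconn : ∀ x y, Relation.ReflTransGen (fun x y => ∃ p ∈ Φ, x ∈ p ∧ y ∈ p) x y) :
    Function.Injective φ ∧ Set.range φ = M.verts := by
  choose g hg hgV using hface
  have hedge' : ∀ p ∈ Φ, ∀ x ∈ p, ∀ y ∈ p, ∀ f ∈ M.faces, φ x ∈ f → φ y ∈ f →
      ∃ q ∈ Φ, x ∈ q ∧ y ∈ q ∧ φ '' q = f ∩ M.verts := by
    intro p hp x hx y hy f hf hxf hyf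
    by_cases hxy : x = y
    · subst hxy
      obtain ⟨q, hq, hxq, hqf⟩ := hlift x f hf hxf
      exact ⟨q, hq, hxq, hxq, hqf⟩
    by_cases hpf : f ∩ M.verts = φ '' p
    · exact ⟨p, hp, hx, hy, hpf.symm⟩
    · exact hedge p hp x hx y hy hxy f hf hpf hxf hyf
  let π : Φ → M.faces := fun p => ⟨g p.1 p.2, hg _ _⟩
  have hπ : ∀ p : Φ, φ '' p.1 = (π p).1 ∩ M.verts := fun p => hgV _ _
  have hπmem : ∀ (p : Φ) x, x ∈ p.1 → φ x ∈ (π p).1 := fun p x hx => by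
    have : φ x ∈ (π p).1 ∩ M.verts := hπ p ▸ ⟨x, hx, rfl⟩
    exact this.1
  have hπex : ∀ (p : Φ) v, v ∈ M.verts → v ∈ (π p).1 → ∃ x ∈ p.1, φ x = v := fun p v hv hvp => by
    have : v ∈ φ '' p.1 := hπ p ▸ ⟨hvp, hv⟩
    exact this
  have hπeq : ∀ (p : Φ) f, f ∈ M.faces → φ '' p.1 = f ∩ M.verts → (π p).1 = f := fun p f hf h =>
    hM.face_eq_of_verts_subset (π p).2 hf ((hπ p).symm.trans h ▸ Set.inter_subset_left)
  have hne : ∀ f : M.faces, (f : Set Plane).Nonempty := fun f => by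
    obtain ⟨a, -, -, -, -, -, ha, -, -⟩ := hM.exists_three_verts f.2
    exact ⟨a, ha.1⟩
  have hcov : ∀ x, ∃ f : M.faces, x ∈ (f : Set Plane) := fun x => by
    have : x ∈ ⋃₀ M.faces := hM.cover ▸ Set.mem_univ x
    obtain ⟨f, hf, hx⟩ := this
    exact ⟨⟨f, hf⟩, hx⟩
  have hcovA : ∀ x, ∃ p : Φ, x ∈ p.1 := fun x => by
    obtain ⟨f, hf⟩ := hcov (φ x)
    obtain ⟨p, hp, hx, -⟩ := hlift x f f.2 hf
    exact ⟨⟨p, hp⟩, hx⟩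
  have : Nonempty Φ := ⟨(hcovA (Classical.arbitrary A)).choose⟩
  have hbij : Function.Bijective π := by
    refine bijective_of_unique_lift (C := fun f : M.faces => (f : Set Plane))
      (fun f => (hM.isCompact_face f.2).isClosed) (fun f => hM.isPreconnected_face f.2)
      hM.locallyFinite hcov hne π (fun p q => (p.1 ∩ q.1).Nonempty) ?_ ?_ ?_ ?_ ?_ ?_ ?_
    · intro p
      obtain ⟨x, -, -, -, -, -, hx, -, -⟩ := hM.exists_three_verts (π p).2
      obtain ⟨y, hy, -⟩ := hπex p x hx.2 hx.1
      exact ⟨y, hy, hy⟩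
    · intro p q h
      rwa [Set.inter_comm]
    · rintro p q ⟨x, hp, hq⟩
      exact ⟨φ x, hπmem p x hp, hπmem q x hq⟩
    · rintro p f hpf
      obtain ⟨v, hv, hvp, -, hvf⟩ := hM.exists_vert_mem (π p).2 (π p).2 f.2
        (by rwa [Set.inter_self])
      obtain ⟨x, hx, rfl⟩ := hπex p v hv hvp
      obtain ⟨q, hq, hxq, hqf⟩ := hlift x f f.2 hvf
      exact ⟨⟨q, hq⟩, Subtype.ext (hπeq ⟨q, hq⟩ f f.2 hqf), x, hx, hxq⟩
    · rintro p q r ⟨a, hap, haq⟩ ⟨b, hbp, hbr⟩ hqr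
      have hqr' : φ '' q.1 = φ '' r.1 := by rw [hπ, hπ, hqr]
      obtain ⟨s, hs, has, hbs, hsf⟩ := hedge' p p.2 a hap b hbp (π q) (π q).2 (hπmem q a haq)
        (hqr ▸ hπmem r b hbr)
      rw [← hπ] at hsf
      exact Subtype.ext ((huniq q q.2 s hs a haq has hsf.symm).trans
        (huniq s hs r r.2 b hbs hbr (hsf.trans hqr')))
    · rintro p q r ⟨a, hap, haq⟩ ⟨b, hbq, hbr⟩ h
      obtain ⟨v, hv, hvp, hvq, hvr⟩ := hM.exists_vert_mem (π p).2 (π q).2 (π r).2 h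
      obtain ⟨z, hz, rfl⟩ := hπex q v hv hvq
      have hzmem : ∀ t : Φ, ∀ c ∈ t.1, c ∈ q.1 → φ z ∈ (π t).1 → z ∈ t.1 := by
        intro t c hct hcq hzt
        obtain ⟨s, hs, hcs, hzs, hsf⟩ := hedge' q q.2 c hcq z hz (π t) (π t).2 (hπmem t c hct) hzt
        rw [← hπ] at hsf
        rwa [huniq t t.2 s hs c hct hcs hsf.symm]
      exact ⟨z, hzmem p a hap haq hvp, hzmem r b hbr hbq hvr⟩
    · intro p q
      obtain ⟨x, -, -, -, -, -, hx, -, -⟩ := hM.exists_three_verts (π p).2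
      obtain ⟨a, ha, -⟩ := hπex p x hx.2 hx.1
      obtain ⟨y, -, -, -, -, -, hy, -, -⟩ := hM.exists_three_verts (π q).2
      obtain ⟨b, hb, -⟩ := hπex q y hy.2 hy.1
      have key : ∀ c, Relation.ReflTransGen (fun x y => ∃ p ∈ Φ, x ∈ p ∧ y ∈ p) a c →
          ∀ r : Φ, c ∈ r.1 → Relation.ReflTransGen
            (fun p q : Φ => (p.1 ∩ q.1).Nonempty) p r := by
        intro c hc
        induction hc with
        | refl => exact fun r hr => Relation.ReflTransGen.single ⟨a, ha, hr⟩
        | @tail c d _ hcd ih =>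
          obtain ⟨s, hs, hcs, hds⟩ := hcd
          exact fun r hr => (ih ⟨s, hs⟩ hcs).tail ⟨d, hds, hr⟩
      exact key b (hconn a b) q hb
  constructor
  · intro x y hxy
    obtain ⟨p, hp⟩ := hcovA x
    obtain ⟨q, hq, hyq, hqf⟩ := hlift y (π p) (π p).2 (hxy ▸ hπmem p x hp)
    obtain rfl : p = ⟨q, hq⟩ :=
      hbij.1 (Subtype.ext (hπeq ⟨q, hq⟩ (π p) (π p).2 hqf)).symm
    exact hinj q hq hp hyq hxy
  · refine Set.Subset.antisymm (by rintro _ ⟨a, rfl⟩; exact hφ a) fun v hv => ?_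
    obtain ⟨f, hf⟩ := hcov v
    obtain ⟨p, rfl⟩ := hbij.2 f
    obtain ⟨x, -, hx⟩ := hπex p v hv hf
    exact ⟨x, hx⟩

end PlaneCells

namespace PlaneCells

variable {M : PlaneCells}

/-! ### Flags -/

/-- A flag of a map: a vertex on an edge on a face. -/
@[ext]
structure Flag (M : PlaneCells) where
  vert : Plane
  edge : Set Plane
  face : Set Plane
  vert_mem : vert ∈ M.verts
  edge_mem : edge ∈ M.edges
  face_mem : face ∈ M.faces
  vert_edge : vert ∈ edge
  edge_face : edge ⊆ face

namespace IsCyclicMap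

theorem exists_flipVert (hM : M.IsCyclicMap) (x : M.Flag) :
    ∃ y : M.Flag, (y.edge = x.edge ∧ y.face = x.face ∧ y.vert ≠ x.vert) ∧
      ∀ z : M.Flag, z.edge = x.edge → z.face = x.face → z = x ∨ z = y := by
  obtain ⟨a, b, hab, hv⟩ := hM.two_ends x.edge_mem
  have key : ∃ w, w ≠ x.vert ∧ ∀ v, (v ∈ M.verts ∧ v ∈ x.edge) ↔ v = x.vert ∨ v = w := by
    rcases (hv _).1 ⟨x.vert_mem, x.vert_edge⟩ with h | h <;> rw [h]
    · exact ⟨b, hab.symm, hv⟩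
    · exact ⟨a, hab, fun v => (hv v).trans or_comm⟩
  obtain ⟨w, hw, hwv⟩ := key
  obtain ⟨hwV, hwe⟩ := (hwv w).2 (Or.inr rfl)
  refine ⟨⟨w, x.edge, x.face, hwV, x.edge_mem, x.face_mem, hwe, x.edge_face⟩, ⟨rfl, rfl, hw⟩,
    fun z hze hzf => ?_⟩
  rcases (hwv z.vert).1 ⟨z.vert_mem, hze ▸ z.vert_edge⟩ with h | h
  · exact Or.inl (Flag.ext h hze hzf)
  · exact Or.inr (Flag.ext h hze hzf)

theorem exists_flipEdge (hM : M.IsCyclicMap) (x : M.Flag) :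
    ∃ y : M.Flag, (y.vert = x.vert ∧ y.face = x.face ∧ y.edge ≠ x.edge) ∧
      ∀ z : M.Flag, z.vert = x.vert → z.face = x.face → z = x ∨ z = y := by
  obtain ⟨a, b, hab, hv⟩ := hM.two_edges x.face_mem x.vert_mem (x.edge_face x.vert_edge)
  have key : ∃ w, w ≠ x.edge ∧
      ∀ e, (e ∈ M.edges ∧ x.vert ∈ e ∧ e ⊆ x.face) ↔ e = x.edge ∨ e = w := by
    rcases (hv _).1 ⟨x.edge_mem, x.vert_edge, x.edge_face⟩ with h | h <;> rw [h]
    · exact ⟨b, hab.symm, hv⟩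
    · exact ⟨a, hab, fun v => (hv v).trans or_comm⟩
  obtain ⟨w, hw, hwv⟩ := key
  obtain ⟨hwE, hwv', hwf⟩ := (hwv w).2 (Or.inr rfl)
  refine ⟨⟨x.vert, w, x.face, x.vert_mem, hwE, x.face_mem, hwv', hwf⟩, ⟨rfl, rfl, hw⟩,
    fun z hzv hzf => ?_⟩
  rcases (hwv z.edge).1 ⟨z.edge_mem, hzv ▸ z.vert_edge, hzf ▸ z.edge_face⟩ with h | h
  · exact Or.inl (Flag.ext hzv h hzf)
  · exact Or.inr (Flag.ext hzv h hzf)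

theorem exists_flipFace (hM : M.IsCyclicMap) (x : M.Flag) :
    ∃ y : M.Flag, (y.vert = x.vert ∧ y.edge = x.edge ∧ y.face ≠ x.face) ∧
      ∀ z : M.Flag, z.vert = x.vert → z.edge = x.edge → z = x ∨ z = y := by
  obtain ⟨a, b, hab, hv⟩ := hM.two_faces x.edge_mem
  have key : ∃ w, w ≠ x.face ∧
      ∀ f, (f ∈ M.faces ∧ x.edge ⊆ f) ↔ f = x.face ∨ f = w := by
    rcases (hv _).1 ⟨x.face_mem, x.edge_face⟩ with h | h <;> rw [h]
    · exact ⟨b, hab.symm, hv⟩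
    · exact ⟨a, hab, fun v => (hv v).trans or_comm⟩
  obtain ⟨w, hw, hwv⟩ := key
  obtain ⟨hwF, hwf⟩ := (hwv w).2 (Or.inr rfl)
  refine ⟨⟨x.vert, x.edge, w, x.vert_mem, x.edge_mem, hwF, x.vert_edge, hwf⟩, ⟨rfl, rfl, hw⟩,
    fun z hzv hze => ?_⟩
  rcases (hwv z.face).1 ⟨z.face_mem, hze ▸ z.edge_face⟩ with h | h
  · exact Or.inl (Flag.ext hzv hze h)
  · exact Or.inr (Flag.ext hzv hze h)

/-- The flag that differs from `x` in the vertex only. -/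
noncomputable def flipVert (hM : M.IsCyclicMap) (x : M.Flag) : M.Flag :=
  (hM.exists_flipVert x).choose

/-- The flag that differs from `x` in the edge only. -/
noncomputable def flipEdge (hM : M.IsCyclicMap) (x : M.Flag) : M.Flag :=
  (hM.exists_flipEdge x).choose

/-- The flag that differs from `x` in the face only. -/
noncomputable def flipFace (hM : M.IsCyclicMap) (x : M.Flag) : M.Flag :=
  (hM.exists_flipFace x).choose

variable (hM : M.IsCyclicMap) (x y : M.Flag)

@[simp] theorem flipVert_edge : (hM.flipVert x).edge = x.edge :=
  (hM.exists_flipVert x).choose_spec.1.1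

@[simp] theorem flipVert_face : (hM.flipVert x).face = x.face :=
  (hM.exists_flipVert x).choose_spec.1.2.1

theorem flipVert_vert_ne : (hM.flipVert x).vert ≠ x.vert :=
  (hM.exists_flipVert x).choose_spec.1.2.2

@[simp] theorem flipEdge_vert : (hM.flipEdge x).vert = x.vert :=
  (hM.exists_flipEdge x).choose_spec.1.1

@[simp] theorem flipEdge_face : (hM.flipEdge x).face = x.face :=
  (hM.exists_flipEdge x).choose_spec.1.2.1

theorem flipEdge_edge_ne : (hM.flipEdge x).edge ≠ x.edge :=
  (hM.exists_flipEdge x).choose_spec.1.2.2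

@[simp] theorem flipFace_vert : (hM.flipFace x).vert = x.vert :=
  (hM.exists_flipFace x).choose_spec.1.1

@[simp] theorem flipFace_edge : (hM.flipFace x).edge = x.edge :=
  (hM.exists_flipFace x).choose_spec.1.2.1

theorem flipFace_face_ne : (hM.flipFace x).face ≠ x.face :=
  (hM.exists_flipFace x).choose_spec.1.2.2

variable {x y}

theorem eq_or_eq_flipVert (he : y.edge = x.edge) (hf : y.face = x.face) :
    y = x ∨ y = hM.flipVert x :=
  (hM.exists_flipVert x).choose_spec.2 y he hf

theorem eq_or_eq_flipEdge (hv : y.vert = x.vert) (hf : y.face = x.face) :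
    y = x ∨ y = hM.flipEdge x :=
  (hM.exists_flipEdge x).choose_spec.2 y hv hf

theorem eq_or_eq_flipFace (hv : y.vert = x.vert) (he : y.edge = x.edge) :
    y = x ∨ y = hM.flipFace x :=
  (hM.exists_flipFace x).choose_spec.2 y hv he

theorem eq_flipVert (he : y.edge = x.edge) (hf : y.face = x.face) (hv : y.vert ≠ x.vert) :
    y = hM.flipVert x :=
  (hM.eq_or_eq_flipVert he hf).resolve_left fun h => hv (by rw [h])

theorem eq_flipEdge (hv : y.vert = x.vert) (hf : y.face = x.face) (he : y.edge ≠ x.edge) :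
    y = hM.flipEdge x :=
  (hM.eq_or_eq_flipEdge hv hf).resolve_left fun h => he (by rw [h])

theorem eq_flipFace (hv : y.vert = x.vert) (he : y.edge = x.edge) (hf : y.face ≠ x.face) :
    y = hM.flipFace x :=
  (hM.eq_or_eq_flipFace hv he).resolve_left fun h => hf (by rw [h])

variable (x)

@[simp] theorem flipVert_flipVert : hM.flipVert (hM.flipVert x) = x :=
  (hM.eq_flipVert (by simp) (by simp) (hM.flipVert_vert_ne x).symm).symm

@[simp] theorem flipEdge_flipEdge : hM.flipEdge (hM.flipEdge x) = x :=
  (hM.eq_flipEdge (by simp) (by simp) (hM.flipEdge_edge_ne x).symm).symm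

@[simp] theorem flipFace_flipFace : hM.flipFace (hM.flipFace x) = x :=
  (hM.eq_flipFace (by simp) (by simp) (hM.flipFace_face_ne x).symm).symm

theorem flipVert_vert_congr {x y : M.Flag} (hv : x.vert = y.vert) (he : x.edge = y.edge) :
    (hM.flipVert x).vert = (hM.flipVert y).vert := by
  obtain ⟨a, b, -, h⟩ := hM.two_ends x.edge_mem
  have h1 := (h _).1 ⟨x.vert_mem, x.vert_edge⟩
  have h2 := (h _).1 ⟨(hM.flipVert x).vert_mem, by simpa using (hM.flipVert x).vert_edge⟩
  have h3 := (h _).1 ⟨(hM.flipVert y).vert_mem, by simpa [he] using (hM.flipVert y).vert_edge⟩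
  have h4 := hM.flipVert_vert_ne x
  have h5 := hM.flipVert_vert_ne y
  rw [← hv] at h5
  rcases h1 with h1 | h1 <;> rcases h2 with h2 | h2 <;> rcases h3 with h3 | h3 <;>
    simp_all

theorem flipVert_flipFace : hM.flipVert (hM.flipFace x) = hM.flipFace (hM.flipVert x) := by
  refine hM.eq_flipFace ?_ (by simp) ?_
  · exact hM.flipVert_vert_congr (by simp) (by simp)
  · simpa using hM.flipFace_face_ne x

theorem mem_edge_iff (x : M.Flag) {v : Plane} (hv : v ∈ M.verts) :
    v ∈ x.edge ↔ v = x.vert ∨ v = (hM.flipVert x).vert := by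
  obtain ⟨a, b, -, h⟩ := hM.two_ends x.edge_mem
  have h0 := h v
  have h1 := (h _).1 ⟨x.vert_mem, x.vert_edge⟩
  have h2 := (h _).1 ⟨(hM.flipVert x).vert_mem, by simpa using (hM.flipVert x).vert_edge⟩
  have h4 := hM.flipVert_vert_ne x
  rcases h1 with h1 | h1 <;> rcases h2 with h2 | h2 <;> simp_all [or_comm]

/-- The flags of an `n`-gon form a cycle: those of one orientation are `c 0, …, c (n - 1)`. -/
theorem exists_faceFlags {f : Set Plane} (hf : f ∈ M.faces) :
    ∃ c : Fin (M.size f) → M.Flag, (∀ i, (c i).face = f) ∧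
      Function.Injective (fun i => (c i).vert) ∧
      (∀ i, hM.flipEdge (hM.flipVert (c i)) = c (finRotate _ i)) ∧
      ∀ y : M.Flag, y.face = f → ∃ i, y = c i ∨ y = hM.flipVert (c i) := by
  obtain ⟨n, v, e, hb⟩ := hM.exists_boundary hf
  obtain rfl := hb.size_eq
  let c : Fin (M.size f) → M.Flag := fun i => ⟨v i, e i, f, hb.vert i, hb.edge i, hf,
    hb.vert_mem_edge.2 (Or.inl rfl), hb.edge_subset i⟩
  have hc : ∀ i, (hM.flipVert (c i)).vert = v (finRotate _ i) := fun i => by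
    have h1 : v (finRotate _ i) ∈ (c i).edge := hb.vert_mem_edge.2 (Or.inr rfl)
    refine (((hM.mem_edge_iff (c i) (hb.vert _)).1 h1).resolve_left fun h => ?_).symm
    exact finRotate_ne_self hb.three_le i (hb.inj h)
  refine ⟨c, fun _ => rfl, hb.inj, fun i => ?_, fun y hy => ?_⟩
  · refine (hM.eq_flipEdge (hc i).symm (by simp [c]) fun h => ?_).symm
    have h' : e (finRotate _ i) = e i := by simpa [c] using h
    exact finRotate_ne_self hb.three_le i (hb.edge_injective h')
  · obtain ⟨i, hi⟩ := hb.exists_eq_edge hM.toIsPolyhedralMap y.edge_mem (hy ▸ y.edge_face)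
    exact ⟨i, hM.eq_or_eq_flipVert (x := c i) hi hy⟩

/-- The flags at a vertex form a cycle, which follows the face cycle. -/
theorem exists_vertFlags {v : Plane} (hv : v ∈ M.verts) {p : List ℕ} (hp : 3 ≤ p.length)
    (h : M.HasFaceCycle v p) :
    ∃ b : Fin p.length → M.Flag, (∀ i, (b i).vert = v) ∧
      Function.Injective (fun i => (b i).edge) ∧
      (∀ i, M.size (b i).face = p.get i) ∧
      (∀ i, hM.flipFace (hM.flipEdge (b i)) = b (finRotate _ i)) ∧
      ∀ y : M.Flag, y.vert = v → ∃ i, y = b i ∨ y = hM.flipEdge (b i) := by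
  obtain ⟨E, F, hE, hEr, hF, hFr, hEF⟩ := h
  have hEm : ∀ i, E i ∈ M.edges ∧ v ∈ E i := fun i => by
    have : E i ∈ {a | a ∈ M.edges ∧ v ∈ a} := hEr ▸ ⟨i, rfl⟩
    exact this
  have hFm : ∀ i, F i ∈ M.faces ∧ v ∈ F i := fun i => by
    have : F i ∈ {f | f ∈ M.faces ∧ v ∈ f} := hFr ▸ ⟨i, rfl⟩
    exact this
  let b : Fin p.length → M.Flag := fun i => ⟨v, E i, F i, hv, (hEm i).1, (hFm i).1, (hEm i).2,
    (hEF i).1⟩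
  have hb : ∀ i, (hM.flipEdge (b i)).edge = E (finRotate _ i) := fun i => by
    let z : M.Flag := ⟨v, E (finRotate _ i), F i, hv, (hEm _).1, (hFm i).1, (hEm _).2, (hEF i).2.1⟩
    have hz : z = hM.flipEdge (b i) := hM.eq_flipEdge rfl rfl fun h =>
      finRotate_ne_self hp i (hE h)
    rw [← hz]
  refine ⟨b, fun _ => rfl, hE, fun i => (hEF i).2.2, fun i => ?_, fun y hy => ?_⟩
  · refine (hM.eq_flipFace (by simp [b]) (hb i).symm fun h => ?_).symm
    have h' : F (finRotate _ i) = F i := by simpa [b] using h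
    exact finRotate_ne_self hp i (hF h')
  · have : y.face ∈ Set.range F := hFr ▸ ⟨y.face_mem, hy ▸ y.edge_face y.vert_edge⟩
    obtain ⟨i, hi⟩ := this
    exact ⟨i, hM.eq_or_eq_flipEdge (x := b i) hy hi.symm⟩

end IsCyclicMap

end PlaneCells

theorem finRotate_induction {n : ℕ} {Q : Fin n → Prop} (hQ : ∀ i, Q i → Q (finRotate n i))
    {i : Fin n} (hi : Q i) (j : Fin n) : Q j := by
  have : NeZero n := ⟨fun h => by subst h; exact i.elim0⟩
  have key : ∀ k : ℕ, Q (i + Fin.ofNat n k) := by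
    intro k
    induction k with
    | zero => simpa using hi
    | succ k ih =>
      have h := hQ _ ih
      rw [finRotate_apply] at h
      convert h using 1
      ext
      simp [Fin.val_add, Nat.add_assoc]
  have h := key (j - i).val
  simpa using h

theorem iterate_finRotate_self {n : ℕ} (i : Fin n) : (finRotate n)^[n] i = i := by
  have : NeZero n := ⟨fun h => by subst h; exact i.elim0⟩
  have key : ∀ k : ℕ, (finRotate n)^[k] i = i + Fin.ofNat n k := by
    intro k
    induction k with
    | zero => simp
    | succ k ih =>
      rw [Function.iterate_succ_apply', ih, finRotate_apply]
      ext
      simp [Fin.val_add, Nat.add_assoc]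
  rw [key]
  ext
  simp

namespace PlaneCells

variable {M : PlaneCells}

namespace IsCyclicMap

variable (hM : M.IsCyclicMap)

include hM

/-- The flags of a face are permuted transitively by changing vertices and edges. -/
theorem faceFlags_induction {P : M.Flag → Prop} (h0 : ∀ y, P y → P (hM.flipVert y))
    (h1 : ∀ y, P y → P (hM.flipEdge y)) {x : M.Flag} (hx : P x) {y : M.Flag}
    (hy : y.face = x.face) : P y := by
  obtain ⟨c, -, -, hrot, hall⟩ := hM.exists_faceFlags x.face_mem
  have key : ∀ j, P (c j) := by
    obtain ⟨i, h | h⟩ := hall x rfl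
    all_goals
      refine finRotate_induction (Q := fun j => P (c j)) (i := i) (fun j hj => ?_) ?_
      · rw [← hrot]
        exact h1 _ (h0 _ hj)
    · rwa [← h]
    · rw [← hM.flipVert_flipVert (c i), ← h]
      exact h0 _ hx
  obtain ⟨j, rfl | rfl⟩ := hall y hy
  · exact key j
  · exact h0 _ (key j)

/-- The flags at a vertex are permuted transitively by changing edges and faces. -/
theorem vertFlags_induction {P : M.Flag → Prop} (h1 : ∀ y, P y → P (hM.flipEdge y))
    (h2 : ∀ y, P y → P (hM.flipFace y)) {x : M.Flag} (hx : P x) {y : M.Flag}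
    (hy : y.vert = x.vert) : P y := by
  obtain ⟨p, hp, hcyc⟩ := hM.exists_faceCycle x.vert x.vert_mem
  obtain ⟨b, -, -, -, hrot, hall⟩ := hM.exists_vertFlags x.vert_mem hp hcyc
  have key : ∀ j, P (b j) := by
    obtain ⟨i, h | h⟩ := hall x rfl
    all_goals
      refine finRotate_induction (Q := fun j => P (b j)) (i := i) (fun j hj => ?_) ?_
      · rw [← hrot]
        exact h2 _ (h1 _ hj)
    · rwa [← h]
    · rw [← hM.flipEdge_flipEdge (b i), ← h]
      exact h1 _ hx
  obtain ⟨j, rfl | rfl⟩ := hall y hy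
  · exact key j
  · exact h1 _ (key j)

/-- Going once around an `n`-gon takes `n` steps. -/
theorem iterate_face (x : M.Flag) :
    (fun y => hM.flipEdge (hM.flipVert y))^[M.size x.face] x = x := by
  obtain ⟨c, -, -, hrot, hall⟩ := hM.exists_faceFlags x.face_mem
  have key : ∀ k i, (fun y => hM.flipEdge (hM.flipVert y))^[k] (c i) = c ((finRotate _)^[k] i) := by
    intro k
    induction k with
    | zero => simp
    | succ k ih => intro i; rw [Function.iterate_succ_apply, hrot, ih, Function.iterate_succ_apply]
  have hc : ∀ i, (fun y => hM.flipEdge (hM.flipVert y))^[M.size x.face] (c i) = c i := fun i => by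
    rw [key, iterate_finRotate_self]
  -- The two orientations are exchanged by `flipVert`, which inverts the rotation.
  have inv : ∀ k z, (fun y => hM.flipEdge (hM.flipVert y))^[k] (hM.flipVert
      ((fun y => hM.flipEdge (hM.flipVert y))^[k] z)) = hM.flipVert z := by
    intro k
    induction k with
    | zero => simp
    | succ k ih =>
      intro z
      rw [Function.iterate_succ_apply, Function.iterate_succ_apply']
      simpa using ih z
  have hx : ∀ z : M.Flag, z.face = x.face →
      (fun y => hM.flipEdge (hM.flipVert y))^[M.size x.face] z = z := by
    intro z hz
    obtain ⟨i, rfl | rfl⟩ := hall z hz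
    · exact hc i
    · have := inv (M.size x.face) (c i)
      rwa [hc] at this
  exact hx x rfl

theorem ncard_vertFlags {v : Plane} (hv : v ∈ M.verts) {p : List ℕ} (hp : 3 ≤ p.length)
    (h : M.HasFaceCycle v p) : 2 * p.length ≤ {y : M.Flag | y.vert = v}.ncard := by
  obtain ⟨b, hbv, hinj, -, hrot, hall⟩ := hM.exists_vertFlags hv hp h
  have hbinj : Function.Injective b := fun i j hij => hinj (by simp [hij])
  have hne : ∀ i j, b i ≠ hM.flipEdge (b j) := by
    intro i j hij
    -- `b i` and `flipEdge (b j)` have edges `e i` and `e (j + 1)` and faces `F i` and `F j`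
    have h1 : (b i).edge = (b (finRotate _ j)).edge := by
      rw [← hrot, flipFace_edge, hij]
    have h2 := hinj h1
    rw [h2] at hij
    have h3 := hrot j
    rw [← hij] at h3
    exact hM.flipFace_face_ne (b (finRotate _ j)) (by rw [h3])
  let m : Fin p.length ⊕ Fin p.length → M.Flag := Sum.elim b fun i => hM.flipEdge (b i)
  have hm : Function.Injective m := by
    refine hbinj.sumElim (fun i j hij => hbinj ?_) hne
    rw [← hM.flipEdge_flipEdge (b i), ← hM.flipEdge_flipEdge (b j), hij]
  have hset : {y : M.Flag | y.vert = v} = Set.range m := by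
    ext y
    constructor
    · intro hy
      obtain ⟨i, h | h⟩ := hall y hy
      · exact ⟨Sum.inl i, h.symm⟩
      · exact ⟨Sum.inr i, h.symm⟩
    · rintro ⟨i | i, rfl⟩ <;> simp [m, hbv]
  rw [hset, ← Set.image_univ, Set.ncard_image_of_injective _ hm, Set.ncard_univ]
  simp [two_mul]

end IsCyclicMap

/-! ### Maps described by their vertex sets -/

/-- The map `M` is described by its vertices: `α` parametrizes the vertices, the edges and the
faces are determined by the vertices they contain, these sets of vertices are given by `E` and `F`,
and incidence of edges and faces can be read off from the vertices. -/
structure Realizes (M : PlaneCells) {A : Type*} (α : A → Plane) (E F : Set (Set A)) : Prop where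
  inj : Function.Injective α
  range_eq : Set.range α = M.verts
  exists_edge_iff : ∀ t : Set Plane, (∃ e ∈ M.edges, e ∩ M.verts = t) ↔ ∃ s ∈ E, α '' s = t
  exists_face_iff : ∀ t : Set Plane, (∃ f ∈ M.faces, f ∩ M.verts = t) ↔ ∃ s ∈ F, α '' s = t
  edge_inj : ∀ e ∈ M.edges, ∀ e' ∈ M.edges, e ∩ M.verts = e' ∩ M.verts → e = e'
  face_inj : ∀ f ∈ M.faces, ∀ f' ∈ M.faces, f ∩ M.verts = f' ∩ M.verts → f = f'
  edge_subset : ∀ e ∈ M.edges, ∀ f ∈ M.faces, e ∩ M.verts ⊆ f → e ⊆ f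

namespace Realizes

variable {N : PlaneCells} {A : Type*} {α β : A → Plane} {E F : Set (Set A)}

theorem mem_verts (h : M.Realizes α E F) (a : A) : α a ∈ M.verts := h.range_eq ▸ ⟨a, rfl⟩

/-- The cells with prescribed vertices, as a bijection from the abstract cells. -/
theorem exists_cellEquiv {V : Set Plane} {α : A → Plane} (hα : Function.Injective α)
    {C : Set (Set Plane)} {E : Set (Set A)}
    (h : ∀ t : Set Plane, (∃ e ∈ C, e ∩ V = t) ↔ ∃ s ∈ E, α '' s = t)
    (hinj : ∀ e ∈ C, ∀ e' ∈ C, e ∩ V = e' ∩ V → e = e') :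
    ∃ ψ : E ≃ C, ∀ s : E, (ψ s : Set Plane) ∩ V = α '' s := by
  have h1 : ∀ s : E, ∃ e : C, (e : Set Plane) ∩ V = α '' s := fun s => by
    obtain ⟨e, he, hes⟩ := (h _).2 ⟨s, s.2, rfl⟩
    exact ⟨⟨e, he⟩, hes⟩
  choose ψ hψ using h1
  refine ⟨Equiv.ofBijective ψ ⟨fun s t hst => ?_, fun e => ?_⟩, hψ⟩
  · have := hψ s
    rw [hst, hψ t] at this
    exact Subtype.ext (hα.image_injective this).symm
  · obtain ⟨s, hs, hse⟩ := (h _).1 ⟨e, e.2, rfl⟩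
    exact ⟨⟨s, hs⟩, Subtype.ext (hinj _ (ψ _).2 _ e.2 ((hψ _).trans hse))⟩

theorem edge_subset_iff (h : M.Realizes α E F) {e f : Set Plane} (he : e ∈ M.edges)
    (hf : f ∈ M.faces) : e ⊆ f ↔ e ∩ M.verts ⊆ f ∩ M.verts :=
  ⟨fun hef => Set.inter_subset_inter_left _ hef,
    fun hef => h.edge_subset e he f hf (hef.trans Set.inter_subset_left)⟩

/-- Maps with the same description by vertices are isomorphic. -/
theorem isomorphic (hM : M.Realizes α E F) (hN : N.Realizes β E F) : M.Isomorphic N := by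
  obtain ⟨ψM, hψM⟩ := exists_cellEquiv hM.inj hM.exists_edge_iff hM.edge_inj
  obtain ⟨ψN, hψN⟩ := exists_cellEquiv hN.inj hN.exists_edge_iff hN.edge_inj
  obtain ⟨χM, hχM⟩ := exists_cellEquiv hM.inj hM.exists_face_iff hM.face_inj
  obtain ⟨χN, hχN⟩ := exists_cellEquiv hN.inj hN.exists_face_iff hN.face_inj
  let φM : A ≃ M.verts := (Equiv.ofInjective α hM.inj).trans (Equiv.setCongr hM.range_eq)
  let φN : A ≃ N.verts := (Equiv.ofInjective β hN.inj).trans (Equiv.setCongr hN.range_eq)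
  have key : ∀ {L : PlaneCells} {γ : A → Plane}, L.Realizes γ E F → ∀ (a : A) (s : Set A)
      (t : Set Plane), t ∩ L.verts = γ '' s → (γ a ∈ t ↔ a ∈ s) := by
    intro L γ hL a s t hst
    rw [← hL.inj.mem_set_image, ← hst]
    simp [hL.mem_verts a]
  refine ⟨φM.symm.trans φN, ψM.symm.trans ψN, χM.symm.trans χN, fun v e => ?_, fun v f => ?_,
    fun e f => ?_⟩
  · obtain ⟨a, rfl⟩ := φM.surjective v
    obtain ⟨s, rfl⟩ := ψM.surjective e
    simp only [Equiv.trans_apply, Equiv.symm_apply_apply]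
    exact (key hM a s _ (hψM s)).trans (key hN a s _ (hψN s)).symm
  · obtain ⟨a, rfl⟩ := φM.surjective v
    obtain ⟨s, rfl⟩ := χM.surjective f
    simp only [Equiv.trans_apply, Equiv.symm_apply_apply]
    exact (key hM a s _ (hχM s)).trans (key hN a s _ (hχN s)).symm
  · obtain ⟨s, rfl⟩ := ψM.surjective e
    obtain ⟨t, rfl⟩ := χM.surjective f
    simp only [Equiv.trans_apply, Equiv.symm_apply_apply]
    rw [hM.edge_subset_iff (ψM s).2 (χM t).2, hN.edge_subset_iff (ψN s).2 (χN t).2, hψM, hψN, hχM,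
      hχN, Set.image_subset_image_iff hM.inj, Set.image_subset_image_iff hN.inj]

end Realizes

end PlaneCells

namespace PlaneCells

variable {M : PlaneCells}

/-- A model `Z` of the flags of an abstract map, with its three flag operations, and an equivariant
map `φ` from `Z` to the flags of the cyclic map `M`. The vertex of a model flag `z` is `pt z`, a
point of `A`; its face, given as a set of vertices, is `fc z`. -/
structure FlagModel (hM : M.IsCyclicMap) (Z A : Type*) where
  t₀ : Z → Z
  t₁ : Z → Z
  t₂ : Z → Z
  φ : Z → M.Flag
  pt : Z → A
  fc : Z → Set A
  φ_t₀ : ∀ z, φ (t₀ z) = hM.flipVert (φ z)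
  φ_t₁ : ∀ z, φ (t₁ z) = hM.flipEdge (φ z)
  φ_t₂ : ∀ z, φ (t₂ z) = hM.flipFace (φ z)
  pt_t₁ : ∀ z, pt (t₁ z) = pt z
  pt_t₂ : ∀ z, pt (t₂ z) = pt z
  pt_t₀_t₂ : ∀ z, pt (t₀ (t₂ z)) = pt (t₀ z)
  fc_t₀ : ∀ z, fc (t₀ z) = fc z
  fc_t₁ : ∀ z, fc (t₁ z) = fc z
  pt_surj : Function.Surjective pt
  pt_mem : ∀ z, pt z ∈ fc z
  exists_corner : ∀ z, ∀ x ∈ fc z, ∃ z', pt z' = x ∧ fc z' = fc z ∧ (φ z').face = (φ z).face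
  vert_eq : ∀ z z', pt z = pt z' → (φ z).vert = (φ z').vert
  finite_fibre : ∀ x, {z | pt z = x}.Finite
  card_fibre : ∀ z, {z' | pt z' = pt z}.ncard ≤ {y : M.Flag | y.vert = (φ z).vert}.ncard
  finite_fc : ∀ z, (fc z).Finite
  card_fc : ∀ z, (fc z).ncard ≤ M.size (φ z).face
  conn : ∀ P : Z → Prop, (∀ z, P z → P (t₀ z)) → (∀ z, P z → P (t₁ z)) → (∀ z, P z → P (t₂ z)) →
    ∀ z z', P z → P z'

namespace FlagModel

variable {hM : M.IsCyclicMap} {Z A : Type*} (m : FlagModel hM Z A)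

include m

/-- The flags at the vertex of `φ z` lift uniquely to model flags at the vertex of `z`. -/
theorem exists_lift (z : Z) {y : M.Flag} (hy : y.vert = (m.φ z).vert) :
    ∃ z', m.pt z' = m.pt z ∧ m.φ z' = y := by
  refine hM.vertFlags_induction (P := fun y => ∃ z', m.pt z' = m.pt z ∧ m.φ z' = y) ?_ ?_
    ⟨z, rfl, rfl⟩ hy
  · rintro y ⟨z', h, rfl⟩
    exact ⟨m.t₁ z', (m.pt_t₁ _).trans h, m.φ_t₁ _⟩
  · rintro y ⟨z', h, rfl⟩
    exact ⟨m.t₂ z', (m.pt_t₂ _).trans h, m.φ_t₂ _⟩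

theorem lift_unique {z z' : Z} (hpt : m.pt z = m.pt z') (h : m.φ z = m.φ z') : z = z' := by
  have himg : m.φ '' {w | m.pt w = m.pt z} = {y : M.Flag | y.vert = (m.φ z).vert} := by
    ext y
    constructor
    · rintro ⟨w, hw, rfl⟩
      exact m.vert_eq _ _ hw
    · intro hy
      obtain ⟨w, hw, rfl⟩ := m.exists_lift z hy
      exact ⟨w, hw, rfl⟩
  have hinj : Set.InjOn m.φ {w | m.pt w = m.pt z} := by
    refine Set.injOn_of_ncard_image_eq ?_ (m.finite_fibre _)
    exact le_antisymm (Set.ncard_image_le (m.finite_fibre _)) (himg ▸ m.card_fibre z)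
  exact hinj rfl hpt.symm h

theorem exists_lift_face (z : Z) {y : M.Flag} (hy : y.face = (m.φ z).face) :
    ∃ z', m.fc z' = m.fc z ∧ m.φ z' = y := by
  refine hM.faceFlags_induction (P := fun y => ∃ z', m.fc z' = m.fc z ∧ m.φ z' = y) ?_ ?_
    ⟨z, rfl, rfl⟩ hy
  · rintro y ⟨z', h, rfl⟩
    exact ⟨m.t₀ z', (m.fc_t₀ _).trans h, m.φ_t₀ _⟩
  · rintro y ⟨z', h, rfl⟩
    exact ⟨m.t₁ z', (m.fc_t₁ _).trans h, m.φ_t₁ _⟩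

theorem fc_eq_of_face_eq {z z' : Z} (hpt : m.pt z = m.pt z')
    (h : (m.φ z).face = (m.φ z').face) : m.fc z = m.fc z' := by
  rcases hM.eq_or_eq_flipEdge (m.vert_eq _ _ hpt) h with h | h
  · rw [m.lift_unique hpt h]
  · rw [← m.φ_t₁] at h
    rw [m.lift_unique (hpt.trans (m.pt_t₁ _).symm) h, m.fc_t₁]

/-- If the flags of a plane map have a flag model, then the map is described by the vertices of
the model. -/
theorem realizes [Nonempty A] : ∃ α : A → Plane, M.Realizes α
    {s | ∃ z, s = {m.pt z, m.pt (m.t₀ z)}} {s | ∃ z, s = m.fc z} := by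
  choose σ hσ using m.pt_surj
  let α : A → Plane := fun a => (m.φ (σ a)).vert
  have hα : ∀ z, α (m.pt z) = (m.φ z).vert := fun z => m.vert_eq _ _ (hσ _)
  have hαV : ∀ a, α a ∈ M.verts := fun a => (m.φ (σ a)).vert_mem
  have himg : ∀ z, α '' m.fc z = (m.φ z).face ∩ M.verts := by
    intro z
    ext v
    constructor
    · rintro ⟨x, hx, rfl⟩
      obtain ⟨z', rfl, -, hf⟩ := m.exists_corner _ _ hx
      rw [hα, ← hf]
      exact ⟨(m.φ z').edge_face (m.φ z').vert_edge, (m.φ z').vert_mem⟩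
    · rintro ⟨hvf, hv⟩
      obtain ⟨e, e', -, he⟩ := hM.two_edges (m.φ z).face_mem hv hvf
      obtain ⟨h1, h2, h3⟩ := (he e).2 (Or.inl rfl)
      obtain ⟨z', hz', hφ⟩ := m.exists_lift_face z
        (y := ⟨v, e, (m.φ z).face, hv, h1, (m.φ z).face_mem, h2, h3⟩) rfl
      exact ⟨m.pt z', hz' ▸ m.pt_mem z', by rw [hα, hφ]⟩
  have hinj : ∀ z, Set.InjOn α (m.fc z) := fun z => by
    refine Set.injOn_of_ncard_image_eq ?_ (m.finite_fc z)
    refine le_antisymm (Set.ncard_image_le (m.finite_fc z)) ?_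
    rw [himg]
    exact m.card_fc z
  have hfeq : ∀ z z', α '' m.fc z = α '' m.fc z' → (m.φ z).face = (m.φ z').face := by
    intro z z' h
    rw [himg, himg] at h
    exact hM.face_eq_of_verts_subset (m.φ z).face_mem (m.φ z').face_mem
      (h ▸ Set.inter_subset_left)
  have hflag : ∀ x f, f ∈ M.faces → α x ∈ f → ∃ z, m.pt z = x ∧ (m.φ z).face = f := by
    intro x f hf hx
    obtain ⟨e, e', -, he⟩ := hM.two_edges hf (hαV x) hx
    obtain ⟨h1, h2, h3⟩ := (he e).2 (Or.inl rfl)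
    obtain ⟨z', hz', hφ⟩ := m.exists_lift (σ x) (y := ⟨α x, e, f, hαV x, h1, hf, h2, h3⟩) rfl
    exact ⟨z', hz'.trans (hσ x), by rw [hφ]⟩
  have hmain := hM.bijective_of_local_iso hαV (Φ := {s | ∃ z, s = m.fc z})
    (by
      rintro _ ⟨z, rfl⟩
      exact ⟨_, (m.φ z).face_mem, himg z⟩)
    (by
      intro x f hf hx
      obtain ⟨z, rfl, rfl⟩ := hflag x f hf hx
      exact ⟨_, ⟨z, rfl⟩, m.pt_mem z, himg z⟩)
    (by
      rintro _ ⟨z, rfl⟩ _ ⟨z', rfl⟩ x hx hx' h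
      obtain ⟨w, hw, hwf, hwφ⟩ := m.exists_corner _ _ hx
      obtain ⟨w', hw', hwf', hwφ'⟩ := m.exists_corner _ _ hx'
      rw [← hwf, ← hwf']
      exact m.fc_eq_of_face_eq (hw.trans hw'.symm) (by rw [hwφ, hwφ', hfeq _ _ h]))
    (by
      rintro _ ⟨z, rfl⟩
      exact hinj z)
    (by
      rintro _ ⟨z, rfl⟩ x hx y hy hxy f hf hne hxf hyf
      obtain ⟨w, rfl, hwf, hwφ⟩ := m.exists_corner _ _ hx
      rw [← hwf] at hy
      have hface : (m.φ w).face ≠ f := fun h => hne (by rw [himg, ← hwφ, h])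
      have hαne : α (m.pt w) ≠ α y := fun h => hxy (hinj w (m.pt_mem w) hy h)
      have hmem : ∀ a ∈ m.fc w, α a ∈ (m.φ w).face := fun a ha => by
        have : α a ∈ (m.φ w).face ∩ M.verts := himg w ▸ ⟨a, ha, rfl⟩
        exact this.1
      -- the two faces share the edge from `α (pt w)` to `α y`; lift the two flags on this edge
      obtain ⟨hE, hEv⟩ := hM.inter_mem_edges (m.φ w).face_mem hf hface hαne
        ⟨hmem _ (m.pt_mem w), hxf⟩ ⟨hmem _ hy, hyf⟩ (hαV _) (hαV _)
      obtain ⟨w₁, hw₁, hφ₁⟩ := m.exists_lift w (y := ⟨α (m.pt w), _, (m.φ w).face, hαV _, hE,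
        (m.φ w).face_mem, ⟨hmem _ (m.pt_mem w), hxf⟩, Set.inter_subset_left⟩) (hα w)
      have hfc₁ : m.fc w₁ = m.fc w := m.fc_eq_of_face_eq hw₁ (by rw [hφ₁])
      have hφ₂ : (m.φ (m.t₂ w₁)).face = f := by
        have h : (⟨α (m.pt w), _, f, hαV _, hE, hf, ⟨hmem _ (m.pt_mem w), hxf⟩,
          Set.inter_subset_right⟩ : M.Flag) = hM.flipFace (m.φ w₁) :=
          hM.eq_flipFace (by rw [hφ₁]) (by rw [hφ₁]) (by rw [hφ₁]; exact hface.symm)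
        rw [m.φ_t₂, ← h]
      have hend : m.pt (m.t₀ w₁) = y := by
        have h1 : m.pt (m.t₀ w₁) ∈ m.fc w := by
          rw [← hfc₁, ← m.fc_t₀]
          exact m.pt_mem _
        refine hinj w h1 hy ?_
        have h2 : α (m.pt (m.t₀ w₁)) ∈ (m.φ w₁).edge := by
          rw [hα, m.φ_t₀, ← hM.flipVert_edge]
          exact (hM.flipVert (m.φ w₁)).vert_edge
        rw [hφ₁] at h2
        refine ((hEv _).1 ⟨hαV _, h2⟩).resolve_left fun h => ?_
        rw [hα, m.φ_t₀] at h
        refine hM.flipVert_vert_ne (m.φ w₁) (h.trans ?_)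
        rw [hφ₁]
      refine ⟨_, ⟨m.t₂ w₁, rfl⟩, ?_, ?_, ?_⟩
      · rw [← hw₁, ← m.pt_t₂]
        exact m.pt_mem _
      · rw [← hend, ← m.pt_t₀_t₂, ← m.fc_t₀]
        exact m.pt_mem _
      · rw [himg, hφ₂])
    (by
      intro x y
      rw [← hσ x, ← hσ y]
      refine m.conn (fun z => Relation.ReflTransGen
        (fun x y => ∃ p ∈ {s | ∃ z, s = m.fc z}, x ∈ p ∧ y ∈ p) (m.pt (σ x)) (m.pt z)) ?_ ?_ ?_
        (σ x) (σ y) Relation.ReflTransGen.refl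
      · intro z hz
        exact hz.tail ⟨_, ⟨z, rfl⟩, m.pt_mem z, m.fc_t₀ z ▸ m.pt_mem _⟩
      · intro z hz
        rwa [m.pt_t₁]
      · intro z hz
        rwa [m.pt_t₂])
  obtain ⟨hαinj, hrange⟩ := hmain
  have hedge : ∀ z, α '' {m.pt z, m.pt (m.t₀ z)} = (m.φ z).edge ∩ M.verts := by
    intro z
    ext v
    rw [Set.image_pair, hα, hα, m.φ_t₀]
    constructor
    · rintro (rfl | rfl)
      · exact ⟨(m.φ z).vert_edge, (m.φ z).vert_mem⟩
      · refine ⟨?_, (hM.flipVert (m.φ z)).vert_mem⟩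
        rw [← hM.flipVert_edge]
        exact (hM.flipVert (m.φ z)).vert_edge
    · rintro ⟨hv, hvV⟩
      exact (hM.mem_edge_iff _ hvV).1 hv
  refine ⟨α, hαinj, hrange, fun t => ⟨?_, ?_⟩, fun t => ⟨?_, ?_⟩,
    fun e he e' he' => hM.edge_eq_of_verts_eq he he', fun f hf f' hf' h =>
      hM.face_eq_of_verts_subset hf hf' (h ▸ Set.inter_subset_left),
    fun e he f hf => (hM.edge_subset_iff he hf).2⟩
  · rintro ⟨e, he, rfl⟩
    obtain ⟨v, v', -, hv⟩ := hM.two_ends he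
    obtain ⟨hvV, hve⟩ := (hv v).2 (Or.inl rfl)
    obtain ⟨f, f', -, hf⟩ := hM.two_faces he
    obtain ⟨hfM, hef⟩ := (hf f).2 (Or.inl rfl)
    obtain ⟨a, rfl⟩ : v ∈ Set.range α := hrange ▸ hvV
    obtain ⟨z, -, hz⟩ := m.exists_lift (σ a) (y := ⟨_, e, f, hvV, he, hfM, hve, hef⟩) rfl
    exact ⟨_, ⟨z, rfl⟩, by rw [hedge, hz]⟩
  · rintro ⟨_, ⟨z, rfl⟩, rfl⟩
    exact ⟨_, (m.φ z).edge_mem, (hedge z).symm⟩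
  · rintro ⟨f, hf, rfl⟩
    obtain ⟨v, -, -, -, -, -, hv, -, -⟩ := hM.exists_three_verts hf
    obtain ⟨a, rfl⟩ : v ∈ Set.range α := hrange ▸ hv.2
    obtain ⟨z, -, rfl⟩ := hflag a f hf hv.1
    exact ⟨_, ⟨z, rfl⟩, himg z⟩
  · rintro ⟨_, ⟨z, rfl⟩, rfl⟩
    exact ⟨_, (m.φ z).face_mem, (himg z).symm⟩

end FlagModel

end PlaneCells

/-! ### Flags of the square lattice -/

/-- A flag of the square lattice: the vertex `(i, j)`, the adjacent square in the quadrant given by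
the signs `s` and `t` (`true` is positive), and one of the two edges of this square at the vertex,
the vertical one if `w` is true. -/
structure GridFlag where
  i : ℤ
  j : ℤ
  s : Bool
  t : Bool
  w : Bool

namespace GridFlag

/-- The sign of a direction. -/
def sgn (s : Bool) : ℤ := if s then 1 else -1

@[simp] theorem sgn_true : sgn true = 1 := rfl
@[simp] theorem sgn_false : sgn false = -1 := rfl
@[simp] theorem sgn_not (s : Bool) : sgn (!s) = - sgn s := by cases s <;> rfl

/-- Change the vertex. -/
def flipVert (g : GridFlag) : GridFlag :=
  if g.w then ⟨g.i, g.j + sgn g.t, g.s, !g.t, g.w⟩ else ⟨g.i + sgn g.s, g.j, !g.s, g.t, g.w⟩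

/-- Change the edge. -/
def flipEdge (g : GridFlag) : GridFlag := ⟨g.i, g.j, g.s, g.t, !g.w⟩

/-- Change the square. -/
def flipFace (g : GridFlag) : GridFlag :=
  if g.w then ⟨g.i, g.j, !g.s, g.t, g.w⟩ else ⟨g.i, g.j, g.s, !g.t, g.w⟩

end GridFlag

/-- The flags of the square lattice are connected by the three flips. -/
theorem GridFlag.induction {P : GridFlag → Prop} (h0 : ∀ g, P g → P g.flipVert)
    (h1 : ∀ g, P g → P g.flipEdge) (h2 : ∀ g, P g → P g.flipFace) {g₀ : GridFlag} (hg₀ : P g₀)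
    (g : GridFlag) : P g := by
  have hw : ∀ {i j s t w} w', P ⟨i, j, s, t, w⟩ → P ⟨i, j, s, t, w'⟩ := fun {i j s t w} w' h => by
    have := h1 _ h
    cases w <;> cases w' <;> first | exact h | exact this
  have ht : ∀ {i j s t w} t', P ⟨i, j, s, t, w⟩ → P ⟨i, j, s, t', w⟩ := fun {i j s t w} t' h => by
    have := hw w (h2 _ (hw false h))
    cases t <;> cases t' <;> first | exact h | exact this
  have hs : ∀ {i j s t w} s', P ⟨i, j, s, t, w⟩ → P ⟨i, j, s', t, w⟩ := fun {i j s t w} s' h => by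
    have := hw w (h2 _ (hw true h))
    cases s <;> cases s' <;> first | exact h | exact this
  have hall : ∀ {i j s t w} s' t' w', P ⟨i, j, s, t, w⟩ → P ⟨i, j, s', t', w'⟩ :=
    fun s' t' w' h => hs s' (ht t' (hw w' h))
  let Q : ℤ → ℤ → Prop := fun i j => ∀ s t w, P ⟨i, j, s, t, w⟩
  have hi : ∀ i j s, Q i j → Q (i + sgn s) j := fun i j s h s' t' w' =>
    hall s' t' w' (h0 _ (h s true false))
  have hj : ∀ i j s, Q i j → Q i (j + sgn s) := fun i j s h s' t' w' =>
    hall s' t' w' (h0 _ (h true s true))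
  have hQi : ∀ i, Q i g₀.j := fun i => by
    induction i using Int.inductionOn' (b := g₀.i) with
    | zero => exact fun s t w => hall s t w hg₀
    | succ k _ ih => exact hi _ _ true ih
    | pred k _ ih => exact hi _ _ false ih
  have hQ : ∀ i j, Q i j := fun i j => by
    induction j using Int.inductionOn' (b := g₀.j) with
    | zero => exact hQi i
    | succ k _ ih => exact hj _ _ true ih
    | pred k _ ih => exact hj _ _ false ih
  exact hQ _ _ _ _ _

/-- Three involutions with the relations of the symmetry group of the square lattice define an
equivariant image of the flags of the lattice. The unit translations, as words in the involutions,
commute; this is the combinatorial simple connectivity of the lattice. -/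
theorem exists_gridFlag_map {N : Type*} {a b c : Equiv.Perm N} (ha : a * a = 1) (hb : b * b = 1)
    (hc : c * c = 1) (hac : a * c = c * a) (hab : a * b * a * b = b * a * b * a)
    (hbc : b * c * b * c = c * b * c * b) (x₀ : N) :
    ∃ φ : GridFlag → N, φ ⟨0, 0, true, true, false⟩ = x₀ ∧ (∀ g, φ g.flipVert = a (φ g)) ∧
      (∀ g, φ g.flipEdge = b (φ g)) ∧ ∀ g, φ g.flipFace = c (φ g) := by
  have ha' : ∀ x, a (a x) = x := fun x => by rw [← Equiv.Perm.mul_apply, ha]; rfl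
  have hb' : ∀ x, b (b x) = x := fun x => by rw [← Equiv.Perm.mul_apply, hb]; rfl
  have hc' : ∀ x, c (c x) = x := fun x => by rw [← Equiv.Perm.mul_apply, hc]; rfl
  have hac' : ∀ x, a (c x) = c (a x) := fun x => by
    rw [← Equiv.Perm.mul_apply, hac]; rfl
  have hab' : ∀ x, a (b (a (b x))) = b (a (b (a x))) := fun x => by
    have := congrArg (fun p : Equiv.Perm N => p x) hab
    exact this
  have hbc' : ∀ x, b (c (b (c x))) = c (b (c (b x))) := fun x => by
    have := congrArg (fun p : Equiv.Perm N => p x) hbc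
    exact this
  let R : Equiv.Perm N := b * c * b * a
  let U : Equiv.Perm N := c * b * a * b
  have hRU : Commute U R := by
    ext x
    change c (b (a (b (b (c (b (a x))))))) = b (c (b (a (c (b (a (b x)))))))
    rw [hb', hac', hac', hab', ← hbc', hb']
  let X : ℤ → ℤ → N := fun i j => (R ^ i) ((U ^ j) x₀)
  have hR : ∀ i j, X (i + 1) j = b (c (b (a (X i j)))) := fun i j => by
    simp only [X]
    rw [add_comm, zpow_add, zpow_one]
    rfl
  have hU : ∀ i j, X i (j + 1) = c (b (a (b (X i j)))) := fun i j => by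
    simp only [X]
    rw [add_comm j 1, zpow_add, zpow_one, Equiv.Perm.mul_apply, ← Equiv.Perm.mul_apply (R ^ i) U,
      ← ((hRU.zpow_right i).eq)]
    rfl
  have hR' : ∀ i j, a (X (i - 1) j) = b (c (b (X i j))) := fun i j => by
    have := hR (i - 1) j
    rw [sub_add_cancel] at this
    rw [this, hb', hc', hb']
  let h : ℤ → ℤ → Bool → Bool → N := fun i j s t =>
    if s then (if t then X i j else c (X i j))
    else (if t then a (X (i - 1) j) else c (a (X (i - 1) j)))
  refine ⟨fun g => if g.w then b (h g.i g.j g.s g.t) else h g.i g.j g.s g.t, ?_, ?_, ?_, ?_⟩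
  · simp [h, X]
  · rintro ⟨i, j, s, t, w⟩
    have hU' : ∀ i j, X i (j - 1) = b (a (b (c (X i j)))) := fun i j => by
      have := hU i (j - 1)
      rw [sub_add_cancel] at this
      rw [this, hc', hb', ha', hb']
    cases w <;> cases s <;> cases t <;>
      simp [GridFlag.flipVert, h, hR', hU, hU', hc', hb', hac', ← sub_eq_add_neg, hbc']
    all_goals first | rw [← hR', ha'] | rw [hR, hb', hc', hb']
  · rintro ⟨i, j, s, t, w⟩
    cases w <;> simp [GridFlag.flipEdge, hb']
  · rintro ⟨i, j, s, t, w⟩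
    cases w <;> cases s <;> cases t <;>
      simp [GridFlag.flipFace, h, hR', hc', hb', hbc']

/-! ### Flags of the hexagons of the trihexagonal tiling -/

/-- A flag at a hexagon of the trihexagonal tiling, in the triangular lattice `ℤ ⊕ ℤ ω` with `ω` a
primitive sixth root of unity: the hexagon has centre `2 i + (2 j + 1) ω` and vertices at the six
neighbours of the centre; the edge joins the vertices in the directions `ω ^ k` and `ω ^ (k + 1)`,
and the vertex of the flag is the second one of these if `e` is true. -/
structure HexFlag where
  i : ℤ
  j : ℤ
  k : Fin 6
  e : Bool

namespace HexFlag

/-- The first coordinate of `ω ^ k`. -/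
def dx : Fin 6 → ℤ := ![1, 0, -1, -1, 0, 1]

/-- The second coordinate of `ω ^ k`. -/
def dy : Fin 6 → ℤ := ![0, 1, 1, 0, -1, -1]

/-- Change the vertex. -/
def flipVert (g : HexFlag) : HexFlag := ⟨g.i, g.j, g.k, !g.e⟩

/-- Change the edge. -/
def flipEdge (g : HexFlag) : HexFlag :=
  if g.e then ⟨g.i, g.j, g.k + 1, false⟩ else ⟨g.i, g.j, g.k + 5, true⟩

/-- Pass through the triangle at the edge of the flag to the other hexagon at its vertex. -/
def flipAcross (g : HexFlag) : HexFlag :=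
  if g.e then ⟨g.i + dx (g.k + 1), g.j + dy (g.k + 1), g.k + 4, false⟩
  else ⟨g.i + dx g.k, g.j + dy g.k, g.k + 2, true⟩

/-- The hexagon flags are connected by the three flips. -/
theorem induction {P : HexFlag → Prop} (h0 : ∀ g, P g → P g.flipVert)
    (h1 : ∀ g, P g → P g.flipEdge) (h2 : ∀ g, P g → P g.flipAcross) {g₀ : HexFlag} (hg₀ : P g₀)
    (g : HexFlag) : P g := by
  have he : ∀ {i j k e} e', P ⟨i, j, k, e⟩ → P ⟨i, j, k, e'⟩ := fun {i j k e} e' h => by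
    have := h0 _ h
    cases e <;> cases e' <;> first | exact h | exact this
  have hall : ∀ {i j k e} k' e', P ⟨i, j, k, e⟩ → P ⟨i, j, k', e'⟩ := fun {i j k e} k' e' h => by
    refine he e' (finRotate_induction (Q := fun k => P ⟨i, j, k, true⟩) (fun k hk => ?_)
      (he true h) k')
    rw [finRotate_apply]
    exact he true (h1 _ hk)
  let Q : ℤ → ℤ → Prop := fun i j => ∀ k e, P ⟨i, j, k, e⟩
  have hstep : ∀ i j k, Q i j → Q (i + dx k) (j + dy k) := fun i j k h k' e' =>
    hall k' e' (h2 _ (h k false))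
  have hQi : ∀ i, Q i g₀.j := fun i => by
    induction i using Int.inductionOn' (b := g₀.i) with
    | zero => exact fun k e => hall k e hg₀
    | succ i _ ih => simpa [dx, dy] using hstep _ _ 0 ih
    | pred i _ ih => simpa [dx, dy, sub_eq_add_neg] using hstep _ _ 3 ih
  have hQ : ∀ i j, Q i j := fun i j => by
    induction j using Int.inductionOn' (b := g₀.j) with
    | zero => exact hQi i
    | succ j _ ih => simpa [dx, dy] using hstep _ _ 1 ih
    | pred j _ ih => simpa [dx, dy, sub_eq_add_neg] using hstep _ _ 4 ih
  exact hQ _ _ _ _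

theorem flipAcross_flipAcross (g : HexFlag) : g.flipAcross.flipAcross = g := by
  obtain ⟨i, j, k, e⟩ := g
  cases e <;> fin_cases k <;> simp [flipAcross, dx, dy]

end HexFlag

/-- Three involutions with the relations of the symmetry group of the triangular lattice define an
equivariant image of the hexagon flags. The unit translations, as words in the involutions,
commute; this is the combinatorial simple connectivity of the lattice. -/
theorem exists_hexFlag_map {N : Type*} {a b c : Equiv.Perm N} (ha : a * a = 1) (hb : b * b = 1)
    (hc : c * c = 1) (hbc : b * c = c * b) (hac : a * c * a = c * a * c)
    (hab : a * b * a * b * a * b = b * a * b * a * b * a) (x₀ : N) :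
    ∃ φ : HexFlag → N, φ ⟨0, 0, 0, false⟩ = x₀ ∧ (∀ g, φ g.flipVert = a (φ g)) ∧
      (∀ g, φ g.flipEdge = b (φ g)) ∧ ∀ g, φ g.flipAcross = c (φ g) := by
  have ha' : ∀ x, a (a x) = x := fun x => by rw [← Equiv.Perm.mul_apply, ha]; rfl
  have hb' : ∀ x, b (b x) = x := fun x => by rw [← Equiv.Perm.mul_apply, hb]; rfl
  have hc' : ∀ x, c (c x) = x := fun x => by rw [← Equiv.Perm.mul_apply, hc]; rfl
  have hcb' : ∀ x, c (b x) = b (c x) := fun x => by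
    rw [← Equiv.Perm.mul_apply, ← hbc]; rfl
  have hcac' : ∀ x, c (a (c x)) = a (c (a x)) := fun x => by
    have := congrArg (fun p : Equiv.Perm N => p x) hac
    exact this.symm
  have hab' : ∀ x, a (b (a (b (a (b x))))) = b (a (b (a (b (a x))))) := fun x => by
    have := congrArg (fun p : Equiv.Perm N => p x) hab
    exact this
  -- `h` is the half turn of a hexagon
  obtain ⟨h, hh⟩ : ∃ h : Equiv.Perm N, ∀ x, h x = a (b (a (b (a (b x))))) :=
    ⟨a * b * a * b * a * b, fun _ => rfl⟩
  have hha : ∀ x, a (h x) = h (a x) := fun x => by rw [hh, hh, hab', hab', ha']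
  have hhb : ∀ x, b (h x) = h (b x) := fun x => by rw [hh, hh, hab', hb', hb']
  have hhh : ∀ x, h (h x) = x := fun x => by rw [hh, hh, hab']; simp only [ha', hb']
  have habab : ∀ x, a (b (a (b x))) = h (b (a x)) := fun x => by rw [hh, hb', ha']
  have hbaba : ∀ x, b (a (b (a x))) = h (a (b x)) := fun x => by rw [hh, hab', ha', hb']
  let T : Equiv.Perm N := h * b * c
  let U : Equiv.Perm N := h * a * b * c * a
  have hTx : ∀ x, T x = h (b (c x)) := fun _ => rfl
  have hUx : ∀ x, U x = h (a (b (c (a x)))) := fun _ => rfl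
  have hUT : Commute U T := by
    ext x
    change U (T x) = T (U x)
    rw [hTx, hUx, hTx, hUx]
    rw [hha, ← hbaba (c (a x)), ← hbaba (c x), hcb', hcb', hb', hb', ← hcac' x, ← hcb', hcac' (b _)]
  let X : ℤ → ℤ → N := fun i j => (T ^ i) ((U ^ j) x₀)
  have hT : ∀ i j, X (i + 1) j = h (b (c (X i j))) := fun i j => by
    simp only [X]
    rw [add_comm, zpow_add, zpow_one]
    rfl
  have hU : ∀ i j, X i (j + 1) = h (a (b (c (a (X i j))))) := fun i j => by
    simp only [X]
    rw [add_comm j 1, zpow_add, zpow_one, Equiv.Perm.mul_apply, ← Equiv.Perm.mul_apply (T ^ i) U,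
      ← ((hUT.zpow_right i).eq)]
    rfl
  let r : Equiv.Perm N := b * a
  have hr6 : r ^ 6 = 1 := by
    ext x
    change b (a (b (a (b (a (b (a (b (a (b (a x))))))))))) = x
    simp only [hbaba, hha, hhb, hhh, ha', hb']
  have hr1 : ∀ k : Fin 6, r ^ ((k + 1 : Fin 6) : ℕ) = r * r ^ (k : ℕ) := fun k => by
    rw [← pow_succ']
    fin_cases k <;> simp [hr6]
  let φ : HexFlag → N := fun g => if g.e then a ((r ^ (g.k : ℕ)) (X g.i g.j))
    else (r ^ (g.k : ℕ)) (X g.i g.j)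
  have hacross : ∀ i j k, φ (HexFlag.flipAcross ⟨i, j, k, false⟩) = c (φ ⟨i, j, k, false⟩) := by
    intro i j k
    have h0 : ∀ x, (r ^ 0) x = x := fun x => rfl
    have h1 : ∀ x, (r ^ 1) x = b (a x) := fun x => rfl
    have h2 : ∀ x, (r ^ 2) x = b (a (b (a x))) := fun x => rfl
    have h3 : ∀ x, (r ^ 3) x = b (a (b (a (b (a x))))) := fun x => rfl
    have h4 : ∀ x, (r ^ 4) x = b (a (b (a (b (a (b (a x))))))) := fun x => rfl
    have h5 : ∀ x, (r ^ 5) x = b (a (b (a (b (a (b (a (b (a x))))))))) := fun x => rfl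
    have e2 : X i j = h (b (c (X (i - 1) j))) := by rw [← hT, sub_add_cancel]
    have e3 : X i j = h (a (b (c (a (X i (j - 1)))))) := by rw [← hU, sub_add_cancel]
    fin_cases k
    · change a ((r ^ 2) (X (i + 1) (j + 0))) = c ((r ^ 0) (X i j))
      rw [add_zero, hT, h2, h0]
      simp only [hha, hhb, hhh, ha', hb', habab]
    · change a ((r ^ 3) (X (i + 0) (j + 1))) = c ((r ^ 1) (X i j))
      rw [add_zero, hU, h3, h1]
      simp only [hbaba, hha, hhb, hhh, ha', hb', hcb']
    · change a ((r ^ 4) (X (i - 1) (j + 1))) = c ((r ^ 2) (X i j))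
      rw [e2, hU, h4, h2]
      simp only [hbaba, hha, hhb, hhh, ha', hb', habab, hcac']
    · change a ((r ^ 5) (X (i - 1) (j + 0))) = c ((r ^ 3) (X i j))
      rw [add_zero, e2, h5, h3]
      simp only [hbaba, hha, hhb, hhh, ha', hb', hc', habab, hcb']
    · change a ((r ^ 0) (X (i + 0) (j - 1))) = c ((r ^ 4) (X i j))
      rw [add_zero, e3, h0, h4]
      simp only [hbaba, hha, hhb, hhh, ha', hb', hc']
    · change a ((r ^ 1) (X (i + 1) (j - 1))) = c ((r ^ 5) (X i j))
      rw [e3, hT, h1, h5]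
      simp only [hbaba, hha, hhb, hhh, ha', hb', habab, hcb', hcac']
  refine ⟨φ, ?_, ?_, ?_, ?_⟩
  · simp [φ, X]
  · rintro ⟨i, j, k, e⟩
    cases e <;> simp [φ, HexFlag.flipVert, ha']
  · rintro ⟨i, j, k, e⟩
    cases e
    · have h5 := hr1 (k + 5)
      rw [add_assoc, show (5 + 1 : Fin 6) = 0 from rfl, add_zero] at h5
      simp [φ, HexFlag.flipEdge, h5, r, hb']
    · simp [φ, HexFlag.flipEdge, hr1, r]
  · rintro ⟨i, j, k, e⟩
    cases e
    · exact hacross i j k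
    · have := hacross (i + HexFlag.dx (k + 1)) (j + HexFlag.dy (k + 1)) (k + 4)
      have h2 : (⟨i + HexFlag.dx (k + 1), j + HexFlag.dy (k + 1), k + 4, false⟩ : HexFlag) =
        HexFlag.flipAcross ⟨i, j, k, true⟩ := rfl
      rw [h2, HexFlag.flipAcross_flipAcross] at this
      rw [this, hc']

/-! ### Maps with straight edges and convex faces -/

section Convex

/-- A point of the convex hull of a set contained in the disc with centre `o` and radius `r` has
distance less than `r'` from some point of the set, provided `r² - |p - o|² < r'²`: on the hull, the
affine function `|c - p|² - |c - o|²` of `c` is bounded below by its infimum on the set. -/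
theorem exists_dist_sq_lt_of_mem_convexHull {E : Type*} [NormedAddCommGroup E]
    [InnerProductSpace ℝ E] {s : Set E} {p o : E} {r d : ℝ} (hp : p ∈ convexHull ℝ s)
    (hr : ∀ c ∈ s, ‖c - o‖ ^ 2 ≤ r) (hd : r - ‖p - o‖ ^ 2 < d) : ∃ c ∈ s, ‖c - p‖ ^ 2 < d := by
  by_contra! hcon
  have hform : ∀ c, ‖c - p‖ ^ 2 - ‖c - o‖ ^ 2 = inner ℝ (2 • (o - p)) c + (‖p‖ ^ 2 - ‖o‖ ^ 2) := by
    intro c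
    rw [norm_sub_sq_real, norm_sub_sq_real, two_smul, inner_add_left, inner_sub_left,
      real_inner_comm c o, real_inner_comm c p]
    ring
  have hconv : Convex ℝ {c : E | d - r - (‖p‖ ^ 2 - ‖o‖ ^ 2) ≤ inner ℝ (2 • (o - p)) c} :=
    convex_halfSpace_ge (innerSL ℝ (2 • (o - p))).isBoundedLinearMap.toIsLinearMap _
  have hsub : s ⊆ {c : E | d - r - (‖p‖ ^ 2 - ‖o‖ ^ 2) ≤ inner ℝ (2 • (o - p)) c} := by
    intro c hc
    have h1 := hform c
    have h2 := hr c hc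
    have h3 := hcon c hc
    simp only [Set.mem_ofPred_eq]
    linarith
  have h := convexHull_min hsub hconv hp
  simp only [Set.mem_ofPred_eq] at h
  have h1 := hform p
  rw [sub_self, norm_zero] at h1
  linarith

end Convex

namespace PlaneCells

variable {M : PlaneCells}

/-- A map whose cells are convex hulls of vertices that contain no further vertices is described by
its vertices. -/
theorem realizes_of_convexHull {A : Type*} {α : A → Plane} {E F : Set (Set A)}
    (hα : Function.Injective α) (hV : Set.range α = M.verts)
    (hE : M.edges = (fun s => convexHull ℝ (α '' s)) '' E)
    (hF : M.faces = (fun s => convexHull ℝ (α '' s)) '' F)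
    (hsE : ∀ s ∈ E, ∀ a, α a ∈ convexHull ℝ (α '' s) → a ∈ s)
    (hsF : ∀ s ∈ F, ∀ a, α a ∈ convexHull ℝ (α '' s) → a ∈ s) : M.Realizes α E F := by
  have key : ∀ s : Set A, (∀ a, α a ∈ convexHull ℝ (α '' s) → a ∈ s) →
      convexHull ℝ (α '' s) ∩ M.verts = α '' s := by
    intro s hs
    rw [← hV]
    ext x
    constructor
    · rintro ⟨hx, a, rfl⟩
      exact ⟨a, hs a hx, rfl⟩
    · rintro ⟨a, ha, rfl⟩
      exact ⟨subset_convexHull ℝ _ ⟨a, ha, rfl⟩, a, rfl⟩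
  have hullE : ∀ e ∈ M.edges, e = convexHull ℝ (e ∩ M.verts) := by
    rw [hE]
    rintro _ ⟨s, hs, rfl⟩
    dsimp only
    rw [key s (hsE s hs)]
  have hullF : ∀ f ∈ M.faces, f = convexHull ℝ (f ∩ M.verts) := by
    rw [hF]
    rintro _ ⟨s, hs, rfl⟩
    dsimp only
    rw [key s (hsF s hs)]
  refine ⟨hα, hV, fun t => ?_, fun t => ?_, fun e he e' he' h => ?_, fun f hf f' hf' h => ?_,
    fun e he f hf h => ?_⟩
  · rw [hE]
    constructor
    · rintro ⟨_, ⟨s, hs, rfl⟩, rfl⟩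
      exact ⟨s, hs, (key s (hsE s hs)).symm⟩
    · rintro ⟨s, hs, rfl⟩
      exact ⟨_, ⟨s, hs, rfl⟩, key s (hsE s hs)⟩
  · rw [hF]
    constructor
    · rintro ⟨_, ⟨s, hs, rfl⟩, rfl⟩
      exact ⟨s, hs, (key s (hsF s hs)).symm⟩
    · rintro ⟨s, hs, rfl⟩
      exact ⟨_, ⟨s, hs, rfl⟩, key s (hsF s hs)⟩
  · rw [hullE e he, hullE e' he', h]
  · rw [hullF f hf, hullF f' hf', h]
  · rw [hullE e he]
    refine convexHull_min h ?_
    rw [hullF f hf]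
    exact convex_convexHull ℝ _

/-- Criterion for a convex hull of vertices to contain no further vertices: the vertices are at
mutual distance at least `1`, and those in question lie in a disc of radius at most `1` whose centre,
if the radius is `1`, is not a further vertex. -/
theorem mem_of_mem_convexHull {A : Type*} {α : A → Plane}
    (hsep : ∀ a b, ‖α a - α b‖ ^ 2 < 1 → a = b) {s : Set A} {o : Plane}
    (hs : ∀ a ∈ s, ‖α a - o‖ ^ 2 ≤ 1) (ho : ∀ a, a ∉ s → α a ≠ o) {a : A}
    (ha : α a ∈ convexHull ℝ (α '' s)) : a ∈ s := by
  by_contra has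
  have hpos : 0 < ‖α a - o‖ ^ 2 := by
    have := sub_ne_zero.2 (ho a has)
    positivity
  obtain ⟨_, ⟨b, hb, rfl⟩, hlt⟩ := exists_dist_sq_lt_of_mem_convexHull (r := 1) (d := 1) ha
    (by rintro _ ⟨b, hb, rfl⟩; exact hs b hb) (by linarith)
  exact has (hsep b a hlt ▸ hb)

end PlaneCells

/-! ### The trihexagonal tiling as a combinatorial map -/

namespace HexFlag

/-- The vertices of the trihexagonal tiling in the triangular lattice `ℤ ⊕ ℤ ω`: all lattice points
except the centres of the hexagons. -/
abbrev Vertex : Type := {p : ℤ × ℤ // ¬ (Even p.1 ∧ Odd p.2)}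

theorem not_centre (i j : ℤ) (k : Fin 6) : ¬ (Even (2 * i + dx k) ∧ Odd (2 * j + 1 + dy k)) := by
  fin_cases k <;> simp [dx, dy, parity_simps]

/-- The corner of a hexagon in the direction `ω ^ k`. -/
def corner (i j : ℤ) (k : Fin 6) : Vertex :=
  ⟨(2 * i + dx k, 2 * j + 1 + dy k), not_centre i j k⟩

/-- The vertex of a flag. -/
def pt (g : HexFlag) : Vertex := corner g.i g.j (if g.e then g.k + 1 else g.k)

/-- The vertices of the hexagon of a flag. -/
def hexagon (g : HexFlag) : Set Vertex := Set.range (corner g.i g.j)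

/-- The vertices of the triangle at the edge of a flag; the third one is the second common
neighbour of the two vertices of the edge. -/
def triangle (g : HexFlag) : Set Vertex :=
  {corner g.i g.j g.k, corner g.i g.j (g.k + 1), corner (g.i + dx g.k) (g.j + dy g.k) (g.k + 2)}

theorem corner_eq_iff {i j i' j' : ℤ} {k k' : Fin 6} : corner i j k = corner i' j' k' ↔
    (i = i' ∧ j = j' ∧ k = k') ∨ (i' = i + dx k ∧ j' = j + dy k ∧ k' = k + 3) := by
  simp only [corner, Subtype.mk.injEq, Prod.mk.injEq]
  fin_cases k <;> fin_cases k' <;> simp [dx, dy] <;> omega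

theorem corner_across (i j : ℤ) (k : Fin 6) :
    corner (i + dx k) (j + dy k) (k + 3) = corner i j k :=
  (corner_eq_iff.2 (Or.inr ⟨rfl, rfl, rfl⟩)).symm

theorem pt_flipEdge (g : HexFlag) : g.flipEdge.pt = g.pt := by
  obtain ⟨i, j, k, e⟩ := g
  cases e
  · simp [flipEdge, pt, add_assoc]
  · simp [flipEdge, pt]

theorem pt_flipAcross (g : HexFlag) : g.flipAcross.pt = g.pt := by
  obtain ⟨i, j, k, e⟩ := g
  cases e
  · simpa [flipAcross, pt, add_assoc] using corner_across i j k
  · simpa [flipAcross, pt, add_assoc] using corner_across i j (k + 1)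

theorem triangle_flipAcross (g : HexFlag) : g.flipAcross.triangle = g.triangle := by
  obtain ⟨i, j, k, e⟩ := g
  ext ⟨⟨x, y⟩, h⟩
  cases e <;> fin_cases k <;>
    simp [triangle, flipAcross, corner, dx, dy] <;> omega

theorem exists_pt_eq (p : Vertex) : ∃ i j k, corner i j k = p := by
  obtain ⟨⟨x, y⟩, hp⟩ := p
  simp only [corner, Subtype.mk.injEq, Prod.mk.injEq]
  rcases Int.even_or_odd' x with ⟨i, rfl | rfl⟩ <;> rcases Int.even_or_odd' y with ⟨j, rfl | rfl⟩
  · exact ⟨i, j, 4, by simp [dx], by simp [dy]⟩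
  · exact absurd ⟨by simp, by simp⟩ hp
  · exact ⟨i, j, 5, by simp [dx], by simp [dy]⟩
  · exact ⟨i, j, 0, by simp [dx], by simp [dy]⟩

theorem pt_eq_iff {g g' : HexFlag} : g.pt = g'.pt ↔
    g' = g ∨ g' = g.flipEdge ∨ g' = g.flipAcross ∨ g' = g.flipAcross.flipEdge := by
  constructor
  · obtain ⟨i, j, k, e⟩ := g
    obtain ⟨i', j', k', e'⟩ := g'
    intro h
    have h5 : ∀ k k' : Fin 6, k = k' + 1 → k' = k + 5 := by decide
    have h2 : ∀ k k' : Fin 6, k' + 1 = k + 3 → k' = k + 2 := by decide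
    have h4 : ∀ k k' : Fin 6, k' + 1 = k + 1 + 3 → k' = k + 3 := by decide
    have hk : ∀ k : Fin 6, k + 1 + 3 = k + 4 := by decide
    have hk' : ∀ k : Fin 6, k + 4 + 5 = k + 3 := by decide
    have hk'' : ∀ k : Fin 6, k + 2 + 1 = k + 3 := by decide
    cases e <;> cases e' <;> simp only [pt, if_true, if_false, Bool.false_eq_true] at h <;>
      rcases corner_eq_iff.1 h with ⟨rfl, rfl, hd⟩ | ⟨rfl, rfl, hd⟩
    · simp [hd]
    · simp [flipEdge, flipAcross, hk'', hd]
    · simp [flipEdge, h5 _ _ hd]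
    · simp [flipEdge, flipAcross, h2 _ _ hd]
    · simp [flipEdge, hd]
    · simp [flipEdge, flipAcross, hd, hk]
    · simp [add_right_cancel hd]
    · simp [flipEdge, flipAcross, h4 _ _ hd, hk']
  · rintro (rfl | rfl | rfl | rfl) <;> simp [pt_flipEdge, pt_flipAcross]

end HexFlag

/-! ### Maps of type `[3, 6, 3, 6]` -/

theorem ncard_triple_le {A : Type*} (x y z : A) : ({x, y, z} : Set A).ncard ≤ 3 :=
  (Set.ncard_insert_le _ _).trans (Nat.succ_le_succ
    ((Set.ncard_insert_le _ _).trans (by rw [Set.ncard_singleton])))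

namespace PlaneCells

variable {M : PlaneCells}

section TypeTrihexagonal

variable (hM : M.IsCyclicMap) (hT : ∀ v ∈ M.verts, M.HasFaceCycle v [3, 6, 3, 6])

include hM hT

/-- The cyclic order of the flags at a vertex: triangles and hexagons alternate, and the rotation by
two faces has order two. -/
theorem trihexagonal_vertFlags (x : M.Flag) :
    ((M.size x.face = 3 ∧ M.size (hM.flipFace x).face = 6) ∨
      (M.size x.face = 6 ∧ M.size (hM.flipFace x).face = 3)) ∧
    hM.flipEdge (hM.flipFace (hM.flipEdge (hM.flipFace x))) =
      hM.flipFace (hM.flipEdge (hM.flipFace (hM.flipEdge x))) := by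
  obtain ⟨b, -, -, hsz, hb, hy⟩ := hM.exists_vertFlags x.vert_mem (by simp) (hT _ x.vert_mem)
  have s0 : M.size (b 0).face = 3 := hsz 0
  have s1 : M.size (b 1).face = 6 := hsz 1
  have s2 : M.size (b 2).face = 3 := hsz 2
  have s3 : M.size (b 3).face = 6 := hsz 3
  have b0 : hM.flipFace (hM.flipEdge (b 0)) = b 1 := hb 0
  have b1 : hM.flipFace (hM.flipEdge (b 1)) = b 2 := hb 1
  have b2 : hM.flipFace (hM.flipEdge (b 2)) = b 3 := hb 2
  have b3 : hM.flipFace (hM.flipEdge (b 3)) = b 0 := hb 3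
  have c0 : hM.flipFace (b 1) = hM.flipEdge (b 0) := by rw [← b0, hM.flipFace_flipFace]
  have c1 : hM.flipFace (b 2) = hM.flipEdge (b 1) := by rw [← b1, hM.flipFace_flipFace]
  have c2 : hM.flipFace (b 3) = hM.flipEdge (b 2) := by rw [← b2, hM.flipFace_flipFace]
  have c3 : hM.flipFace (b 0) = hM.flipEdge (b 3) := by rw [← b3, hM.flipFace_flipFace]
  have hall : ∀ i : Fin 4, i = 0 ∨ i = 1 ∨ i = 2 ∨ i = 3 := by decide
  obtain ⟨i, rfl | rfl⟩ := hy x rfl <;> rcases hall i with rfl | rfl | rfl | rfl <;>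
    simp [s0, s1, s2, s3, b0, b1, b2, b3, c0, c1, c2, c3]

/-- The flag model of a map with a hexagon flag `x₀`: the hexagon flags form an orbit of the
symmetry group of the triangular lattice, generated by the flips of the vertex and of the edge and
by the passage through a triangle, and each triangle flag is across the edge from a hexagon
flag. -/
theorem exists_realizes_trihexagonal (x₀ : M.Flag) (hx₀ : M.size x₀.face = 6) :
    ∃ α : HexFlag.Vertex → Plane,
      M.Realizes α {s | ∃ g : HexFlag, s = {g.pt, g.flipVert.pt}}
        {s | ∃ g : HexFlag, s = g.hexagon ∨ s = g.triangle} := by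
  have hsz := fun x => (trihexagonal_vertFlags hM hT x).1
  have hper := fun x => (trihexagonal_vertFlags hM hT x).2
  have h63 : ∀ x : M.Flag, M.size x.face = 6 → M.size (hM.flipFace x).face = 3 := fun x h => by
    have := hsz x
    omega
  have h36 : ∀ x : M.Flag, M.size x.face = 3 → M.size (hM.flipFace x).face = 6 := fun x h => by
    have := hsz x
    omega
  let N := {x : M.Flag // M.size x.face = 6}
  let a : Equiv.Perm N := Function.Involutive.toPerm
    (fun x => ⟨hM.flipVert x.1, by simpa using x.2⟩) fun x => Subtype.ext (by simp)
  let b : Equiv.Perm N := Function.Involutive.toPerm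
    (fun x => ⟨hM.flipEdge x.1, by simpa using x.2⟩) fun x => Subtype.ext (by simp)
  let c : Equiv.Perm N := Function.Involutive.toPerm
    (fun x => ⟨hM.flipFace (hM.flipEdge (hM.flipFace x.1)), h36 _ (by simpa using h63 _ x.2)⟩)
    fun x => Subtype.ext (by simp)
  obtain ⟨φ, -, h0, h1, h2⟩ := exists_hexFlag_map (a := a) (b := b) (c := c)
    (by ext x : 1; exact Subtype.ext (hM.flipVert_flipVert _))
    (by ext x : 1; exact Subtype.ext (hM.flipEdge_flipEdge _))
    (by 
      ext x : 1
      refine Subtype.ext ?_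
      change hM.flipFace (hM.flipEdge (hM.flipFace (hM.flipFace (hM.flipEdge (hM.flipFace
        x.1))))) = x.1
      simp)
    (by ext x : 1; exact Subtype.ext (hper x.1))
    (by
      ext x : 1
      refine Subtype.ext ?_
      change hM.flipVert (hM.flipFace (hM.flipEdge (hM.flipFace (hM.flipVert x.1)))) =
        hM.flipFace (hM.flipEdge (hM.flipFace (hM.flipVert (hM.flipFace (hM.flipEdge
          (hM.flipFace x.1))))))
      -- in a triangle `x` and its translates by `flipEdge ∘ flipVert` close up after three steps
      have h := hM.iterate_face (hM.flipFace x.1)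
      rw [h63 _ x.2] at h
      change hM.flipEdge (hM.flipVert (hM.flipEdge (hM.flipVert (hM.flipEdge (hM.flipVert
        (hM.flipFace x.1)))))) = hM.flipFace x.1 at h
      rw [hM.flipVert_flipFace (hM.flipEdge (hM.flipFace (hM.flipVert x.1))),
        ← hM.flipVert_flipFace x.1, hM.flipVert_flipFace (hM.flipEdge (hM.flipFace x.1)),
        hM.flipFace_flipFace]
      congr 1
      conv_rhs => rw [← h]
      simp)
    (by
      ext x : 1
      refine Subtype.ext ?_
      have h := hM.iterate_face x.1
      rw [x.2] at h
      change hM.flipEdge (hM.flipVert (hM.flipEdge (hM.flipVert (hM.flipEdge (hM.flipVert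
        (hM.flipEdge (hM.flipVert (hM.flipEdge (hM.flipVert (hM.flipEdge (hM.flipVert
        x.1))))))))))) = x.1 at h
      change hM.flipVert (hM.flipEdge (hM.flipVert (hM.flipEdge (hM.flipVert (hM.flipEdge
        x.1))))) = hM.flipEdge (hM.flipVert (hM.flipEdge (hM.flipVert (hM.flipEdge (hM.flipVert
        x.1)))))
      conv_lhs => rw [← h]
      simp) ⟨x₀, hx₀⟩
  have e0 : ∀ g, (φ g.flipVert).1 = hM.flipVert (φ g).1 := fun g => by rw [h0]; rfl
  have e1 : ∀ g, (φ g.flipEdge).1 = hM.flipEdge (φ g).1 := fun g => by rw [h1]; rfl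
  have e2 : ∀ g, (φ g.flipAcross).1 = hM.flipFace (hM.flipEdge (hM.flipFace (φ g).1)) :=
    fun g => by rw [h2]; rfl
  -- the twelve flags of a hexagon of the model go to the flags of one face
  have hface : ∀ i j k e, (φ ⟨i, j, k, e⟩).1.face = (φ ⟨i, j, 0, true⟩).1.face := by
    intro i j k e
    have he : ∀ k, (φ ⟨i, j, k, e⟩).1.face = (φ ⟨i, j, k, true⟩).1.face := fun k => by
      cases e
      · have := e0 ⟨i, j, k, false⟩
        rw [← hM.flipVert_face, ← this]
        rfl
      · rfl
    rw [he]
    refine finRotate_induction (Q := fun k => (φ ⟨i, j, k, true⟩).1.face = _) (fun k hk => ?_)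
      rfl k
    rw [finRotate_apply, ← hk]
    have h1 := e1 ⟨i, j, k, true⟩
    have h2 := e0 ⟨i, j, k + 1, false⟩
    refine (congrArg Flag.face h2).trans ((hM.flipVert_face _).trans ?_)
    exact (congrArg Flag.face h1).trans (hM.flipEdge_face _)
  have hvert : ∀ g g' : HexFlag, g.pt = g'.pt → (φ g).1.vert = (φ g').1.vert := by
    intro g g' h
    rcases HexFlag.pt_eq_iff.1 h with rfl | rfl | rfl | rfl <;> simp [e1, e2]
  have hfibre : ∀ g : HexFlag, {z : HexFlag × Bool | z.1.pt = g.pt} ⊆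
      ({g, g.flipEdge, g.flipAcross, g.flipAcross.flipEdge} : Set HexFlag) ×ˢ Set.univ :=
    fun g z hz => ⟨HexFlag.pt_eq_iff.1 (Eq.symm hz), trivial⟩
  have hfin : ∀ g : HexFlag, (({g, g.flipEdge, g.flipAcross, g.flipAcross.flipEdge} : Set HexFlag) ×ˢ
      (Set.univ : Set Bool)).Finite := fun g => Set.toFinite _
  -- `(g, false)` is the flag of a hexagon, `(g, true)` that of the triangle across its edge
  let m : FlagModel hM (HexFlag × Bool) HexFlag.Vertex :=
    { t₀ := fun z => (z.1.flipVert, z.2)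
      t₁ := fun z => (if z.2 then z.1.flipAcross else z.1.flipEdge, z.2)
      t₂ := fun z => (z.1, !z.2)
      φ := fun z => if z.2 then hM.flipFace (φ z.1).1 else (φ z.1).1
      pt := fun z => z.1.pt
      fc := fun z => if z.2 then z.1.triangle else z.1.hexagon
      φ_t₀ := by rintro ⟨g, _ | _⟩ <;> simp [e0, hM.flipVert_flipFace]
      φ_t₁ := by rintro ⟨g, _ | _⟩ <;> simp [e1, e2]
      φ_t₂ := by rintro ⟨g, _ | _⟩ <;> simp
      pt_t₁ := by rintro ⟨g, _ | _⟩ <;> simp [HexFlag.pt_flipEdge, HexFlag.pt_flipAcross]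
      pt_t₂ := fun _ => rfl
      pt_t₀_t₂ := fun _ => rfl
      fc_t₀ := fun _ => rfl
      fc_t₁ := by
        rintro ⟨⟨i, j, k, _ | _⟩, _ | _⟩
        · rfl
        · exact HexFlag.triangle_flipAcross ⟨i, j, k, false⟩
        · rfl
        · exact HexFlag.triangle_flipAcross ⟨i, j, k, true⟩
      pt_surj := fun p => by
        obtain ⟨i, j, k, rfl⟩ := HexFlag.exists_pt_eq p
        exact ⟨(⟨i, j, k, false⟩, false), rfl⟩
      pt_mem := by
        rintro ⟨⟨i, j, k, _ | _⟩, _ | _⟩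
        · exact ⟨k, rfl⟩
        · exact Or.inl rfl
        · exact ⟨k + 1, rfl⟩
        · exact Or.inr (Or.inl rfl)
      exists_corner := by
        rintro ⟨⟨i, j, k, e⟩, _ | _⟩ x hx
        · obtain ⟨l, rfl⟩ := hx
          exact ⟨(⟨i, j, l, false⟩, false), rfl, rfl, (hface _ _ _ _).trans (hface _ _ _ _).symm⟩
        · have hf0 : ∀ g : HexFlag, (hM.flipFace (φ g.flipVert).1).face =
            (hM.flipFace (φ g).1).face := fun g => by
            rw [e0, ← hM.flipVert_flipFace, hM.flipVert_face]
          have hfe : (hM.flipFace (φ ⟨i, j, k, false⟩).1).face =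
            (hM.flipFace (φ ⟨i, j, k, e⟩).1).face := by
            cases e
            · rfl
            · exact hf0 ⟨i, j, k, true⟩
          rcases hx with rfl | rfl | rfl
          · exact ⟨(⟨i, j, k, false⟩, true), rfl, rfl, hfe⟩
          · exact ⟨(⟨i, j, k, true⟩, true), rfl, rfl, (hf0 ⟨i, j, k, false⟩).trans hfe⟩
          · refine ⟨(HexFlag.flipVert (HexFlag.flipAcross ⟨i, j, k, false⟩), true), rfl,
              HexFlag.triangle_flipAcross ⟨i, j, k, false⟩, ?_⟩
            refine (hf0 _).trans (Eq.trans ?_ hfe)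
            rw [e2, hM.flipFace_flipFace, hM.flipEdge_face]
      vert_eq := by
        rintro ⟨g, _ | _⟩ ⟨g', _ | _⟩ h <;> simpa using hvert g g' h
      finite_fibre := fun p => by
        obtain ⟨i, j, k, rfl⟩ := HexFlag.exists_pt_eq p
        exact (hfin _).subset (hfibre ⟨i, j, k, false⟩)
      card_fibre := by
        rintro ⟨g, w⟩
        have hv : (if w then hM.flipFace (φ g).1 else (φ g).1).vert = (φ g).1.vert := by
          cases w <;> simp
        have h8 := hM.ncard_vertFlags (φ g).1.vert_mem (by simp) (hT _ (φ g).1.vert_mem)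
        have h4 : ({g, g.flipEdge, g.flipAcross, g.flipAcross.flipEdge} : Set HexFlag).ncard ≤ 4 :=
          (Set.ncard_insert_le _ _).trans (Nat.succ_le_succ (ncard_triple_le _ _ _))
        refine (Set.ncard_le_ncard (hfibre g) (hfin g)).trans ?_
        rw [Set.ncard_prod, Set.ncard_univ, Nat.card_eq_fintype_card, Fintype.card_bool]
        simp only [hv]
        refine le_trans ?_ h8
        simpa using Nat.mul_le_mul_right 2 h4
      finite_fc := by
        rintro ⟨g, _ | _⟩
        · exact Set.finite_range _
        · exact Set.toFinite {_, _, _}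
      card_fc := by
        rintro ⟨g, _ | _⟩
        · change g.hexagon.ncard ≤ M.size (φ g).1.face
          rw [(φ g).2, HexFlag.hexagon, ← Set.image_univ]
          refine (Set.ncard_image_le Set.finite_univ).trans ?_
          rw [Set.ncard_univ, Nat.card_eq_fintype_card, Fintype.card_fin]
        · change g.triangle.ncard ≤ M.size (hM.flipFace (φ g).1).face
          rw [h63 _ (φ g).2]
          exact ncard_triple_le _ _ _
      conn := by
        intro P k0 k1 k2 z z' hz
        have key : ∀ g, (P (g, false) ∧ P (g, true)) := by
          refine HexFlag.induction (g₀ := z.1) ?_ ?_ ?_ ?_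
          · rintro g ⟨hg, hg'⟩
            exact ⟨k0 _ hg, k0 _ hg'⟩
          · rintro g ⟨hg, hg'⟩
            exact ⟨k1 _ hg, k2 _ (k1 _ hg)⟩
          · rintro g ⟨hg, hg'⟩
            exact ⟨k2 _ (k1 _ hg'), k1 _ hg'⟩
          · obtain ⟨g, _ | _⟩ := z
            · exact ⟨hz, k2 _ hz⟩
            · exact ⟨k2 _ hz, hz⟩
        obtain ⟨g, _ | _⟩ := z'
        · exact (key g).1
        · exact (key g).2 }
  have : Nonempty HexFlag.Vertex := ⟨HexFlag.corner 0 0 0⟩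
  obtain ⟨α, hα⟩ := m.realizes
  refine ⟨α, ?_⟩
  convert hα using 1
  · ext s
    exact ⟨fun ⟨g, h⟩ => ⟨(g, false), h⟩, fun ⟨z, h⟩ => ⟨z.1, h⟩⟩
  · ext s
    constructor
    · rintro ⟨g, h | h⟩
      · exact ⟨(g, false), h⟩
      · exact ⟨(g, true), h⟩
    · rintro ⟨⟨g, _ | _⟩, h⟩
      · exact ⟨g, Or.inl h⟩
      · exact ⟨g, Or.inr h⟩

end TypeTrihexagonal

end PlaneCells

namespace Trihexagonal

/-! ### The trihexagonal tiling -/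

/-- The triangular lattice `ℤ ⊕ ℤ ω` in the plane. -/
noncomputable def lattice (p : ℤ × ℤ) : Plane := !₂[p.1 + p.2 / 2, √3 / 2 * p.2]

theorem norm_sq_lattice_sub (p q : ℤ × ℤ) : ‖lattice p - lattice q‖ ^ 2 =
    (((p.1 - q.1) ^ 2 + (p.1 - q.1) * (p.2 - q.2) + (p.2 - q.2) ^ 2 : ℤ) : ℝ) := by
  have h3 : √3 ^ 2 = (3 : ℝ) := Real.sq_sqrt (by norm_num)
  rw [EuclideanSpace.norm_sq_eq, Fin.sum_univ_two]
  simp only [lattice, PiLp.sub_apply, Real.norm_eq_abs, sq_abs,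
    Matrix.cons_val_zero, Matrix.cons_val_one]
  push_cast
  linear_combination ((p.2 : ℝ) - q.2) ^ 2 / 4 * h3

theorem eq_of_norm_sq_lattice_sub_lt {p q : ℤ × ℤ} (h : ‖lattice p - lattice q‖ ^ 2 < 1) :
    p = q := by
  rw [norm_sq_lattice_sub] at h
  have h' : (p.1 - q.1) ^ 2 + (p.1 - q.1) * (p.2 - q.2) + (p.2 - q.2) ^ 2 < 1 := by
    exact_mod_cast h
  have h2 : p.2 - q.2 = 0 := by nlinarith [sq_nonneg (2 * (p.1 - q.1) + (p.2 - q.2))]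
  have h1 : p.1 - q.1 = 0 := by nlinarith [sq_nonneg (2 * (p.2 - q.2) + (p.1 - q.1))]
  exact Prod.ext (by omega) (by omega)

theorem v_eq (i j : ℤ) : v i j = lattice (2 * i, 2 * j) := by
  ext l
  fin_cases l <;> simp [v, lattice]
  ring

theorem w_eq (i j : ℤ) : w i j = lattice (2 * i + 1, 2 * j) := by
  ext l
  fin_cases l <;> simp [w, v, lattice] <;> ring

theorem u_eq (i j : ℤ) : u i j = lattice (2 * i + 1, 2 * j + 1) := by
  ext l
  fin_cases l <;> simp [u, v, lattice] <;> ring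

/-- The position of a vertex in the plane. -/
noncomputable def pos (p : HexFlag.Vertex) : Plane := lattice p.1

open HexFlag

theorem pos_corner_zero (i j : ℤ) : pos (corner i j 0) = u i j := by
  simp [pos, corner, u_eq, dx, dy]

theorem pos_corner_one (i j : ℤ) : pos (corner i j 1) = v i (j + 1) := by
  simp [pos, corner, v_eq, dx, dy, mul_add, add_assoc]

theorem pos_corner_two (i j : ℤ) : pos (corner i j 2) = w (i - 1) (j + 1) := by
  simp only [pos, corner, w_eq, dx, dy]
  congr 1
  ext
  · simp
    ring
  · simp
    ring

theorem pos_corner_three (i j : ℤ) : pos (corner i j 3) = u (i - 1) j := by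
  simp only [pos, corner, u_eq, dx, dy]
  congr 1
  ext
  · simp
    ring
  · simp

theorem pos_corner_four (i j : ℤ) : pos (corner i j 4) = v i j := by
  simp [pos, corner, v_eq, dx, dy]

theorem pos_corner_five (i j : ℤ) : pos (corner i j 5) = w i j := by
  simp [pos, corner, w_eq, dx, dy]

theorem norm_sq_pos_corner_sub_centre (i j : ℤ) (k : Fin 6) :
    ‖pos (corner i j k) - lattice (2 * i, 2 * j + 1)‖ ^ 2 = 1 := by
  rw [pos, norm_sq_lattice_sub]
  fin_cases k <;> simp [corner, dx, dy]

theorem norm_sq_pos_corner_succ_sub (i j : ℤ) (k : Fin 6) :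
    ‖pos (corner i j (k + 1)) - pos (corner i j k)‖ ^ 2 = 1 := by
  rw [pos, pos, norm_sq_lattice_sub]
  fin_cases k <;> simp [corner, dx, dy]

theorem norm_sq_pos_third_sub (i j : ℤ) (k : Fin 6) :
    ‖pos (corner (i + dx k) (j + dy k) (k + 2)) - pos (corner i j k)‖ ^ 2 = 1 := by
  rw [pos, pos, norm_sq_lattice_sub]
  fin_cases k <;> simp [corner, dx, dy, mul_add] <;> ring_nf

theorem pos_injective_of_lt (a b : Vertex) (h : ‖pos a - pos b‖ ^ 2 < 1) : a = b :=
  Subtype.ext (eq_of_norm_sq_lattice_sub_lt h)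

theorem pos_injective : Function.Injective pos := fun a b h =>
  pos_injective_of_lt a b (by rw [h]; simp)

theorem edges_eq : E₆.edges = (fun s => convexHull ℝ (pos '' s)) ''
    {s | ∃ g : HexFlag, s = {g.pt, g.flipVert.pt}} := by
  have hedge : ∀ i j k, convexHull ℝ (pos '' {corner i j k, corner i j (k + 1)}) ∈
      (fun s => convexHull ℝ (pos '' s)) '' {s | ∃ g : HexFlag, s = {g.pt, g.flipVert.pt}} :=
    fun i j k => ⟨_, ⟨⟨i, j, k, false⟩, rfl⟩, rfl⟩
  ext s
  constructor
  · rintro ⟨i, j, rfl | rfl | rfl | rfl | rfl | rfl⟩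
    · convert hedge i j 4 using 1
      rw [Set.image_pair, convexHull_pair]
      erw [pos_corner_four, pos_corner_five]
    · convert hedge (i + 1) (j - 1) 1 using 1
      rw [Set.image_pair, convexHull_pair, segment_symm]
      erw [pos_corner_one, pos_corner_two]
      simp
    · convert hedge i j 5 using 1
      rw [Set.image_pair, convexHull_pair]
      erw [pos_corner_five, pos_corner_zero]
    · convert hedge (i + 1) j 3 using 1
      rw [Set.image_pair, convexHull_pair, segment_symm]
      erw [pos_corner_three, pos_corner_four]
      simp
    · convert hedge i j 0 using 1
      rw [Set.image_pair, convexHull_pair]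
      erw [pos_corner_zero, pos_corner_one]
    · convert hedge (i + 1) j 2 using 1
      rw [Set.image_pair, convexHull_pair, segment_symm]
      erw [pos_corner_two, pos_corner_three]
      simp
  · rintro ⟨_, ⟨⟨i, j, k, e⟩, rfl⟩, rfl⟩
    have he : ({HexFlag.pt ⟨i, j, k, e⟩, (HexFlag.flipVert ⟨i, j, k, e⟩).pt} : Set Vertex) =
        {corner i j k, corner i j (k + 1)} := by
      cases e
      · rfl
      · exact Set.pair_comm _ _
    simp only [he, Set.image_pair, convexHull_pair]
    fin_cases k
    · refine ⟨i, j, ?_⟩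
      simp [pos_corner_zero, pos_corner_one]
    · refine ⟨i - 1, j + 1, Or.inr (Or.inl ?_)⟩
      rw [segment_symm]
      simp [pos_corner_one, pos_corner_two]
    · refine ⟨i - 1, j, Or.inr (Or.inr (Or.inr (Or.inr (Or.inr ?_))))⟩
      rw [segment_symm]
      simp [pos_corner_two, pos_corner_three]
    · refine ⟨i - 1, j, Or.inr (Or.inr (Or.inr (Or.inl ?_)))⟩
      rw [segment_symm]
      simp [pos_corner_three, pos_corner_four]
    · refine ⟨i, j, ?_⟩
      simp [pos_corner_four, pos_corner_five]
    · refine ⟨i, j, ?_⟩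
      simp [pos_corner_five, pos_corner_zero]

theorem image_hexagon (g : HexFlag) : pos '' g.hexagon =
    {v g.i g.j, w g.i g.j, u g.i g.j, v g.i (g.j + 1), w (g.i - 1) (g.j + 1), u (g.i - 1) g.j} := by
  rw [hexagon, ← Set.range_comp]
  ext x
  have h6 : ∀ Q : Fin 6 → Prop, (∃ k, Q k) ↔ Q 4 ∨ Q 5 ∨ Q 0 ∨ Q 1 ∨ Q 2 ∨ Q 3 := by
    intro Q
    simp only [Fin.exists_fin_succ]
    simp
    tauto
  simp only [Set.mem_range, Function.comp_apply, h6, pos_corner_zero, pos_corner_one,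
    pos_corner_two, pos_corner_three, pos_corner_four, pos_corner_five, Set.mem_insert_iff,
    Set.mem_singleton_iff, eq_comm]

theorem faces_eq : E₆.faces = (fun s => convexHull ℝ (pos '' s)) ''
    {s | ∃ g : HexFlag, s = g.hexagon ∨ s = g.triangle} := by
  have himg : ∀ g : HexFlag, pos '' g.triangle = {pos (corner g.i g.j g.k),
      pos (corner g.i g.j (g.k + 1)), pos (corner (g.i + dx g.k) (g.j + dy g.k) (g.k + 2))} :=
    fun g => by rw [triangle, Set.image_insert_eq, Set.image_pair]
  ext s
  constructor
  · rintro ⟨i, j, rfl | rfl | rfl⟩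
    · refine ⟨_, ⟨⟨i, j, 5, false⟩, Or.inr rfl⟩, ?_⟩
      simp only [himg]
      congr 1
      simp [pos_corner_five, pos_corner_zero, pos_corner_one, dx, dy, Set.pair_comm]
    · refine ⟨_, ⟨⟨i, j, 0, false⟩, Or.inr rfl⟩, ?_⟩
      simp only [himg]
      congr 1
      simp [pos_corner_two, pos_corner_zero, pos_corner_one, dx, dy]
      grind
    · exact ⟨_, ⟨⟨i, j, 0, false⟩, Or.inl rfl⟩, by simp only [image_hexagon]⟩
  · rintro ⟨_, ⟨⟨i, j, k, e⟩, rfl | rfl⟩, rfl⟩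
    · exact ⟨i, j, Or.inr (Or.inr (by simp only [image_hexagon]))⟩
    · simp only [himg]
      have hpos := And.intro pos_corner_zero (And.intro pos_corner_one (And.intro pos_corner_two
        (And.intro pos_corner_three (And.intro pos_corner_four pos_corner_five))))
      fin_cases k
      · refine ⟨i, j, Or.inr (Or.inl ?_)⟩
        congr 1
        simp [hpos, dx, dy]
        grind
      · refine ⟨i - 1, j + 1, Or.inl ?_⟩
        congr 1
        simp [hpos, dx, dy]
        grind
      · refine ⟨i - 1, j, Or.inr (Or.inl ?_)⟩
        congr 1
        simp [hpos, dx, dy]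
        grind
      · refine ⟨i - 1, j, Or.inl ?_⟩
        congr 1
        simp [hpos, dx, dy]
        grind
      · refine ⟨i, j - 1, Or.inr (Or.inl ?_)⟩
        congr 1
        simp [hpos, dx, dy, sub_eq_add_neg]
      · refine ⟨i, j, Or.inl ?_⟩
        congr 1
        simp [hpos, dx, dy]
        grind

theorem realizes_E₆ : E₆.Realizes pos {s | ∃ g : HexFlag, s = {g.pt, g.flipVert.pt}}
    {s | ∃ g : HexFlag, s = g.hexagon ∨ s = g.triangle} := by
  have hmem : ∀ (s : Set Vertex) (b : Vertex), b ∈ s → (∀ a ∈ s, ‖pos a - pos b‖ ^ 2 ≤ 1) →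
      ∀ a, pos a ∈ convexHull ℝ (pos '' s) → a ∈ s := fun s b hb hs a ha =>
    PlaneCells.mem_of_mem_convexHull pos_injective_of_lt hs
      (fun c hc h => hc (pos_injective h ▸ hb)) ha
  refine PlaneCells.realizes_of_convexHull pos_injective ?_ edges_eq faces_eq ?_ ?_
  · ext x
    constructor
    · rintro ⟨p, rfl⟩
      obtain ⟨i, j, k, rfl⟩ := exists_pt_eq p
      fin_cases k
      · exact ⟨i, j, Or.inl (pos_corner_zero i j)⟩
      · exact ⟨i, j + 1, Or.inr (Or.inl (pos_corner_one i j))⟩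
      · exact ⟨i - 1, j + 1, Or.inr (Or.inr (pos_corner_two i j))⟩
      · exact ⟨i - 1, j, Or.inl (pos_corner_three i j)⟩
      · exact ⟨i, j, Or.inr (Or.inl (pos_corner_four i j))⟩
      · exact ⟨i, j, Or.inr (Or.inr (pos_corner_five i j))⟩
    · rintro ⟨i, j, rfl | rfl | rfl⟩
      · exact ⟨_, pos_corner_zero i j⟩
      · exact ⟨_, pos_corner_four i j⟩
      · exact ⟨_, pos_corner_five i j⟩
  · rintro _ ⟨⟨i, j, k, e⟩, rfl⟩ a ha
    have he : ({HexFlag.pt ⟨i, j, k, e⟩, (HexFlag.flipVert ⟨i, j, k, e⟩).pt} : Set Vertex) =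
        {corner i j k, corner i j (k + 1)} := by
      cases e
      · rfl
      · exact Set.pair_comm _ _
    rw [he] at ha ⊢
    refine hmem _ (corner i j k) (Or.inl rfl) ?_ a ha
    rintro _ (rfl | rfl)
    · simp
    · exact (norm_sq_pos_corner_succ_sub i j k).le
  · rintro _ ⟨⟨i, j, k, e⟩, rfl | rfl⟩ a ha
    · refine PlaneCells.mem_of_mem_convexHull pos_injective_of_lt
        (o := lattice (2 * i, 2 * j + 1)) ?_ ?_ ha
      · rintro _ ⟨k', rfl⟩
        exact (norm_sq_pos_corner_sub_centre i j k').le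
      · intro b _ hb
        have h := eq_of_norm_sq_lattice_sub_lt (p := b.1) (q := (2 * i, 2 * j + 1)) (by
          rw [← pos, hb]
          simp)
        exact b.2 (by rw [h]; simp)
    · refine hmem _ (corner i j k) (Or.inl rfl) ?_ a ha
      rintro _ (rfl | rfl | rfl)
      · simp
      · exact (norm_sq_pos_corner_succ_sub i j k).le
      · exact (norm_sq_pos_third_sub i j k).le

end Trihexagonal

namespace PlaneCells

variable {M : PlaneCells}

/-! ### Maps of type `[3, 3, 4, 3, 4]` -/

namespace IsCyclicMap

variable (hM : M.IsCyclicMap)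

/-- The edge of the flag separates faces of different sizes. In a map of type `[3, 3, 4, 3, 4]`, the
edges without this property are the diagonals of quadrangles made of two triangles; without these
diagonals, the map becomes a map of type `[4, 4, 4, 4]`. -/
def Mixed (x : M.Flag) : Prop := M.size (hM.flipFace x).face ≠ M.size x.face

open Classical in
/-- Change the edge, passing over an edge which is not mixed. -/
noncomputable def flipMixed (x : M.Flag) : M.Flag :=
  if hM.Mixed (hM.flipEdge x) then hM.flipEdge x
  else hM.flipEdge (hM.flipFace (hM.flipEdge x))

/-- For a mixed edge: the vertex of the flag is opposite to the edge which is not mixed, in the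
triangle at the edge of the flag. -/
def IsApex (x : M.Flag) : Prop :=
  (M.size x.face = 3 ∧ hM.Mixed (hM.flipEdge x)) ∨
    (M.size (hM.flipFace x).face = 3 ∧ hM.Mixed (hM.flipEdge (hM.flipFace x)))

variable {hM}

theorem Mixed.flipFace {x : M.Flag} (h : hM.Mixed x) : hM.Mixed (hM.flipFace x) := by
  unfold Mixed at *
  rw [hM.flipFace_flipFace]
  exact h.symm

theorem Mixed.flipVert {x : M.Flag} (h : hM.Mixed x) : hM.Mixed (hM.flipVert x) := by
  unfold Mixed at *
  rwa [← hM.flipVert_flipFace, hM.flipVert_face, hM.flipVert_face]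

theorem isApex_flipFace {x : M.Flag} : hM.IsApex (hM.flipFace x) ↔ hM.IsApex x := by
  unfold IsApex
  rw [hM.flipFace_flipFace, or_comm]

@[simp] theorem flipMixed_vert (x : M.Flag) : (hM.flipMixed x).vert = x.vert := by
  unfold flipMixed
  split_ifs <;> simp

theorem flipMixed_of_mixed {x : M.Flag} (h : hM.Mixed (hM.flipEdge x)) :
    hM.flipMixed x = hM.flipEdge x := if_pos h

theorem flipMixed_of_not_mixed {x : M.Flag} (h : ¬ hM.Mixed (hM.flipEdge x)) :
    hM.flipMixed x = hM.flipEdge (hM.flipFace (hM.flipEdge x)) := if_neg h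

theorem flipMixed_flipMixed {x : M.Flag} (h : hM.Mixed x) :
    hM.flipMixed (hM.flipMixed x) = x := by
  by_cases h1 : hM.Mixed (hM.flipEdge x)
  · rw [flipMixed_of_mixed h1, flipMixed_of_mixed (by rwa [hM.flipEdge_flipEdge]),
      hM.flipEdge_flipEdge]
  · rw [flipMixed_of_not_mixed h1, flipMixed_of_not_mixed]
    · simp
    · rw [hM.flipEdge_flipEdge]
      exact fun h2 => h1 (by simpa using h2.flipFace)

theorem size_flipMixed (x : M.Flag) : M.size (hM.flipMixed x).face = M.size x.face := by
  by_cases h1 : hM.Mixed (hM.flipEdge x)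
  · rw [flipMixed_of_mixed h1, hM.flipEdge_face]
  · rw [flipMixed_of_not_mixed h1, hM.flipEdge_face]
    simpa [Mixed] using h1

section TypeSnubSquare

variable (hT : ∀ v ∈ M.verts, M.HasFaceCycle v [3, 3, 4, 3, 4])

include hT

variable (hM) in
/-- What the cyclic order `3, 3, 4, 3, 4` of the faces at a vertex says about the mixed edges: two
edges of a face at the vertex are not both unmixed; of the two triangles adjacent to a square, only
one has a further mixed edge at the vertex; and four mixed edges meet at the vertex. -/
theorem snubSquare_vertFlags (x : M.Flag) :
    (M.size x.face = 3 ∨ M.size x.face = 4) ∧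
    (M.size x.face = 4 → M.size (hM.flipFace x).face = 3) ∧
    (¬ hM.Mixed x → hM.Mixed (hM.flipEdge x)) ∧
    (M.size x.face = 4 → (hM.Mixed (hM.flipEdge (hM.flipFace (hM.flipEdge x))) ↔
      ¬ hM.Mixed (hM.flipEdge (hM.flipFace x)))) ∧
    (hM.Mixed x → hM.flipMixed (hM.flipFace (hM.flipMixed (hM.flipFace x))) =
      hM.flipFace (hM.flipMixed (hM.flipFace (hM.flipMixed x)))) := by
  obtain ⟨b, -, -, hsz, hb, hy⟩ := hM.exists_vertFlags x.vert_mem (by simp) (hT _ x.vert_mem)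
  have s0 : M.size (b 0).face = 3 := hsz 0
  have s1 : M.size (b 1).face = 3 := hsz 1
  have s2 : M.size (b 2).face = 4 := hsz 2
  have s3 : M.size (b 3).face = 3 := hsz 3
  have s4 : M.size (b 4).face = 4 := hsz 4
  have b0 : hM.flipFace (hM.flipEdge (b 0)) = b 1 := hb 0
  have b1 : hM.flipFace (hM.flipEdge (b 1)) = b 2 := hb 1
  have b2 : hM.flipFace (hM.flipEdge (b 2)) = b 3 := hb 2
  have b3 : hM.flipFace (hM.flipEdge (b 3)) = b 4 := hb 3
  have b4 : hM.flipFace (hM.flipEdge (b 4)) = b 0 := hb 4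
  have c1 : hM.flipFace (b 1) = hM.flipEdge (b 0) := by rw [← b0, hM.flipFace_flipFace]
  have c2 : hM.flipFace (b 2) = hM.flipEdge (b 1) := by rw [← b1, hM.flipFace_flipFace]
  have c3 : hM.flipFace (b 3) = hM.flipEdge (b 2) := by rw [← b2, hM.flipFace_flipFace]
  have c4 : hM.flipFace (b 4) = hM.flipEdge (b 3) := by rw [← b3, hM.flipFace_flipFace]
  have c0 : hM.flipFace (b 0) = hM.flipEdge (b 4) := by rw [← b4, hM.flipFace_flipFace]
  have hall : ∀ i : Fin 5, i = 0 ∨ i = 1 ∨ i = 2 ∨ i = 3 ∨ i = 4 := by decide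
  obtain ⟨i, rfl | rfl⟩ := hy x rfl <;> rcases hall i with rfl | rfl | rfl | rfl | rfl <;>
    simp [Mixed, flipMixed, s0, s1, s2, s3, s4, b0, b1, b2, b3, b4, c0, c1, c2, c3, c4]

theorem mixed_of_size_eq_four {x : M.Flag} (hx : M.size x.face = 4) : hM.Mixed x := by
  have := (snubSquare_vertFlags hM hT x).2.1 hx
  unfold Mixed
  omega

theorem Mixed.size_eq {x : M.Flag} (hx : hM.Mixed x) :
    M.size (hM.flipFace x).face = 4 ↔ M.size x.face = 3 := by
  have h1 := (snubSquare_vertFlags hM hT x).1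
  have h2 := (snubSquare_vertFlags hM hT (hM.flipFace x)).1
  unfold Mixed at hx
  omega

theorem mixed_flipMixed (x : M.Flag) : hM.Mixed (hM.flipMixed x) := by
  by_cases h1 : hM.Mixed (hM.flipEdge x)
  · rwa [flipMixed_of_mixed h1]
  · rw [flipMixed_of_not_mixed h1]
    refine (snubSquare_vertFlags hM hT _).2.2.1 fun h2 => h1 ?_
    simpa using h2.flipFace

theorem isApex_iff_of_triangle {x : M.Flag} (h : hM.Mixed x) (hx : M.size x.face = 3) :
    hM.IsApex x ↔ hM.Mixed (hM.flipEdge x) := by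
  have := (h.size_eq hT).2 hx
  simp [IsApex, hx, this]

theorem isApex_flipMixed_of_triangle {x : M.Flag} (h : hM.Mixed x) (hx : M.size x.face = 3) :
    hM.IsApex (hM.flipMixed x) ↔ hM.IsApex x := by
  rw [isApex_iff_of_triangle hT h hx, isApex_iff_of_triangle hT (mixed_flipMixed hT _)
    ((size_flipMixed x).trans hx)]
  by_cases h1 : hM.Mixed (hM.flipEdge x)
  · simpa [flipMixed_of_mixed h1, h1] using h
  · rw [flipMixed_of_not_mixed h1, hM.flipEdge_flipEdge]
    exact ⟨fun h2 => by simpa using h2.flipFace, fun h2 => absurd h2 h1⟩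

theorem flipMixed_of_square {x : M.Flag} (hx : M.size x.face = 4) :
    hM.flipMixed x = hM.flipEdge x :=
  flipMixed_of_mixed (mixed_of_size_eq_four hT (by simpa using hx))

theorem isApex_flipEdge_of_square {x : M.Flag} (hx : M.size x.face = 4) :
    hM.IsApex (hM.flipEdge x) ↔ ¬ hM.IsApex x := by
  obtain ⟨-, h1, -, h2, -⟩ := snubSquare_vertFlags hM hT x
  have h3 := (snubSquare_vertFlags hM hT (hM.flipEdge x)).2.1 (by simpa using hx)
  simp [IsApex, hx, h1 hx, h2 hx, h3]

theorem isApex_flipVert_of_not_isApex {x : M.Flag} (h : hM.Mixed x) (hx : ¬ hM.IsApex x) :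
    hM.IsApex (hM.flipVert x) := by
  -- one of the two faces at the edge is a triangle; pass to it
  wlog h3 : M.size x.face = 3 generalizing x
  · have h4 := (snubSquare_vertFlags hM hT x).1.resolve_left h3
    rw [← isApex_flipFace, ← hM.flipVert_flipFace]
    exact this h.flipFace (by rwa [isApex_flipFace]) ((snubSquare_vertFlags hM hT x).2.1 h4)
  rw [isApex_iff_of_triangle hT h h3] at hx
  rw [isApex_iff_of_triangle hT h.flipVert (by simpa using h3)]
  have hc := hM.iterate_face x
  rw [h3] at hc
  change hM.flipEdge (hM.flipVert (hM.flipEdge (hM.flipVert (hM.flipEdge (hM.flipVert x))))) = x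
    at hc
  have h1 : ¬ hM.Mixed (hM.flipVert (hM.flipEdge x)) := fun h2 => hx (by simpa using h2.flipVert)
  have h2 := ((snubSquare_vertFlags hM hT _).2.2.1 h1).flipVert
  conv at h2 => rw [← hc]
  simpa using h2

/-- Every triangle has exactly one edge which is not mixed: a triangle with three mixed edges would
lead to a contradiction around an adjacent square. -/
theorem isApex_flipVert {x : M.Flag} (h : hM.Mixed x) :
    hM.IsApex (hM.flipVert x) ↔ ¬ hM.IsApex x := by
  refine ⟨fun h1 h2 => ?_, isApex_flipVert_of_not_isApex hT h⟩
  wlog h4 : M.size x.face = 4 generalizing x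
  · refine this h.flipFace ?_ (by rwa [isApex_flipFace]) ?_
    · rwa [hM.flipVert_flipFace, isApex_flipFace]
    · exact (h.size_eq hT).2 ((snubSquare_vertFlags hM hT x).1.resolve_right h4)
  have hstep : ∀ y : M.Flag, M.size y.face = 4 → hM.IsApex y →
      hM.IsApex (hM.flipVert (hM.flipEdge y)) := fun y hy hy' =>
    isApex_flipVert_of_not_isApex hT (mixed_of_size_eq_four hT (by simpa using hy))
      fun h => (isApex_flipEdge_of_square hT hy).1 h hy'
  have h3 := hstep _ (by simpa using h4) (hstep _ (by simpa using h4) (hstep _ h4 h2))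
  have hc := hM.iterate_face (hM.flipVert x)
  rw [hM.flipVert_face, h4] at hc
  change hM.flipEdge (hM.flipVert (hM.flipEdge (hM.flipVert (hM.flipEdge (hM.flipVert (hM.flipEdge
    (hM.flipVert (hM.flipVert x)))))))) = hM.flipVert x at hc
  rw [hM.flipVert_flipVert] at hc
  refine (isApex_flipEdge_of_square hT ?_).1 (hc ▸ h1) h3
  simpa using h4

theorem flipVert_flipMixed_comm {x : M.Flag} (h : hM.Mixed x) :
    hM.flipVert (hM.flipMixed (hM.flipVert (hM.flipMixed x))) =
      hM.flipMixed (hM.flipVert (hM.flipMixed (hM.flipVert x))) := by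
  rcases (snubSquare_vertFlags hM hT x).1 with h3 | h4
  · wlog hx : ¬ hM.IsApex x generalizing x
    · -- the relation is conjugated by `flipVert` to that at the other end of the edge
      have h' := this h.flipVert (by simpa using h3) (by
        rw [isApex_flipVert hT h]
        exact fun h => h (not_not.1 hx))
      rw [hM.flipVert_flipVert] at h'
      rw [← h', hM.flipVert_flipVert]
    have hc : ∀ y : M.Flag, M.size y.face = 3 → hM.flipVert (hM.flipEdge (hM.flipVert
        (hM.flipEdge y))) = hM.flipEdge (hM.flipVert y) := fun y hy => by
      have hc := hM.iterate_face y
      rw [hy] at hc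
      change hM.flipEdge (hM.flipVert (hM.flipEdge (hM.flipVert (hM.flipEdge (hM.flipVert y))))) =
        y at hc
      conv_lhs => rw [← hc]
      simp
    have hap : ∀ y : M.Flag, hM.Mixed y → M.size y.face = 3 → hM.IsApex y →
        hM.flipMixed y = hM.flipEdge y := fun y hy hy3 hya =>
      flipMixed_of_mixed ((isApex_iff_of_triangle hT hy hy3).1 hya)
    have hba : ∀ y : M.Flag, hM.Mixed y → M.size y.face = 3 → ¬ hM.IsApex y →
        hM.flipMixed y = hM.flipEdge (hM.flipFace (hM.flipEdge y)) := fun y hy hy3 hya =>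
      flipMixed_of_not_mixed fun h => hya ((isApex_iff_of_triangle hT hy hy3).2 h)
    have h1 : hM.IsApex (hM.flipVert x) := (isApex_flipVert hT h).2 hx
    have h2 : hM.IsApex (hM.flipVert (hM.flipMixed x)) := by
      rwa [isApex_flipVert hT (mixed_flipMixed hT _), isApex_flipMixed_of_triangle hT h h3]
    have h4 : ¬ hM.IsApex (hM.flipVert (hM.flipMixed (hM.flipVert x))) := by
      rw [isApex_flipVert hT (mixed_flipMixed hT _),
        isApex_flipMixed_of_triangle hT h.flipVert (by simpa using h3)]
      exact fun h => h h1
    rw [hap _ (mixed_flipMixed hT _).flipVert (by simpa [size_flipMixed] using h3) h2,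
      hba _ (mixed_flipMixed hT _).flipVert (by simpa [size_flipMixed] using h3) h4,
      hap _ h.flipVert (by simpa using h3) h1, hba _ h h3 hx, hc]
    · rw [hM.flipVert_flipFace, ← hc x h3]
      simp
    · simpa [hba _ h h3 hx] using (size_flipMixed (hM := hM) x).trans h3
  · have h4' : ∀ y : M.Flag, y.face = x.face → hM.flipMixed y = hM.flipEdge y := fun y hy =>
      flipMixed_of_square hT (by rw [hy, h4])
    have hc := hM.iterate_face x
    rw [h4] at hc
    change hM.flipEdge (hM.flipVert (hM.flipEdge (hM.flipVert (hM.flipEdge (hM.flipVert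
      (hM.flipEdge (hM.flipVert x))))))) = x at hc
    rw [h4' x rfl, h4' _ (by simp), h4' (hM.flipVert x) (by simp), h4' _ (by simp)]
    conv_lhs => rw [← hc]
    simp

end TypeSnubSquare

end IsCyclicMap

end PlaneCells

/-! ### The snub square tiling as a combinatorial map -/

namespace GridFlag

/-- The square of the flag is a square of the snub square tiling, not a pair of triangles. -/
def IsSquare (g : GridFlag) : Prop := Even (g.i + g.j) ↔ g.s = g.t

/-- The square of the flag is divided into two triangles by a diagonal, and the vertex of the flag
is on this diagonal. -/
def IsBase (g : GridFlag) : Prop := ¬ g.IsSquare ∧ (g.s = true ↔ Even g.j)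

/-- The triangle of the snub square tiling at the edge of the flag, on either side, has its angle
at the vertex of the flag not adjacent to a diagonal. -/
def IsApex (g : GridFlag) : Prop := (g.s = true ↔ Even g.j) ↔ (g.IsSquare ∧ g.w = true)

/-- Pass to the opposite vertex of the square. -/
def flipDiag (g : GridFlag) : GridFlag := ⟨g.i + sgn g.s, g.j + sgn g.t, !g.s, !g.t, !g.w⟩

/-- The vertex of a flag. -/
def pt (g : GridFlag) : ℤ × ℤ := (g.i, g.j)

open Classical in
/-- The vertices of the face of the snub square tiling that contains the edge of the flag and is
contained in its square. -/
noncomputable def face (g : GridFlag) : Set (ℤ × ℤ) :=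
  if g.IsSquare then {g.pt, g.flipVert.pt, g.flipEdge.flipVert.pt, g.flipDiag.pt}
  else {g.pt, g.flipVert.pt, if g.IsBase then g.flipDiag.pt else g.flipEdge.flipVert.pt}

theorem isSquare_flipVert (g : GridFlag) : g.flipVert.IsSquare ↔ g.IsSquare := by
  obtain ⟨i, j, s, t, w⟩ := g
  cases s <;> cases t <;> cases w <;> simp [flipVert, IsSquare, Int.even_add] <;>
    simp only [← Int.not_even_iff_odd] <;> tauto

theorem isSquare_flipEdge (g : GridFlag) : g.flipEdge.IsSquare ↔ g.IsSquare := Iff.rfl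

theorem isSquare_flipFace (g : GridFlag) : g.flipFace.IsSquare ↔ ¬ g.IsSquare := by
  obtain ⟨i, j, s, t, w⟩ := g
  cases s <;> cases t <;> cases w <;> simp [flipFace, IsSquare, Int.even_add, -Int.not_even_iff_odd]

theorem isApex_flipVert (g : GridFlag) : g.flipVert.IsApex ↔ ¬ g.IsApex := by
  unfold IsApex
  rw [isSquare_flipVert]
  obtain ⟨i, j, s, t, w⟩ := g
  cases s <;> cases t <;> cases w <;> simp [flipVert, Int.even_add] <;>
    simp only [← Int.not_even_iff_odd] <;> tauto

theorem isApex_flipFace (g : GridFlag) : g.flipFace.IsApex ↔ g.IsApex := by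
  unfold IsApex
  rw [isSquare_flipFace]
  obtain ⟨i, j, s, t, w⟩ := g
  cases s <;> cases t <;> cases w <;> simp [flipFace] <;>
    simp only [← Int.not_even_iff_odd] <;> tauto

theorem isApex_flipEdge_of_isSquare {g : GridFlag} (hg : g.IsSquare) :
    g.flipEdge.IsApex ↔ ¬ g.IsApex := by
  unfold IsApex
  rw [isSquare_flipEdge]
  obtain ⟨i, j, s, t, w⟩ := g
  cases w <;> simp [flipEdge, hg]

theorem isApex_flipEdge_of_not_isSquare {g : GridFlag} (hg : ¬ g.IsSquare) :
    g.flipEdge.IsApex ↔ g.IsApex := by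
  unfold IsApex
  rw [isSquare_flipEdge]
  simp [flipEdge, hg]

theorem isBase_iff {g : GridFlag} : g.IsBase ↔ ¬ g.IsSquare ∧ ¬ g.IsApex := by
  unfold IsBase IsApex
  tauto

theorem isBase_flipDiag {g : GridFlag} (hg : g.IsBase) : g.flipDiag.IsBase := by
  unfold IsBase IsSquare at *
  obtain ⟨i, j, s, t, w⟩ := g
  cases s <;> cases t <;> simp [flipDiag, Int.even_add] at * <;>
    simp only [← Int.not_even_iff_odd] at * <;> tauto

theorem flipVert_flipEdge_flipVert (g : GridFlag) :
    g.flipVert.flipEdge.flipVert = g.flipDiag := by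
  obtain ⟨i, j, s, t, w⟩ := g
  cases w <;> simp [flipVert, flipEdge, flipDiag]

theorem pt_flipVert_flipFace (g : GridFlag) : g.flipFace.flipVert.pt = g.flipVert.pt := by
  obtain ⟨i, j, s, t, w⟩ := g
  cases w <;> simp [flipVert, flipFace, pt]

theorem pt_flipFace (g : GridFlag) : g.flipFace.pt = g.pt := by
  obtain ⟨i, j, s, t, w⟩ := g
  cases w <;> simp [flipFace, pt]

theorem face_flipVert (g : GridFlag) : g.flipVert.face = g.face := by
  have h1 := isSquare_flipVert g
  have h2 := isApex_flipVert g
  have h3 := g.isBase_iff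
  have h4 := g.flipVert.isBase_iff
  obtain ⟨i, j, s, t, w⟩ := g
  ext ⟨x, y⟩
  cases w <;> simp only [face, h1, h2, h3, h4] <;>
    split_ifs <;> simp_all [pt, flipVert, flipEdge, flipDiag] <;> tauto

theorem face_flipEdge {g : GridFlag} (hg : ¬ g.IsBase) : g.flipEdge.face = g.face := by
  have h1 := isSquare_flipEdge g
  have h2 : ¬ g.flipEdge.IsBase := hg
  obtain ⟨i, j, s, t, w⟩ := g
  ext ⟨x, y⟩
  cases w <;> simp only [face, h1, h2, hg] <;>
    split_ifs <;> simp_all [pt, flipVert, flipEdge, flipDiag] <;> tauto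

theorem face_flipDiag {g : GridFlag} (hg : g.IsBase) : g.flipDiag.face = g.face := by
  have h1 : ¬ g.IsSquare := hg.1
  have h2 := isBase_flipDiag hg
  have h3 : ¬ g.flipDiag.IsSquare := h2.1
  obtain ⟨i, j, s, t, w⟩ := g
  ext ⟨x, y⟩
  cases w <;> simp only [face, h1, h2, h3, hg] <;>
    simp_all [pt, flipVert, flipDiag] <;> tauto

end GridFlag

namespace PlaneCells

variable {M : PlaneCells}

open IsCyclicMap

/-- The flag model of a map of type `[3, 3, 4, 3, 4]` with a square flag `x₀`: the flags on mixed
edges form an orbit of the symmetry group of the square lattice, and the two flags of a triangle at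
a corner on its diagonal are one such flag and its image under `flipEdge`. -/
theorem exists_realizes_snubSquare (hM : M.IsCyclicMap)
    (hT : ∀ v ∈ M.verts, M.HasFaceCycle v [3, 3, 4, 3, 4]) (x₀ : M.Flag)
    (hx₀ : M.size x₀.face = 4) :
    ∃ α : ℤ × ℤ → Plane,
      M.Realizes α {s | ∃ g : GridFlag, s = {g.pt, g.flipVert.pt} ∨
          (g.IsBase ∧ s = {g.pt, g.flipDiag.pt})}
        {s | ∃ g : GridFlag, s = g.face} := by
  wlog hx₀' : ¬ hM.IsApex x₀ generalizing x₀
  · refine this (hM.flipVert x₀) (by simpa using hx₀) ?_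
    rw [isApex_flipVert hT (mixed_of_size_eq_four hT hx₀)]
    exact fun h => h (not_not.1 hx₀')
  let N := {x : M.Flag // hM.Mixed x}
  let a : Equiv.Perm N := Function.Involutive.toPerm
    (fun x => ⟨hM.flipVert x.1, x.2.flipVert⟩) fun x => Subtype.ext (by simp)
  let b : Equiv.Perm N := Function.Involutive.toPerm
    (fun x => ⟨hM.flipMixed x.1, mixed_flipMixed hT x.1⟩)
    fun x => Subtype.ext (flipMixed_flipMixed x.2)
  let c : Equiv.Perm N := Function.Involutive.toPerm
    (fun x => ⟨hM.flipFace x.1, x.2.flipFace⟩) fun x => Subtype.ext (by simp)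
  obtain ⟨φ, hφ₀, h0, h1, h2⟩ := exists_gridFlag_map (a := a) (b := b) (c := c)
    (by ext x : 1; exact Subtype.ext (hM.flipVert_flipVert _))
    (by ext x : 1; exact Subtype.ext (flipMixed_flipMixed x.2))
    (by ext x : 1; exact Subtype.ext (hM.flipFace_flipFace _))
    (by ext x : 1; exact Subtype.ext (hM.flipVert_flipFace _))
    (by ext x : 1; exact Subtype.ext (flipVert_flipMixed_comm hT x.2))
    (by ext x : 1; exact Subtype.ext ((snubSquare_vertFlags hM hT x.1).2.2.2.2 x.2))
    ⟨x₀, mixed_of_size_eq_four hT hx₀⟩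
  have e0 : ∀ g, (φ g.flipVert).1 = hM.flipVert (φ g).1 := fun g => by rw [h0]; rfl
  have e1 : ∀ g, (φ g.flipEdge).1 = hM.flipMixed (φ g).1 := fun g => by rw [h1]; rfl
  have e2 : ∀ g, (φ g.flipFace).1 = hM.flipFace (φ g).1 := fun g => by rw [h2]; rfl
  have h34 : ∀ x : M.Flag, M.size x.face = 3 ∨ M.size x.face = 4 := fun x =>
    (snubSquare_vertFlags hM hT x).1
  -- squares and apices are where they should be
  have hkind : ∀ g, (M.size (φ g).1.face = 4 ↔ g.IsSquare) ∧ (hM.IsApex (φ g).1 ↔ g.IsApex) := by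
    refine GridFlag.induction ?_ ?_ ?_ (g₀ := ⟨0, 0, true, true, false⟩) ?_
    · rintro g ⟨hs, ha⟩
      rw [e0, hM.flipVert_face, GridFlag.isSquare_flipVert, IsCyclicMap.isApex_flipVert hT (φ g).2,
        GridFlag.isApex_flipVert, ha]
      exact ⟨hs, Iff.rfl⟩
    · rintro g ⟨hs, ha⟩
      rw [e1, size_flipMixed, GridFlag.isSquare_flipEdge]
      refine ⟨hs, ?_⟩
      by_cases hg : g.IsSquare
      · rw [flipMixed_of_square hT (hs.2 hg), isApex_flipEdge_of_square hT (hs.2 hg),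
          GridFlag.isApex_flipEdge_of_isSquare hg, ha]
      · rw [isApex_flipMixed_of_triangle hT (φ g).2 ((h34 _).resolve_right fun h => hg (hs.1 h)),
          GridFlag.isApex_flipEdge_of_not_isSquare hg, ha]
    · rintro g ⟨hs, ha⟩
      rw [e2, IsCyclicMap.isApex_flipFace, GridFlag.isApex_flipFace, ha,
        GridFlag.isSquare_flipFace, ← hs, (φ g).2.size_eq hT]
      have := h34 (φ g).1
      exact ⟨by omega, Iff.rfl⟩
    · rw [hφ₀]
      simp [hx₀, hx₀', GridFlag.IsSquare, GridFlag.IsApex]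
  -- the edges passed over by `flipMixed` are the diagonals of the model
  have hbase : ∀ g : GridFlag, g.IsBase ↔ ¬ hM.Mixed (hM.flipEdge (φ g).1) := by
    intro g
    rw [GridFlag.isBase_iff, ← (hkind g).1, ← (hkind g).2]
    rcases h34 (φ g).1 with h | h
    · rw [isApex_iff_of_triangle hT (φ g).2 h]
      simp [h]
    · have := mixed_of_size_eq_four (hM := hM) hT (x := hM.flipEdge (φ g).1) (by simpa using h)
      simp [h, this]
  have hnb : ∀ g : GridFlag, g.IsSquare ∨ g.IsBase → ¬ g.flipVert.IsBase := by
    intro g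
    rw [GridFlag.isBase_iff, GridFlag.isBase_iff, GridFlag.isSquare_flipVert,
      GridFlag.isApex_flipVert]
    tauto
  have e1n : ∀ g : GridFlag, ¬ g.IsBase → (φ g.flipEdge).1 = hM.flipEdge (φ g).1 := fun g hg => by
    rw [e1, flipMixed_of_mixed (not_not.1 fun h => hg ((hbase g).2 h))]
  have e1b : ∀ g : GridFlag, g.IsBase → (φ g.flipEdge).1 =
      hM.flipEdge (hM.flipFace (hM.flipEdge (φ g).1)) := fun g hg => by
    rw [e1, flipMixed_of_not_mixed ((hbase g).1 hg)]
  have ed : ∀ g : GridFlag, ¬ g.flipVert.IsBase → (φ g.flipDiag).1 =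
      hM.flipVert (hM.flipEdge (hM.flipVert (φ g).1)) := fun g hg => by
    rw [← GridFlag.flipVert_flipEdge_flipVert, e0, e1n _ hg, e0]
  have hvert : ∀ g g' : GridFlag, g.pt = g'.pt → (φ g).1.vert = (φ g').1.vert := by
    have key : ∀ i j s t w, (φ ⟨i, j, s, t, w⟩).1.vert = (φ ⟨i, j, true, true, true⟩).1.vert := by
      have hw : ∀ {i j s t} w, (φ ⟨i, j, s, t, w⟩).1.vert = (φ ⟨i, j, s, t, true⟩).1.vert := by
        intro i j s t w
        cases w
        · exact (congrArg Flag.vert (e1 ⟨i, j, s, t, true⟩)).trans (flipMixed_vert _)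
        · rfl
      have hs : ∀ {i j s t}, (φ ⟨i, j, s, t, true⟩).1.vert = (φ ⟨i, j, true, t, true⟩).1.vert := by
        intro i j s t
        cases s
        · exact (congrArg Flag.vert (e2 ⟨i, j, true, t, true⟩)).trans (hM.flipFace_vert _)
        · rfl
      have ht : ∀ {i j s t}, (φ ⟨i, j, s, t, false⟩).1.vert =
          (φ ⟨i, j, s, true, false⟩).1.vert := by
        intro i j s t
        cases t
        · exact (congrArg Flag.vert (e2 ⟨i, j, s, true, false⟩)).trans (hM.flipFace_vert _)
        · rfl
      intro i j s t w
      rw [hw, hs, ← hw false, ht, hw]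
    rintro ⟨i, j, s, t, w⟩ ⟨i', j', s', t', w'⟩ h
    obtain ⟨rfl, rfl⟩ := Prod.mk.inj h
    rw [key, key i j s']
  -- `(g, false)` is the flag on a mixed edge given by `g`; where `g` is at a corner of a triangle on
  -- the diagonal, `(g, true)` is the other flag at this corner, on the diagonal
  let Z := {z : GridFlag × Bool // z.2 = true → z.1.IsBase}
  -- there are eight flags of the first kind at a vertex and two of the second kind
  have hfibre : ∀ i j, ∃ f : (Bool × Bool × Bool) ⊕ Bool → GridFlag × Bool,
      Subtype.val '' {z : Z | z.1.1.pt = (i, j)} ⊆ f '' Set.univ := by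
    intro i j
    refine ⟨Sum.elim (fun q => (⟨i, j, q.1, q.2.1, q.2.2⟩, false)) fun w =>
      (⟨i, j, decide (Even j), decide (¬ Even (i + j)) == decide (Even j), w⟩, true), ?_⟩
    rintro _ ⟨⟨⟨⟨i', j', s, t, w⟩, τ⟩, hz⟩, h, rfl⟩
    obtain ⟨rfl, rfl⟩ := Prod.mk.inj h
    cases τ
    · exact ⟨Sum.inl (s, t, w), trivial, rfl⟩
    · refine ⟨Sum.inr w, trivial, ?_⟩
      obtain ⟨hz1, hz2⟩ := hz rfl
      simp only [GridFlag.IsSquare] at hz1 hz2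
      by_cases hj : Even j' <;> by_cases hij : Even (i' + j') <;> cases s <;> cases t <;>
        simp_all
  have hfin : ∀ i j, {z : Z | z.1.1.pt = (i, j)}.Finite := fun i j => by
    obtain ⟨f, hf⟩ := hfibre i j
    exact ((Set.finite_univ.image f).subset hf).of_finite_image Subtype.val_injective.injOn
  have hcard : ∀ i j, {z : Z | z.1.1.pt = (i, j)}.ncard ≤ 10 := fun i j => by
    obtain ⟨f, hf⟩ := hfibre i j
    rw [← Set.ncard_image_of_injective _ Subtype.val_injective]
    refine (Set.ncard_le_ncard hf (Set.finite_univ.image f)).trans ?_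
    refine (Set.ncard_image_le Set.finite_univ).trans ?_
    rw [Set.ncard_univ, Nat.card_eq_fintype_card]
    simp
  classical
  let m : FlagModel hM Z (ℤ × ℤ) :=
    { t₀ := fun z => if h : z.1.2 = true then
          ⟨(z.1.1.flipDiag, true), fun _ => GridFlag.isBase_flipDiag (z.2 h)⟩
        else ⟨(z.1.1.flipVert, false), by simp⟩
      t₁ := fun z => if z.1.2 = true then ⟨(z.1.1, false), by simp⟩
        else if h : z.1.1.IsBase then ⟨(z.1.1, true), fun _ => h⟩
        else ⟨(z.1.1.flipEdge, false), by simp⟩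
      t₂ := fun z => if h : z.1.2 = true then ⟨(z.1.1.flipEdge, true), fun _ => z.2 h⟩
        else ⟨(z.1.1.flipFace, false), by simp⟩
      φ := fun z => if z.1.2 = true then hM.flipEdge (φ z.1.1).1 else (φ z.1.1).1
      pt := fun z => z.1.1.pt
      fc := fun z => z.1.1.face
      φ_t₀ := by
        rintro ⟨⟨g, _ | _⟩, hg⟩
        · simp [e0]
        · have hg' := hg rfl
          have h3 : M.size (φ g).1.face = 3 :=
            (h34 _).resolve_right fun h => hg'.1 ((hkind g).1.1 h)
          have hc := hM.iterate_face (φ g).1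
          rw [h3] at hc
          change hM.flipEdge (hM.flipVert (hM.flipEdge (hM.flipVert (hM.flipEdge (hM.flipVert
            (φ g).1))))) = (φ g).1 at hc
          have := ed g (hnb g (Or.inr hg'))
          simp only [dif_pos, if_true, this]
          conv_rhs => rw [← hc]
          simp
      φ_t₁ := by
        rintro ⟨⟨g, _ | _⟩, hg⟩
        · by_cases h : g.IsBase
          · simp [h]
          · simp [h, e1n]
        · simp
      φ_t₂ := by
        rintro ⟨⟨g, _ | _⟩, hg⟩
        · simp [e2]
        · simp [e1b g (hg rfl)]
      pt_t₁ := by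
        rintro ⟨⟨g, _ | _⟩, hg⟩
        · by_cases h : g.IsBase
          · simp [h]
          · simp [h]
            rfl
        · simp
      pt_t₂ := by
        rintro ⟨⟨g, _ | _⟩, hg⟩
        · simp [GridFlag.pt_flipFace]
        · simp
          rfl
      pt_t₀_t₂ := by
        rintro ⟨⟨g, _ | _⟩, hg⟩
        · simp [GridFlag.pt_flipVert_flipFace]
        · simp
          rfl
      fc_t₀ := by
        rintro ⟨⟨g, _ | _⟩, hg⟩
        · simp [GridFlag.face_flipVert]
        · simp [GridFlag.face_flipDiag (hg rfl)]
      fc_t₁ := by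
        rintro ⟨⟨g, _ | _⟩, hg⟩
        · by_cases h : g.IsBase
          · simp [h]
          · simp [h, GridFlag.face_flipEdge h]
        · simp
      pt_surj := fun p => ⟨⟨(⟨p.1, p.2, true, true, true⟩, false), by simp⟩, rfl⟩
      pt_mem := by
        rintro ⟨⟨g, _ | _⟩, hg⟩ <;> simp only [GridFlag.face] <;> split_ifs <;> exact Or.inl rfl
      exists_corner := by
        rintro ⟨⟨g, τ⟩, hg⟩ x hx
        have hφf : (if τ = true then hM.flipEdge (φ g).1 else (φ g).1).face = (φ g).1.face := by
          cases τ <;> simp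
        suffices h : ∃ g' : GridFlag, g'.pt = x ∧ g'.face = g.face ∧
            (φ g').1.face = (φ g).1.face by
          obtain ⟨g', h1, h2, h3⟩ := h
          exact ⟨⟨(g', false), by simp⟩, h1, h2, h3.trans hφf.symm⟩
        have hv : g.flipVert.face = g.face ∧ (φ g.flipVert).1.face = (φ g).1.face :=
          ⟨g.face_flipVert, by rw [e0, hM.flipVert_face]⟩
        have hev : ¬ g.IsBase → g.flipEdge.flipVert.face = g.face ∧
            (φ g.flipEdge.flipVert).1.face = (φ g).1.face := fun h =>
          ⟨by rw [GridFlag.face_flipVert, GridFlag.face_flipEdge h], by simp [e0, e1n g h]⟩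
        have hd : ¬ g.flipVert.IsBase → g.flipDiag.face = g.face ∧
            (φ g.flipDiag).1.face = (φ g).1.face := fun h =>
          ⟨by rw [← GridFlag.flipVert_flipEdge_flipVert, GridFlag.face_flipVert,
            GridFlag.face_flipEdge h, GridFlag.face_flipVert], by simp [ed g h]⟩
        simp only [GridFlag.face] at hx
        split_ifs at hx with hs hb
        · have hnb' : ¬ g.IsBase := fun h => h.1 hs
          rcases hx with rfl | rfl | rfl | rfl
          · exact ⟨g, rfl, rfl, rfl⟩
          · exact ⟨_, rfl, hv⟩
          · exact ⟨_, rfl, hev hnb'⟩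
          · exact ⟨_, rfl, hd (hnb g (Or.inl hs))⟩
        · rcases hx with rfl | rfl | rfl
          · exact ⟨g, rfl, rfl, rfl⟩
          · exact ⟨_, rfl, hv⟩
          · exact ⟨_, rfl, hd (hnb g (Or.inr hb))⟩
        · rcases hx with rfl | rfl | rfl
          · exact ⟨g, rfl, rfl, rfl⟩
          · exact ⟨_, rfl, hv⟩
          · exact ⟨_, rfl, hev hb⟩
      vert_eq := by
        rintro ⟨⟨g, _ | _⟩, hg⟩ ⟨⟨g', _ | _⟩, hg'⟩ h <;> simpa using hvert g g' h
      finite_fibre := fun p => hfin p.1 p.2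
      card_fibre := by
        rintro ⟨⟨g, τ⟩, hg⟩
        have h10 := hM.ncard_vertFlags (φ g).1.vert_mem (by simp) (hT _ (φ g).1.vert_mem)
        have hv : (if τ = true then hM.flipEdge (φ g).1 else (φ g).1).vert = (φ g).1.vert := by
          cases τ <;> simp
        simp only [hv]
        exact (hcard g.i g.j).trans h10
      finite_fc := by
        rintro ⟨⟨g, τ⟩, hg⟩
        simp only [GridFlag.face]
        split_ifs <;> exact Set.toFinite _
      card_fc := by
        rintro ⟨⟨g, τ⟩, hg⟩
        have hφf : (if τ = true then hM.flipEdge (φ g).1 else (φ g).1).face = (φ g).1.face := by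
          cases τ <;> simp
        simp only [hφf, GridFlag.face]
        split_ifs with hs
        · rw [(hkind g).1.2 hs]
          exact (Set.ncard_insert_le _ _).trans (Nat.succ_le_succ (ncard_triple_le _ _ _))
        all_goals
          rw [(h34 (φ g).1).resolve_right fun h => hs ((hkind g).1.1 h)]
          exact ncard_triple_le _ _ _
      conn := by
        intro P k0 k1 k2 z z' hz
        have key : ∀ g, P ⟨(g, false), by simp⟩ := by
          have hdown : ∀ g (hg : g.IsBase), P ⟨(g, true), fun _ => hg⟩ → P ⟨(g, false), by simp⟩ :=
            fun g hg h => k1 _ h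
          have hup : ∀ g (hg : g.IsBase), P ⟨(g, false), by simp⟩ → P ⟨(g, true), fun _ => hg⟩ :=
            fun g hg h => by simpa [hg] using k1 _ h
          refine GridFlag.induction (g₀ := z.1.1) (fun g hg => k0 _ hg) (fun g hg => ?_)
            (fun g hg => k2 _ hg) ?_
          · by_cases h : g.IsBase
            · exact hdown _ h (k2 _ (hup g h hg))
            · simpa [h] using k1 _ hg
          · obtain ⟨⟨g, _ | _⟩, hg⟩ := z
            · exact hz
            · exact hdown g (hg rfl) hz
        obtain ⟨⟨g, _ | _⟩, hg⟩ := z'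
        · exact key g
        · simpa [hg rfl] using k1 _ (key g) }
  obtain ⟨α, hα⟩ := m.realizes
  refine ⟨α, ?_⟩
  convert hα using 1
  · ext s
    constructor
    · rintro ⟨g, h | ⟨hg, h⟩⟩
      · exact ⟨⟨(g, false), by simp⟩, h⟩
      · exact ⟨⟨(g, true), fun _ => hg⟩, h⟩
    · rintro ⟨⟨⟨g, _ | _⟩, hg⟩, h⟩
      · exact ⟨g, Or.inl h⟩
      · exact ⟨g, Or.inr ⟨hg rfl, h⟩⟩
  · ext s
    exact ⟨fun ⟨g, h⟩ => ⟨⟨(g, false), by simp⟩, h⟩, fun ⟨z, h⟩ => ⟨z.1.1, h⟩⟩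

end PlaneCells

namespace SnubSquare

open GridFlag

/-! ### The snub square tiling -/

/-- The position of a vertex in the plane. -/
noncomputable def pos (p : ℤ × ℤ) : Plane := u p.1 p.2

/-- The difference of two vertices is `m t₁ + n t₂ + (p, q)`, where `t₁`, `t₂` are the orthogonal
translations of the tiling, of length `√(2 + √3)`. -/
theorem norm_sq_u_sub {i j i' j' m n p q : ℤ} (hm : i / 2 - i' / 2 = m) (hn : j / 2 - j' / 2 = n)
    (hp : i % 2 - i' % 2 = p) (hq : j % 2 - j' % 2 = q) : ‖u i j - u i' j'‖ ^ 2 =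
      ((2 * (m * (m + p) + n * (n + q)) + n * p - m * q + p ^ 2 + q ^ 2 : ℤ) : ℝ) +
        ((m * (m + p) + n * (n + q) : ℤ) : ℝ) * √3 := by
  have h3 : √3 ^ 2 = (3 : ℝ) := Real.sq_sqrt (by norm_num)
  rw [EuclideanSpace.norm_sq_eq, Fin.sum_univ_two]
  subst hm hn hp hq
  simp only [u, PiLp.sub_apply, PiLp.add_apply, PiLp.smul_apply, smul_eq_mul, Real.norm_eq_abs,
    sq_abs, Matrix.cons_val_zero, Matrix.cons_val_one]
  push_cast
  linear_combination (((i / 2 : ℤ) - (i' / 2 : ℤ) : ℝ) ^ 2 / 4 +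
    ((j / 2 : ℤ) - (j' / 2 : ℤ) : ℝ) ^ 2 / 4) * h3

theorem pos_injective_of_lt (a b : ℤ × ℤ) (h : ‖pos a - pos b‖ ^ 2 < 1) : a = b := by
  obtain ⟨i, j⟩ := a
  obtain ⟨i', j'⟩ := b
  obtain ⟨m, hm⟩ : ∃ m, i / 2 - i' / 2 = m := ⟨_, rfl⟩
  obtain ⟨n, hn⟩ : ∃ n, j / 2 - j' / 2 = n := ⟨_, rfl⟩
  obtain ⟨p, hp⟩ : ∃ p, i % 2 - i' % 2 = p := ⟨_, rfl⟩
  obtain ⟨q, hq⟩ : ∃ q, j % 2 - j' % 2 = q := ⟨_, rfl⟩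
  rw [pos, pos, norm_sq_u_sub hm hn hp hq] at h
  have hp3 : p = -1 ∨ p = 0 ∨ p = 1 := by omega
  have hq3 : q = -1 ∨ q = 0 ∨ q = 1 := by omega
  have hm1 : 0 ≤ m * (m + 1) := by
    rcases lt_or_ge m 0 with h | h
    · exact mul_nonneg_of_nonpos_of_nonpos (by omega) (by omega)
    · positivity
  have hm2 : 0 ≤ m * (m + -1) := by
    rcases le_or_gt m 0 with h | h
    · exact mul_nonneg_of_nonpos_of_nonpos (by omega) (by omega)
    · exact mul_nonneg (by omega) (by omega)
  have hn1 : 0 ≤ n * (n + 1) := by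
    rcases lt_or_ge n 0 with h | h
    · exact mul_nonneg_of_nonpos_of_nonpos (by omega) (by omega)
    · positivity
  have hn2 : 0 ≤ n * (n + -1) := by
    rcases le_or_gt n 0 with h | h
    · exact mul_nonneg_of_nonpos_of_nonpos (by omega) (by omega)
    · exact mul_nonneg (by omega) (by omega)
  have hB : 0 ≤ m * (m + p) + n * (n + q) := by
    rcases hp3 with rfl | rfl | rfl <;> rcases hq3 with rfl | rfl | rfl <;> nlinarith
  have hA : 2 * (m * (m + p) + n * (n + q)) + n * p - m * q + p ^ 2 + q ^ 2 < 1 := by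
    by_contra! hA
    have h1 : (1 : ℝ) ≤
        ((2 * (m * (m + p) + n * (n + q)) + n * p - m * q + p ^ 2 + q ^ 2 : ℤ) : ℝ) := by
      exact_mod_cast hA
    have h2 : (0 : ℝ) ≤ ((m * (m + p) + n * (n + q) : ℤ) : ℝ) := by exact_mod_cast hB
    have := mul_nonneg h2 (Real.sqrt_nonneg 3)
    linarith
  have h0 : p = 0 ∧ q = 0 ∧ m ^ 2 + n ^ 2 < 1 := by
    rcases hp3 with rfl | rfl | rfl <;> rcases hq3 with rfl | rfl | rfl
    all_goals
      first
      | exact ⟨rfl, rfl, by nlinarith⟩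
      | exfalso
        nlinarith [sq_nonneg m, sq_nonneg n, sq_nonneg (m + 1), sq_nonneg (m - 1),
          sq_nonneg (n + 1), sq_nonneg (n - 1)]
  obtain ⟨rfl, rfl, h0⟩ := h0
  have hm0 : m = 0 := by nlinarith
  have hn0 : n = 0 := by nlinarith
  exact Prod.ext (by dsimp only; omega) (by dsimp only; omega)

theorem pos_injective : Function.Injective pos := fun a b h =>
  pos_injective_of_lt a b (by rw [h]; simp)

theorem norm_sq_right (i j : ℤ) : ‖u (i + 1) j - u i j‖ ^ 2 = 1 := by
  rcases Int.even_or_odd' i with ⟨a, rfl | rfl⟩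
  · rw [norm_sq_u_sub (m := 0) (n := 0) (p := 1) (q := 0) (by omega) (by omega) (by omega)
      (by omega)]
    norm_num
  · rw [norm_sq_u_sub (m := 1) (n := 0) (p := -1) (q := 0) (by omega) (by omega) (by omega)
      (by omega)]
    norm_num

theorem norm_sq_up (i j : ℤ) : ‖u i (j + 1) - u i j‖ ^ 2 = 1 := by
  rcases Int.even_or_odd' j with ⟨a, rfl | rfl⟩
  · rw [norm_sq_u_sub (m := 0) (n := 0) (p := 0) (q := 1) (by omega) (by omega) (by omega)
      (by omega)]
    norm_num
  · rw [norm_sq_u_sub (m := 0) (n := 1) (p := 0) (q := -1) (by omega) (by omega) (by omega)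
      (by omega)]
    norm_num

theorem norm_sq_diag {i j : ℤ} (hi : Odd i) (hj : Even j) :
    ‖u (i + 1) (j + 1) - u i j‖ ^ 2 = 1 := by
  obtain ⟨a, rfl⟩ := hi
  obtain ⟨b, rfl⟩ := hj
  rw [norm_sq_u_sub (m := 1) (n := 0) (p := -1) (q := 1) (by omega) (by omega) (by omega)
    (by omega)]
  norm_num

theorem norm_sq_antidiag {i j : ℤ} (hi : Even i) (hj : Odd j) :
    ‖u (i + 1) j - u i (j + 1)‖ ^ 2 = 1 := by
  obtain ⟨a, rfl⟩ := hi
  obtain ⟨b, rfl⟩ := hj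
  rw [norm_sq_u_sub (m := 0) (n := -1) (p := 1) (q := 1) (by omega) (by omega) (by omega)
    (by omega)]
  norm_num

theorem norm_sq_diag_of_square {i j : ℤ} (h : Even (i + j)) :
    ‖u (i + 1) (j + 1) - u i j‖ ^ 2 = 2 := by
  rcases Int.even_or_odd' i with ⟨a, rfl | rfl⟩ <;> rcases Int.even_or_odd' j with ⟨b, rfl | rfl⟩
  · rw [norm_sq_u_sub (m := 0) (n := 0) (p := 1) (q := 1) (by omega) (by omega) (by omega)
      (by omega)]
    norm_num
  · obtain ⟨c, hc⟩ := h
    omega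
  · obtain ⟨c, hc⟩ := h
    omega
  · rw [norm_sq_u_sub (m := 1) (n := 1) (p := -1) (q := -1) (by omega) (by omega) (by omega)
      (by omega)]
    norm_num

theorem norm_sq_antidiag_of_square {i j : ℤ} (h : Even (i + j)) :
    ‖u (i + 1) j - u i (j + 1)‖ ^ 2 = 2 := by
  rcases Int.even_or_odd' i with ⟨a, rfl | rfl⟩ <;> rcases Int.even_or_odd' j with ⟨b, rfl | rfl⟩
  · rw [norm_sq_u_sub (m := 0) (n := 0) (p := 1) (q := -1) (by omega) (by omega) (by omega)
      (by omega)]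
    norm_num
  · obtain ⟨c, hc⟩ := h
    omega
  · obtain ⟨c, hc⟩ := h
    omega
  · rw [norm_sq_u_sub (m := 1) (n := -1) (p := -1) (q := 1) (by omega) (by omega) (by omega)
      (by omega)]
    norm_num

theorem norm_sq_flipVert (g : GridFlag) : ‖pos g.flipVert.pt - pos g.pt‖ ^ 2 = 1 := by
  obtain ⟨i, j, s, t, w⟩ := g
  cases w
  · cases s
    · rw [norm_sub_rev]
      simpa [pos, pt, flipVert, ← sub_eq_add_neg] using norm_sq_right (i - 1) j
    · simpa [pos, pt, flipVert] using norm_sq_right i j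
  · cases t
    · rw [norm_sub_rev]
      simpa [pos, pt, flipVert, ← sub_eq_add_neg] using norm_sq_up i (j - 1)
    · simpa [pos, pt, flipVert] using norm_sq_up i j

/-- The diagonals of squares and of pairs of triangles. -/
theorem pair_flipDiag (g : GridFlag) : ∃ i j : ℤ,
    ((g.IsSquare ↔ Even (i + j)) ∧ (g.IsBase ↔ Odd i ∧ Even j) ∧
      ({g.pt, g.flipDiag.pt} : Set (ℤ × ℤ)) = {(i, j), (i + 1, j + 1)}) ∨
    ((g.IsSquare ↔ Even (i + j)) ∧ (g.IsBase ↔ Even i ∧ Odd j) ∧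
      ({g.pt, g.flipDiag.pt} : Set (ℤ × ℤ)) = {(i + 1, j), (i, j + 1)}) := by
  obtain ⟨i, j, s, t, w⟩ := g
  cases s <;> cases t
  · refine ⟨i - 1, j - 1, Or.inl ⟨?_, ?_, ?_⟩⟩
    · simp [GridFlag.IsSquare, Int.even_add]
      grind
    · simp [IsBase, GridFlag.IsSquare, Int.even_add]
      grind
    · simp [pt, flipDiag, Set.pair_comm, sub_eq_add_neg]
  · refine ⟨i - 1, j, Or.inr ⟨?_, ?_, ?_⟩⟩
    · simp [GridFlag.IsSquare, Int.even_add]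
      grind
    · simp [IsBase, GridFlag.IsSquare, Int.even_add]
      grind
    · simp [pt, flipDiag, sub_eq_add_neg]
  · refine ⟨i, j - 1, Or.inr ⟨?_, ?_, ?_⟩⟩
    · simp [GridFlag.IsSquare, Int.even_add]
      grind
    · simp [IsBase, GridFlag.IsSquare, Int.even_add]
      grind
    · simp [pt, flipDiag, Set.pair_comm, sub_eq_add_neg]
  · refine ⟨i, j, Or.inl ⟨?_, ?_, ?_⟩⟩
    · simp [GridFlag.IsSquare, Int.even_add]
    · simp [IsBase, GridFlag.IsSquare, Int.even_add]
      grind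
    · simp [pt, flipDiag]

end SnubSquare

namespace SnubSquare

open GridFlag

/-- The faces, in terms of the lower left corner of the square of the flag. -/
theorem exists_face_eq (g : GridFlag) : ∃ i j : ℤ,
    (Even (i + j) ∧ g.face = {(i, j), (i + 1, j), (i + 1, j + 1), (i, j + 1)}) ∨
    (Odd i ∧ Even j ∧ g.face = {(i, j), (i + 1, j), (i + 1, j + 1)}) ∨
    (Odd i ∧ Even j ∧ g.face = {(i, j), (i + 1, j + 1), (i, j + 1)}) ∨
    (Even i ∧ Odd j ∧ g.face = {(i, j), (i + 1, j), (i, j + 1)}) ∨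
    (Even i ∧ Odd j ∧ g.face = {(i + 1, j), (i + 1, j + 1), (i, j + 1)}) := by
  obtain ⟨i, j, s, t, w⟩ := g
  refine ⟨if s then i else i - 1, if t then j else j - 1, ?_⟩
  by_cases hs : GridFlag.IsSquare ⟨i, j, s, t, w⟩
  · left
    rw [GridFlag.face, if_pos hs]
    constructor
    · simp only [GridFlag.IsSquare, Int.even_iff] at hs ⊢
      cases s <;> cases t <;> simp at hs ⊢ <;> omega
    · ext ⟨x, y⟩
      cases s <;> cases t <;> cases w <;> simp [pt, flipVert, flipEdge, flipDiag] <;> omega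
  · right
    rw [GridFlag.face, if_neg hs]
    by_cases hb : IsBase ⟨i, j, s, t, w⟩
    · rw [if_pos hb]
      obtain ⟨-, hb⟩ := hb
      simp only [GridFlag.IsSquare, Int.even_iff, Int.odd_iff] at hs hb ⊢
      have hA : s = t → (if s then i else i - 1) % 2 = 1 ∧ (if t then j else j - 1) % 2 = 0 := by
        cases s <;> cases t <;> simp at hs hb ⊢ <;> omega
      have hB : s ≠ t → (if s then i else i - 1) % 2 = 0 ∧ (if t then j else j - 1) % 2 = 1 := by
        cases s <;> cases t <;> simp at hs hb ⊢ <;> omega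
      cases s <;> cases t <;> cases w
      · exact Or.inr (Or.inl ⟨(hA rfl).1, (hA rfl).2, by
          ext ⟨x, y⟩; simp [pt, flipVert, flipDiag]; omega⟩)
      · exact Or.inl ⟨(hA rfl).1, (hA rfl).2, by
          ext ⟨x, y⟩; simp [pt, flipVert, flipDiag]; omega⟩
      · exact Or.inr (Or.inr (Or.inl ⟨(hB (by simp)).1, (hB (by simp)).2, by
          ext ⟨x, y⟩; simp [pt, flipVert, flipDiag]; omega⟩))
      · exact Or.inr (Or.inr (Or.inr ⟨(hB (by simp)).1, (hB (by simp)).2, by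
          ext ⟨x, y⟩; simp [pt, flipVert, flipDiag]; omega⟩))
      · exact Or.inr (Or.inr (Or.inr ⟨(hB (by simp)).1, (hB (by simp)).2, by
          ext ⟨x, y⟩; simp [pt, flipVert, flipDiag]; omega⟩))
      · exact Or.inr (Or.inr (Or.inl ⟨(hB (by simp)).1, (hB (by simp)).2, by
          ext ⟨x, y⟩; simp [pt, flipVert, flipDiag]; omega⟩))
      · exact Or.inl ⟨(hA rfl).1, (hA rfl).2, by
          ext ⟨x, y⟩; simp [pt, flipVert, flipDiag]⟩
      · exact Or.inr (Or.inl ⟨(hA rfl).1, (hA rfl).2, by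
          ext ⟨x, y⟩; simp [pt, flipVert, flipDiag]; omega⟩)
    · rw [if_neg hb]
      have hb' : ¬ (s = true ↔ Even j) := fun h => hb ⟨hs, h⟩
      clear hb
      simp only [GridFlag.IsSquare, Int.even_iff, Int.odd_iff] at hs hb' ⊢
      have hA : s ≠ t → (if s then i else i - 1) % 2 = 1 ∧ (if t then j else j - 1) % 2 = 0 := by
        cases s <;> cases t <;> simp at hs hb' ⊢ <;> omega
      have hB : s = t → (if s then i else i - 1) % 2 = 0 ∧ (if t then j else j - 1) % 2 = 1 := by
        cases s <;> cases t <;> simp at hs hb' ⊢ <;> omega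
      cases s <;> cases t
      · exact Or.inr (Or.inr (Or.inr ⟨(hB rfl).1, (hB rfl).2, by
          ext ⟨x, y⟩; cases w <;> simp [pt, flipVert, flipEdge] <;> omega⟩))
      · exact Or.inl ⟨(hA (by simp)).1, (hA (by simp)).2, by
          ext ⟨x, y⟩; cases w <;> simp [pt, flipVert, flipEdge] <;> omega⟩
      · exact Or.inr (Or.inl ⟨(hA (by simp)).1, (hA (by simp)).2, by
          ext ⟨x, y⟩; cases w <;> simp [pt, flipVert, flipEdge] <;> omega⟩)
      · exact Or.inr (Or.inr (Or.inl ⟨(hB rfl).1, (hB rfl).2, by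
          ext ⟨x, y⟩; cases w <;> simp [pt, flipVert, flipEdge] <;> omega⟩))

theorem faces_eq : E₂.faces = (fun s => convexHull ℝ (pos '' s)) ''
    {s | ∃ g : GridFlag, s = g.face} := by
  ext s
  constructor
  · rintro ⟨i, j, ⟨h, rfl⟩ | ⟨hi, hj, rfl⟩ | ⟨hi, hj, rfl⟩ | ⟨hi, hj, rfl⟩ | ⟨hi, hj, rfl⟩⟩
    · have hs : GridFlag.IsSquare ⟨i, j, true, true, false⟩ := by simpa [GridFlag.IsSquare] using h
      refine ⟨_, ⟨⟨i, j, true, true, false⟩, rfl⟩, ?_⟩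
      simp only [GridFlag.face, if_pos hs]
      congr 1
      simp [Set.image_insert_eq, pos, pt, flipVert, flipEdge, flipDiag, Set.pair_comm]
    · have hb : IsBase ⟨i, j, true, true, false⟩ := by
        simp [IsBase, GridFlag.IsSquare, Int.even_add, hi, hj]
      refine ⟨_, ⟨⟨i, j, true, true, false⟩, rfl⟩, ?_⟩
      simp only [GridFlag.face, if_neg hb.1, if_pos hb]
      congr 1
      simp [Set.image_insert_eq, pos, pt, flipVert, flipDiag]
    · have hb : IsBase ⟨i, j, true, true, true⟩ := by
        simp [IsBase, GridFlag.IsSquare, Int.even_add, hi, hj]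
      refine ⟨_, ⟨⟨i, j, true, true, true⟩, rfl⟩, ?_⟩
      simp only [GridFlag.face, if_neg hb.1, if_pos hb]
      congr 1
      simp [Set.image_insert_eq, pos, pt, flipVert, flipDiag, Set.pair_comm]
    · have hs : ¬ GridFlag.IsSquare ⟨i, j, true, true, false⟩ := by
        simp [GridFlag.IsSquare, Int.even_add, hi, hj]
      have hb : ¬ IsBase ⟨i, j, true, true, false⟩ := by simp [IsBase, hj]
      refine ⟨_, ⟨⟨i, j, true, true, false⟩, rfl⟩, ?_⟩
      simp only [GridFlag.face, if_neg hs, if_neg hb]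
      congr 1
      simp [Set.image_insert_eq, pos, pt, flipVert, flipEdge]
    · have hs : ¬ GridFlag.IsSquare ⟨i + 1, j + 1, false, false, true⟩ := by
        simp [GridFlag.IsSquare, Int.even_add, hi, hj]
      have hb : ¬ IsBase ⟨i + 1, j + 1, false, false, true⟩ := by
        simp [IsBase, hj]
      refine ⟨_, ⟨⟨i + 1, j + 1, false, false, true⟩, rfl⟩, ?_⟩
      simp only [GridFlag.face, if_neg hs, if_neg hb]
      congr 1
      simp [Set.image_insert_eq, pos, pt, flipVert, flipEdge]
      grind
  · rintro ⟨_, ⟨g, rfl⟩, rfl⟩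
    obtain ⟨i, j, ⟨h, e⟩ | ⟨hi, hj, e⟩ | ⟨hi, hj, e⟩ | ⟨hi, hj, e⟩ | ⟨hi, hj, e⟩⟩ :=
      exists_face_eq g
    all_goals
      refine ⟨i, j, ?_⟩
      simp only [e, Set.image_insert_eq, Set.image_singleton, pos]
    · exact Or.inl ⟨h, trivial⟩
    · exact Or.inr (Or.inl ⟨hi, hj, trivial⟩)
    · exact Or.inr (Or.inr (Or.inl ⟨hi, hj, trivial⟩))
    · exact Or.inr (Or.inr (Or.inr (Or.inl ⟨hi, hj, trivial⟩)))
    · exact Or.inr (Or.inr (Or.inr (Or.inr ⟨hi, hj, trivial⟩)))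

theorem edges_eq : E₂.edges = (fun s => convexHull ℝ (pos '' s)) ''
    {s | ∃ g : GridFlag, s = {g.pt, g.flipVert.pt} ∨ (g.IsBase ∧ s = {g.pt, g.flipDiag.pt})} := by
  ext s
  constructor
  · rintro ⟨i, j, rfl | rfl | ⟨hi, hj, rfl⟩ | ⟨hi, hj, rfl⟩⟩
    · refine ⟨_, ⟨⟨i, j, true, true, false⟩, Or.inl rfl⟩, ?_⟩
      simp [Set.image_pair, pos, pt, flipVert]
    · refine ⟨_, ⟨⟨i, j, true, true, true⟩, Or.inl rfl⟩, ?_⟩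
      simp [Set.image_pair, pos, pt, flipVert]
    · have hb : IsBase ⟨i, j, true, true, false⟩ := by
        simp [IsBase, GridFlag.IsSquare, Int.even_add, hi, hj]
      refine ⟨_, ⟨_, Or.inr ⟨hb, rfl⟩⟩, ?_⟩
      simp [Set.image_pair, pos, pt, flipDiag]
    · have hb : IsBase ⟨i, j + 1, true, false, false⟩ := by
        simp [IsBase, GridFlag.IsSquare, Int.even_add, hi, hj]
      refine ⟨_, ⟨_, Or.inr ⟨hb, rfl⟩⟩, ?_⟩
      simp [Set.image_pair, pos, pt, flipDiag, segment_symm]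
  · rintro ⟨_, ⟨g, rfl | ⟨hg, rfl⟩⟩, rfl⟩
    · obtain ⟨i, j, s, t, w⟩ := g
      cases w
      · refine ⟨if s then i else i - 1, j, Or.inl ?_⟩
        cases s <;> simp [Set.image_pair, pos, pt, flipVert, segment_symm, sub_eq_add_neg]
      · refine ⟨i, if t then j else j - 1, Or.inr (Or.inl ?_)⟩
        cases t <;> simp [Set.image_pair, pos, pt, flipVert, segment_symm, sub_eq_add_neg]
    · obtain ⟨i, j, ⟨-, h, e⟩ | ⟨-, h, e⟩⟩ := pair_flipDiag g
      · refine ⟨i, j, Or.inr (Or.inr (Or.inl ⟨(h.1 hg).1, (h.1 hg).2, ?_⟩))⟩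
        simp only [e, Set.image_pair, convexHull_pair, pos]
      · refine ⟨i, j, Or.inr (Or.inr (Or.inr ⟨(h.1 hg).1, (h.1 hg).2, ?_⟩))⟩
        simp only [e, Set.image_pair, convexHull_pair, pos]

end SnubSquare

namespace SnubSquare

open GridFlag

theorem norm_pos_sub_of_pair_eq {a b c d : ℤ × ℤ} (h : ({a, b} : Set (ℤ × ℤ)) = {c, d}) :
    ‖pos b - pos a‖ = ‖pos d - pos c‖ := by
  rcases Set.pair_eq_pair_iff.1 h with ⟨rfl, rfl⟩ | ⟨rfl, rfl⟩
  · rfl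
  · exact norm_sub_rev _ _

theorem norm_sq_flipDiag_of_isBase {g : GridFlag} (hg : g.IsBase) :
    ‖pos g.flipDiag.pt - pos g.pt‖ ^ 2 = 1 := by
  obtain ⟨i, j, ⟨-, h, e⟩ | ⟨-, h, e⟩⟩ := pair_flipDiag g
  · rw [norm_pos_sub_of_pair_eq e]
    exact norm_sq_diag (h.1 hg).1 (h.1 hg).2
  · rw [norm_pos_sub_of_pair_eq e, norm_sub_rev]
    exact norm_sq_antidiag (h.1 hg).1 (h.1 hg).2

theorem norm_sq_flipDiag_of_isSquare {g : GridFlag} (hg : g.IsSquare) :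
    ‖pos g.flipDiag.pt - pos g.pt‖ ^ 2 = 2 := by
  obtain ⟨i, j, ⟨h, -, e⟩ | ⟨h, -, e⟩⟩ := pair_flipDiag g
  · rw [norm_pos_sub_of_pair_eq e]
    exact norm_sq_diag_of_square (h.1 hg)
  · rw [norm_pos_sub_of_pair_eq e, norm_sub_rev]
    exact norm_sq_antidiag_of_square (h.1 hg)

theorem norm_sq_flipEdge_flipVert (g : GridFlag) :
    ‖pos g.flipEdge.flipVert.pt - pos g.pt‖ ^ 2 = 1 := norm_sq_flipVert g.flipEdge

theorem norm_sq_flipDiag_sub_flipVert (g : GridFlag) :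
    ‖pos g.flipDiag.pt - pos g.flipVert.pt‖ ^ 2 = 1 := by
  rw [← flipVert_flipEdge_flipVert]
  exact norm_sq_flipEdge_flipVert g.flipVert

theorem norm_sq_flipDiag_sub_flipEdge_flipVert (g : GridFlag) :
    ‖pos g.flipDiag.pt - pos g.flipEdge.flipVert.pt‖ ^ 2 = 1 := by
  have h : g.flipEdge.flipDiag.pt = g.flipDiag.pt := rfl
  rw [← h]
  exact norm_sq_flipDiag_sub_flipVert g.flipEdge

/-- A point at distance `1` from the ends of a segment is at distance at most `1` from its
midpoint. -/
theorem norm_sub_midpoint_sq_le {E : Type*} [NormedAddCommGroup E] [InnerProductSpace ℝ E]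
    {p d x : E} (hp : ‖x - p‖ ^ 2 = 1) (hd : ‖d - x‖ ^ 2 = 1) :
    ‖x - midpoint ℝ p d‖ ^ 2 ≤ 1 := by
  have h : x - midpoint ℝ p d = (1 / 2 : ℝ) • ((x - p) - (d - x)) := by
    rw [midpoint_eq_smul_add, invOf_eq_inv]
    module
  have h1 := parallelogram_law_with_norm ℝ (x - p) (d - x)
  rw [h, norm_smul, mul_pow]
  norm_num
  nlinarith [mul_self_nonneg ‖(x - p) + (d - x)‖]

theorem realizes_E₂ : E₂.Realizes pos
    {s | ∃ g : GridFlag, s = {g.pt, g.flipVert.pt} ∨ (g.IsBase ∧ s = {g.pt, g.flipDiag.pt})}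
    {s | ∃ g : GridFlag, s = g.face} := by
  have hmem : ∀ (s : Set (ℤ × ℤ)) (b : ℤ × ℤ), b ∈ s → (∀ a ∈ s, ‖pos a - pos b‖ ^ 2 ≤ 1) →
      ∀ a, pos a ∈ convexHull ℝ (pos '' s) → a ∈ s := fun s b hb hs a ha =>
    PlaneCells.mem_of_mem_convexHull pos_injective_of_lt hs
      (fun c hc h => hc (pos_injective h ▸ hb)) ha
  refine PlaneCells.realizes_of_convexHull pos_injective ?_ edges_eq faces_eq ?_ ?_
  · ext x
    constructor
    · rintro ⟨p, rfl⟩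
      exact ⟨p.1, p.2, rfl⟩
    · rintro ⟨i, j, rfl⟩
      exact ⟨(i, j), rfl⟩
  · rintro _ ⟨g, rfl | ⟨hg, rfl⟩⟩ a ha
    · refine hmem _ g.pt (Or.inl rfl) ?_ a ha
      rintro _ (rfl | rfl)
      · simp
      · exact (norm_sq_flipVert g).le
    · refine hmem _ g.pt (Or.inl rfl) ?_ a ha
      rintro _ (rfl | rfl)
      · simp
      · exact (norm_sq_flipDiag_of_isBase hg).le
  · rintro _ ⟨g, rfl⟩ a ha
    simp only [GridFlag.face] at ha ⊢
    split_ifs at ha ⊢ with hs hb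
    · have hP : ‖pos g.pt - midpoint ℝ (pos g.pt) (pos g.flipDiag.pt)‖ ^ 2 = 1 / 2 := by
        rw [← dist_eq_norm, dist_left_midpoint, dist_comm, dist_eq_norm, mul_pow,
          norm_sq_flipDiag_of_isSquare hs]
        norm_num
      refine PlaneCells.mem_of_mem_convexHull pos_injective_of_lt
        (o := midpoint ℝ (pos g.pt) (pos g.flipDiag.pt)) ?_ ?_ ha
      · rintro _ (rfl | rfl | rfl | rfl)
        · rw [hP]
          norm_num
        · exact norm_sub_midpoint_sq_le (norm_sq_flipVert g) (norm_sq_flipDiag_sub_flipVert g)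
        · exact norm_sub_midpoint_sq_le (norm_sq_flipEdge_flipVert g)
            (norm_sq_flipDiag_sub_flipEdge_flipVert g)
        · rw [← dist_eq_norm, dist_right_midpoint, dist_comm, dist_eq_norm, mul_pow,
            norm_sq_flipDiag_of_isSquare hs]
          norm_num
      · -- the midpoint is at distance `1 / √2` from the vertex of the flag
        intro b hb hbo
        refine hb (Or.inl (pos_injective_of_lt _ _ ?_))
        rw [hbo, norm_sub_rev, hP]
        norm_num
    · refine hmem _ g.pt (Or.inl rfl) ?_ a ha
      rintro _ (rfl | rfl | rfl)
      · simp
      · exact (norm_sq_flipVert g).le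
      · exact (norm_sq_flipDiag_of_isBase hb).le
    · refine hmem _ g.pt (Or.inl rfl) ?_ a ha
      rintro _ (rfl | rfl | rfl)
      · simp
      · exact (norm_sq_flipVert g).le
      · exact (norm_sq_flipEdge_flipVert g).le

end SnubSquare

/-! ### Uniqueness -/

namespace PlaneCells

theorem IsPolyhedralMap.exists_vert {M : PlaneCells} (hM : M.IsPolyhedralMap) :
    ∃ v, v ∈ M.verts := by
  have h0 : (0 : Plane) ∈ ⋃₀ M.faces := hM.cover ▸ trivial
  obtain ⟨f, hf, -⟩ := h0
  obtain ⟨v, -, -, -, -, -, hv, -, -⟩ := hM.exists_three_verts hf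
  exact ⟨v, hv.2⟩

end PlaneCells

theorem mainTheorem5 (Y : PlaneCells) (hY : Y.IsPolyhedralMap) :
    (Y.IsSemiEquivelarOfType [(3, 2), (4, 1), (3, 1), (4, 1)] →
      Y.Isomorphic SnubSquare.E₂) ∧
    (Y.IsSemiEquivelarOfType [(3, 1), (6, 1), (3, 1), (6, 1)] →
      Y.Isomorphic Trihexagonal.E₆) := by
  obtain ⟨v, hv⟩ := hY.exists_vert
  constructor
  · intro h
    have hT : ∀ v ∈ Y.verts, Y.HasFaceCycle v [3, 3, 4, 3, 4] := h
    have hM : Y.IsCyclicMap := ⟨hY, fun v hv => ⟨_, by simp, hT v hv⟩⟩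
    obtain ⟨b, -, -, hsz, -, -⟩ := hM.exists_vertFlags hv (by simp) (hT v hv)
    obtain ⟨α, hα⟩ := PlaneCells.exists_realizes_snubSquare hM hT (b 2) (hsz 2)
    exact hα.isomorphic SnubSquare.realizes_E₂
  · intro h
    have hT : ∀ v ∈ Y.verts, Y.HasFaceCycle v [3, 6, 3, 6] := h
    have hM : Y.IsCyclicMap := ⟨hY, fun v hv => ⟨_, by simp, hT v hv⟩⟩
    obtain ⟨b, -, -, hsz, -, -⟩ := hM.exists_vertFlags hv (by simp) (hT v hv)
    obtain ⟨α, hα⟩ := PlaneCells.exists_realizes_trihexagonal hM hT (b 1) (hsz 1)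
    exact hα.isomorphic Trihexagonal.realizes_E₆
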